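/- **Setting.** Strings are binary. For a function $g:\{0,1\}^*\to\{0,1\}^*$ let $\Sigma_0^P(g)=\mathsf P^g$ (polynomial time with a function oracle for $g$) and $\Sigma_{k+1}^P(g)=\mathsf{NP}^{\Sigma_k^P(g)}$; for a class $\mathsf C$ of string functions let $(\Sigma_k^P)^{\mathsf C}=\bigcup_{g\in\mathsf C}\Sigma_k^P(g)$. A family of real functions $F_j:D_j\to\mathbb R$, $D_j\subseteq\mathbb R^{k_j}$, named by strings $c_j$, is in the Type 2 complexity class $\mathsf C$ if there are a polynomial $m$ and a $\theta\in\mathsf C$ with polynomially long values such that for all $j$, all $i\in\mathbb N$, all $x\in D_j$ and all dyadic $d$ with $|d_l-x_l|\le 2^{-m(|c_j|+i)}$ for every coordinate $l$, the value $\theta(c_j,d,1^i)$ is (the code of) a dyadic rational $r$ with $|r-F_j(x)|<2^{-i}$. **Systems.** Consider a system $\dot x=f(x)$ on $\mathbb R^n$ with $f$ Lipschitz, and write $\Phi(t,x_0)=x_0+\int_0^t f(x(s))\,ds$, where $x(\cdot)$ is the solution with $x(0)=x_0$. Let $X=\prod_i[a_i,b_i]$ be a compact box, $T,T'>0$, and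 let $0\le \delta_1\le \varepsilon_1\le e$, $0\le\delta_1'\le d$, $0\le\varepsilon_1'\le e'$, $0\le\delta_1''\le d'$ be reals with $e,d,e',d'>0$. The bounded formula $\mathsf{A\_stable}$ is the conjunction of $$\forall \varepsilon\in[\varepsilon_1,e]\ \exists\delta\in[\delta_1,\varepsilon]\ \forall t\in[0,T]\ \forall x_0\in X\ \forall x_t\in X\ \big((\|x_0\|<\delta\wedge x_t=\Phi(t,x_0))\to\|x_t\|<\varepsilon\big)$$ and $$\exists\delta'\in[\delta_1',d]\ \forall t\in[0,T']\ \forall x_0\in X\ \forall x_t\in X\ \big((\|x_0\|<\delta'\wedge x_t=\Phi(t,x_0))\to \lim_{s\to T'}\|\Phi(s,x_0)\|=0\big),$$ where $\lim_{s\to T'}g(s)=0$ stands for the bounded formula $\forall\varepsilon'\in[\varepsilon_1',e']\ \exists\delta''\in[\delta_1'',d']\ \forall s\in[T'-\delta'',T'+\delta'']\ |g(s)|<\varepsilon'$. Implications are expanded so that the formula is built by $\wedge,\vee$ and bounded quantifiers from atoms $\tau>0$ and $\tau\ge0$; the equation $x_t=\Phi(t,x_0)$ is the atom $-\|x_t-\Phi(t,x_0)\|\ge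 0$, and $\neg(\tau>0)$, $\neg(\tau\ge 0)$ are $-\tau\ge0$, $-\tau>0$. For $\delta>0$, a $\delta$-perturbation of a formula replaces each atom $\tau>0$ (resp. $\tau\ge0$) by $\tau>c$ (resp. $\tau\ge c$) with a constant $|c|\le\delta$ depending on the atom; quantifier bounds are not changed. **Problem.** Let $S$ be a set of strings, each $w\in S$ being the code of a system with bounds as above. The bounded asymptotic $\delta$-stability problem for $S$ asks, on input $(w,1^n,\delta)$ with $w\in S$, $n$ the dimension of the system coded by $w$, and $\delta\in\mathbb Q^+$ in binary, for one of the answers *stable* ($\mathsf{A\_stable}$ of the system coded by $w$ is true) or *$\delta$-unstable* (some $\delta$-perturbation of this formula is false); if both are correct, either may be given. **Theorem.** Let $\mathsf C$ be a class of string functions. Suppose that the terms of the representations of the systems coded by $w\in S$ are in the Type 2 complexity class $\mathsf C$, that is, the family consisting, for all $w\in S$, of the coordinate functions $\Phi_i$ of the flow on $([0,T]\cup[0,T']\cup[T'-d',T'+d'])\times X$ and of the constants (0-ary functions) $a_i,b_i,T,T',\varepsilon_1,e,\delta_1,\delta_1',d,\varepsilon_1',e',\delta_1'',d'$, each named by $w$,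 $1^n$ and a tag for the term. Then bounded asymptotic $\delta$-stability is in $(\Sigma_4^P)^{\mathsf C}$: there is a language in $(\Sigma_4^P)^{\mathsf C}$ such that answering *stable* for its members and *$\delta$-unstable* for its non-members is correct for all inputs. -/

import Mathlib

noncomputable section

namespace DeltaStab

/-! ### Strings -/

/-- A finite list of binary strings as one binary string: each bit `b` becomes `1b`, and each
string is terminated by `0`. -/
def encodeList (l : List (List Bool)) : List Bool :=
  l.flatMap fun s => (s.flatMap fun b => [true, b]) ++ [false]

/-- The number `k` in unary. -/
def unary (k : ℕ) : List Bool := List.replicate k true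

/-- The dyadic rational `m / 2 ^ k` represented by the pair `(m, k)`. -/
def dyadicVal (r : ℤ × ℕ) : ℝ := (r.1 : ℝ) / 2 ^ r.2

/-- The string for the dyadic `m / 2 ^ k`: sign, binary digits of `|m|`, and `k` in unary (so the
length is about the number of digits before and after the binary point). -/
def encodeDyadic (r : ℤ × ℕ) : List Bool :=
  encodeList [[decide (r.1 < 0)], Nat.bits r.1.natAbs, unary r.2]

/-- The string for a positive rational: numerator and denominator in binary. -/
def encodeRat (q : ℚ) : List Bool :=
  encodeList [Nat.bits q.num.natAbs, Nat.bits q.den]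

/-! ### Oracle machines and the relativized polynomial hierarchy -/

/-- A function-oracle Turing machine: a finite multi-stack machine (Mathlib's `TM2`) over the
binary alphabet, with an input stack, a query stack, and two distinguished control labels
`ask`, `answer`. -/
structure OracleTM where
  K : Type
  [decEqK : DecidableEq K]
  [finK : Finite K]
  Λ : Type
  [finΛ : Finite Λ]
  σ : Type
  [finσ : Finite σ]
  input : K
  query : K
  main : Λ
  ask : Λ
  answer : Λ
  start : σ
  accept : σ → Bool
  prog : Λ → Turing.TM2.Stmt (fun _ : K => Bool) Λ σ

attribute [instance] OracleTM.decEqK OracleTM.finK OracleTM.finΛ OracleTM.finσ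

namespace OracleTM

abbrev Cfg (M : OracleTM) : Type := Turing.TM2.Cfg (fun _ : M.K => Bool) M.Λ M.σ

def initCfg (M : OracleTM) (x : List Bool) : M.Cfg where
  l := some M.main
  var := M.start
  stk := Function.update (fun _ => []) M.input x

open Classical in
/-- One step with oracle `g`. At the label `ask` the string `s` on the query stack is replaced by
`g s` and control passes to `answer`; at any other label the program of that label is executed.
A halted configuration (no label) does not change. -/
def step (M : OracleTM) (g : List Bool → List Bool) (c : M.Cfg) : M.Cfg :=
  match c.l with
  | none => c
  | some l =>
    if l = M.ask then
      { c with
        l := some M.answer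
        stk := Function.update c.stk M.query (g (c.stk M.query)) }
    else Turing.TM2.stepAux (M.prog l) c.var c.stk

/-- With oracle `g`, the machine halts on `x` within `t` steps and accepts iff `x ∈ L`. -/
def DecidesWithin (M : OracleTM) (g : List Bool → List Bool) (L : Set (List Bool))
    (x : List Bool) (t : ℕ) : Prop :=
  ((M.step g)^[t] (M.initCfg x)).l = none ∧
    (M.accept ((M.step g)^[t] (M.initCfg x)).var = true ↔ x ∈ L)

end OracleTM

/-- `P^g`. -/
def PTime (g : List Bool → List Bool) : Set (Set (List Bool)) :=
  {L | ∃ (M : OracleTM) (p : Polynomial ℕ), ∀ x, M.DecidesWithin g L x (p.eval x.length)}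

/-- `NP^g`: membership has polynomially short certificates checked in `P^g`. -/
def NPTime (g : List Bool → List Bool) : Set (Set (List Bool)) :=
  {L | ∃ V ∈ PTime g, ∃ p : Polynomial ℕ, ∀ x,
    x ∈ L ↔ ∃ y : List Bool, y.length ≤ p.eval x.length ∧ encodeList [x, y] ∈ V}

open Classical in
/-- A set oracle as a function oracle. -/
def charFn (B : Set (List Bool)) (x : List Bool) : List Bool := [decide (x ∈ B)]

/-- `Σ₀^P(g) = P^g` and `Σ_{k+1}^P(g) = NP^{Σ_k^P(g)}`. -/
def SigmaP (g : List Bool → List Bool) : ℕ → Set (Set (List Bool))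
  | 0 => PTime g
  | k + 1 => {L | ∃ B ∈ SigmaP g k, L ∈ NPTime (charFn B)}

/-- `(Σ_k^P)^C`, for a class `C` of string functions used as oracles. -/
def SigmaPClass (C : Set (List Bool → List Bool)) (k : ℕ) : Set (Set (List Bool)) :=
  {L | ∃ g ∈ C, L ∈ SigmaP g k}

/-! ### Type 2 complexity of real functions -/

/-- A real function `f :⊆ ℝ^arity → ℝ` with domain `dom`. -/
structure RealFn where
  arity : ℕ
  dom : Set (Fin arity → ℝ)
  toFun : (Fin arity → ℝ) → ℝ

/-- The real functions `F j`, with names `code j`, are in the Type 2 complexity class given by the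
class `C` of string functions: there are a polynomial modulus `m` and a function `θ` in `C`, with
polynomially long values, such that from any dyadic `2^{-m}`-approximation `d` of any point `x` of
the domain, `θ` produces a dyadic `2^{-i}`-approximation of `F j x`. For a single function (`j`
ranging over one element) `code j` is a constant, and this is the usual representation `(m, θ)`;
for `C` the polynomial time (space) functions one gets polynomial time (space) computable real
functions. For a family the representation is uniform in the code. -/
def InType2Class (C : Set (List Bool → List Bool)) {ι : Type} (code : ι → List Bool)
    (F : ι → RealFn) : Prop :=
  ∃ θ ∈ C, ∃ m p : Polynomial ℕ, (∀ x, (θ x).length ≤ p.eval x.length) ∧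
    ∀ (j : ι) (i : ℕ), ∀ x ∈ (F j).dom, ∀ d : Fin (F j).arity → ℤ × ℕ,
      (∀ l, |dyadicVal (d l) - x l| ≤ (2 : ℝ)⁻¹ ^ (m.eval ((code j).length + i))) →
      ∃ r : ℤ × ℕ,
        θ (encodeList [code j, encodeList (List.ofFn fun l => encodeDyadic (d l)), unary i])
          = encodeDyadic r ∧
        |dyadicVal r - (F j).toFun x| < (2 : ℝ)⁻¹ ^ i

/-! ### Bounded first-order formulas over the reals and their perturbations -/

/-- A term with variables in `V`, identified with the real function of the assignment that it
denotes. -/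
abbrev Term (V : Type) : Type := (V → ℝ) → ℝ

/-- Formulas with atoms `t > 0`, `t ≥ 0` and bounded quantifiers `∀^{[u,v]} x`, `∃^{[u,v]} x`. -/
inductive Formula (V : Type) : Type
  | gt (t : Term V) : Formula V
  | ge (t : Term V) : Formula V
  | and (φ ψ : Formula V) : Formula V
  | or (φ ψ : Formula V) : Formula V
  | all (x : V) (u v : Term V) (φ : Formula V) : Formula V
  | ex (x : V) (u v : Term V) (φ : Formula V) : Formula V

namespace Formula

variable {V : Type}

def Holds [DecidableEq V] : Formula V → (V → ℝ) → Prop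
  | gt t, a => t a > 0
  | ge t, a => t a ≥ 0
  | and φ ψ, a => φ.Holds a ∧ ψ.Holds a
  | or φ ψ, a => φ.Holds a ∨ ψ.Holds a
  | all x u v φ, a => ∀ r : ℝ, u a ≤ r ∧ r ≤ v a → φ.Holds (Function.update a x r)
  | ex x u v φ, a => ∃ r : ℝ, (u a ≤ r ∧ r ≤ v a) ∧ φ.Holds (Function.update a x r)

/-- Truth of a sentence (the assignment is irrelevant if no variable is free). -/
def IsTrue [DecidableEq V] (φ : Formula V) : Prop := φ.Holds fun _ => 0

/-- Negation, as an operation on formulas. -/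
def neg : Formula V → Formula V
  | gt t => ge fun a => -t a
  | ge t => gt fun a => -t a
  | and φ ψ => or φ.neg ψ.neg
  | or φ ψ => and φ.neg ψ.neg
  | all x u v φ => ex x u v φ.neg
  | ex x u v φ => all x u v φ.neg

def imp (φ ψ : Formula V) : Formula V := or φ.neg ψ

/-- `s < t`, i.e. `t - s > 0`. -/
def lt (s t : Term V) : Formula V := gt fun a => t a - s a

/-- `∀^X` for a box `X`: one bounded quantifier for each coordinate. -/
def allBox {n : ℕ} (x : Fin n → V) (lo hi : Fin n → ℝ) (φ : Formula V) : Formula V :=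
  (List.finRange n).foldr (fun i ψ => all (x i) (fun _ => lo i) (fun _ => hi i) ψ) φ

/-- `IsPerturbation δ φ φ'`: `φ'` arises from `φ` by replacing each atom `t > 0` by `t > c` and
each atom `t ≥ 0` by `t ≥ c`, with a constant `c ∈ [-δ, δ]` for each occurrence of an atom. The
bounds of the quantifiers are kept. -/
inductive IsPerturbation (δ : ℝ) : Formula V → Formula V → Prop
  | gt (t : Term V) (c : ℝ) (hc : |c| ≤ δ) : IsPerturbation δ (gt t) (gt fun a => t a - c)
  | ge (t : Term V) (c : ℝ) (hc : |c| ≤ δ) : IsPerturbation δ (ge t) (ge fun a => t a - c)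
  | and {φ φ' ψ ψ' : Formula V} (h₁ : IsPerturbation δ φ φ') (h₂ : IsPerturbation δ ψ ψ') :
      IsPerturbation δ (and φ ψ) (and φ' ψ')
  | or {φ φ' ψ ψ' : Formula V} (h₁ : IsPerturbation δ φ φ') (h₂ : IsPerturbation δ ψ ψ') :
      IsPerturbation δ (or φ ψ) (or φ' ψ')
  | all (x : V) (u v : Term V) {φ φ' : Formula V} (h : IsPerturbation δ φ φ') :
      IsPerturbation δ (all x u v φ) (all x u v φ')
  | ex (x : V) (u v : Term V) {φ φ' : Formula V} (h : IsPerturbation δ φ φ') :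
      IsPerturbation δ (ex x u v φ) (ex x u v φ')

end Formula

/-! ### Continuous systems and bounded asymptotic stability -/

/-- The solution of `x' = f(x)`, `x(0) = x₀` (in integral form); it exists on all of `ℝ` and is
unique when `f` is Lipschitz. -/
def trajectory {n : ℕ} (f : EuclideanSpace ℝ (Fin n) → EuclideanSpace ℝ (Fin n))
    (x₀ : EuclideanSpace ℝ (Fin n)) : ℝ → EuclideanSpace ℝ (Fin n) :=
  Classical.epsilon fun x => Continuous x ∧ ∀ t : ℝ, x t = x₀ + ∫ s in (0 : ℝ)..t, f (x s)

/-- The right-hand side `∫_0^t f(x(s)) ds + x₀` of the flow equation. -/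
def flowMap {n : ℕ} (f : EuclideanSpace ℝ (Fin n) → EuclideanSpace ℝ (Fin n))
    (t : ℝ) (x₀ : EuclideanSpace ℝ (Fin n)) : EuclideanSpace ℝ (Fin n) :=
  (∫ s in (0 : ℝ)..t, f (trajectory f x₀ s)) + x₀

/-- The real constants that bound the quantifiers (apart from the box `X`). -/
inductive Bound : Type
  | εlo | εhi | δlo | T | T' | δ'lo | δ'hi | ε'lo | ε'hi | δ''lo | δ''hi

/-- An `n`-dimensional system `x' = f(x)` with `f` Lipschitz, together with quantifier bounds:
a box `X = ∏ [lo i, hi i]`, time bounds `T`, `T'`, and nonempty closed intervals for the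
quantified `ε`, `δ`, `δ'` and for the `ε'`, `δ''` of the limit. Lower bounds equal to `0` are
allowed. -/
structure BoundedSystem where
  n : ℕ
  f : EuclideanSpace ℝ (Fin n) → EuclideanSpace ℝ (Fin n)
  lipschitz : ∃ k : NNReal, LipschitzWith k f
  lo : Fin n → ℝ
  hi : Fin n → ℝ
  lo_le_hi : ∀ i, lo i ≤ hi i
  b : Bound → ℝ
  T_pos : 0 < b .T
  T'_pos : 0 < b .T'
  δ_nonneg : 0 ≤ b .δlo
  δ_le : b .δlo ≤ b .εlo
  ε_le : b .εlo ≤ b .εhi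
  ε_pos : 0 < b .εhi
  δ'_nonneg : 0 ≤ b .δ'lo
  δ'_le : b .δ'lo ≤ b .δ'hi
  δ'_pos : 0 < b .δ'hi
  ε'_nonneg : 0 ≤ b .ε'lo
  ε'_le : b .ε'lo ≤ b .ε'hi
  ε'_pos : 0 < b .ε'hi
  δ''_nonneg : 0 ≤ b .δ''lo
  δ''_le : b .δ''lo ≤ b .δ''hi
  δ''_pos : 0 < b .δ''hi

/-- The variables of the stability formula. -/
inductive Var (n : ℕ) : Type
  | ε | δ | t | δ' | ε' | δ'' | s
  | x₀ (i : Fin n)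
  | xₜ (i : Fin n)
  deriving DecidableEq

namespace BoundedSystem

variable (B : BoundedSystem)

/-- The vector of values of the variables `x i`. -/
def vec {n : ℕ} (x : Fin n → Var n) (a : Var n → ℝ) : EuclideanSpace ℝ (Fin n) :=
  WithLp.toLp 2 fun i => a (x i)

/-- A quantifier bound, as a 0-ary term. -/
def const (k : Bound) : Term (Var B.n) := fun _ => B.b k

/-- The formula `x_t = ∫_0^t f(x(s)) ds + x₀`, as the atom `-‖x_t - (∫_0^t f(x(s)) ds + x₀)‖ ≥ 0`
(whose `δ`-weakening says that the norm is at most `δ`). -/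
def flow : Formula (Var B.n) :=
  .ge fun a => -‖vec .xₜ a - flowMap B.f (a .t) (vec .x₀ a)‖

/-- The bounded formula for `lim_{s → T'} g(s) = c`: for all `ε'` there is `δ''` such that
`|g(s) - c| < ε'` for all `s ∈ [T' - δ'', T' + δ'']`. -/
def limAtT' (g : Term (Var B.n)) (c : ℝ) : Formula (Var B.n) :=
  .all .ε' (B.const .ε'lo) (B.const .ε'hi) <|
  .ex .δ'' (B.const .δ''lo) (B.const .δ''hi) <|
  .all .s (fun a => B.b .T' - a .δ'') (fun a => B.b .T' + a .δ'') <|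
  .lt (fun a => |g a - c|) (fun a => a .ε')

/-- The bounded form of Lyapunov stability. -/
def lStable : Formula (Var B.n) :=
  .all .ε (B.const .εlo) (B.const .εhi) <|
  .ex .δ (B.const .δlo) (fun a => a .ε) <|
  .all .t (fun _ => 0) (B.const .T) <|
  .allBox .x₀ B.lo B.hi <| .allBox .xₜ B.lo B.hi <|
  .imp (.and (.lt (fun a => ‖vec .x₀ a‖) (fun a => a .δ)) B.flow)
    (.lt (fun a => ‖vec .xₜ a‖) (fun a => a .ε))

/-- The bounded form of convergence to the origin, with `x_s = ∫_0^s f(x(r)) dr + x₀` in the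
limit. -/
def attractive : Formula (Var B.n) :=
  .ex .δ' (B.const .δ'lo) (B.const .δ'hi) <|
  .all .t (fun _ => 0) (B.const .T') <|
  .allBox .x₀ B.lo B.hi <| .allBox .xₜ B.lo B.hi <|
  .imp (.and (.lt (fun a => ‖vec .x₀ a‖) (fun a => a .δ')) B.flow)
    (B.limAtT' (fun a => ‖flowMap B.f (a .s) (vec .x₀ a)‖) 0)

/-- The bounded form of asymptotic stability. -/
def aStable : Formula (Var B.n) := .and B.lStable B.attractive

/-- The names of the terms of the representation: coordinates of the flow, endpoints of the box,
and the other quantifier bounds. -/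
inductive TermName (n : ℕ) : Type
  | flow (i : Fin n)
  | lo (i : Fin n)
  | hi (i : Fin n)
  | bound (k : Bound)

/-- A string for each term name. -/
def TermName.code {n : ℕ} : TermName n → List Bool
  | .flow i => encodeList [unary 0, unary i]
  | .lo i => encodeList [unary 1, unary i]
  | .hi i => encodeList [unary 2, unary i]
  | .bound k => encodeList [unary 3, unary k.ctorIdx]

/-- The times at which the flow occurs in the stability formula. -/
def times : Set ℝ :=
  Set.Icc 0 (B.b .T) ∪ Set.Icc 0 (B.b .T') ∪
    Set.Icc (B.b .T' - B.b .δ''hi) (B.b .T' + B.b .δ''hi)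

/-- The real function denoted by a term: for a flow coordinate, the function
`(t, x₀) ↦ (∫_0^t f(x(s)) ds + x₀)_i` on `times × X`; otherwise a constant (0-ary function). -/
def term : TermName B.n → RealFn
  | .flow i =>
    { arity := B.n + 1
      dom := {z | z 0 ∈ B.times ∧ ∀ j : Fin B.n, z j.succ ∈ Set.Icc (B.lo j) (B.hi j)}
      toFun := fun z => flowMap B.f (z 0) (WithLp.toLp 2 fun j => z j.succ) i }
  | .lo i => { arity := 0, dom := Set.univ, toFun := fun _ => B.lo i }
  | .hi i => { arity := 0, dom := Set.univ, toFun := fun _ => B.hi i }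
  | .bound k => { arity := 0, dom := Set.univ, toFun := fun _ => B.b k }

end BoundedSystem

/-- All terms in the representations of the systems `sys w`, `w ∈ S`, are in the Type 2 complexity
class `C`. -/
def TermsInClass (C : Set (List Bool → List Bool)) (S : Set (List Bool))
    (sys : S → BoundedSystem) : Prop :=
  InType2Class C (ι := (w : S) × BoundedSystem.TermName (sys w).n)
    (fun j => encodeList [j.1.1, unary (sys j.1).n, j.2.code])
    (fun j => (sys j.1).term j.2)

/-- The input string of the stability problem for the system with code `w` and the rational `δ`. -/
def instanceCode (S : Set (List Bool)) (sys : S → BoundedSystem) (w : S) (δ : ℚ) : List Bool :=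
  encodeList [w.1, unary (sys w).n, encodeRat δ]

/-- `L` answers the bounded asymptotic `δ`-stability problem for the systems `sys w`, `w ∈ S`:
acceptance is the answer "stable", which is correct only if the stability formula is true;
rejection is the answer "`δ`-unstable", which is correct only if some `δ`-perturbation of the
formula is false. -/
def SolvesStability (S : Set (List Bool)) (sys : S → BoundedSystem) (L : Set (List Bool)) : Prop :=
  ∀ (w : S) (δ : ℚ), 0 < δ →
    (instanceCode S sys w δ ∈ L → (sys w).aStable.IsTrue) ∧
    (instanceCode S sys w δ ∉ L →
      ∃ φ, Formula.IsPerturbation (δ : ℝ) (sys w).aStable φ ∧ ¬ φ.IsTrue)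

end DeltaStab

end

/-! The quantifier alternation of `aStable` collapses, because the thresholds occur monotonically:
shrinking δ, δ' or δ'' and enlarging ε or ε' only weakens what has to be shown. As δ₁ ≤ ε₁, every
existential threshold may be taken at its lower end, and a universal one is worst at its lower end.
What remains is universal: no time in [0,T] and initial point of norm below δ₁ lead to a point of X
of norm at least ε₁, and no time within δ₁'' of T' and initial point of norm below δ₁' lead to norm
at least ε₁'. `aStable_isTrue` gives the direction needed for the exact formula, and the two
`not_strengthen_aStable` lemmas give its converse, with slack, for a perturbed formula.

A counterexample is thus a single pair of a time and a point of X. Let N be the length of the input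
and c = 2^(-N). Then c ≤ δ, since the denominator of δ is written in the input, so refuting the
formula with all atoms strengthened by c justifies the answer "δ-unstable". The slack c in each
inequality absorbs all numerical errors: the dimension occurs in unary, hence n < N, and flow values
with 2N + 5 bits determine norms well enough. A machine with the oracle for the terms checks a
rounded pair with tolerances. It accepts the rounding of every exact counterexample
(`refutesStable_of_close`, `refutesAttractive_of_close`). Conversely, whatever it accepts can be
moved to a real counterexample to the strengthened formula (`not_strengthen_of_refutesStable`,
`not_strengthen_of_refutesAttractive`). Rounded pairs are polynomially short, because the oracle's
values for the quantifier bounds are (`exists_certificate`).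

So "no short string refutes" is a correct criterion for the answer "stable". It has one universal
quantifier over a polynomial time predicate, and is placed on the fourth level by three further
quantifiers over the empty string (`exists_mem_SigmaP_four`).

Polynomial time is not shown on machines directly. Structured register programs are compiled to
oracle machines (`exec_simulation`), and `FP`, the class of functions they compute in polynomial
time, is shown to be closed under composition, pairing, branching, bounded iteration and binary
arithmetic. The verifier is then an expression in these operations. -/

noncomputable section

namespace DeltaStab

/-! ### A structured programming language for oracle machines -/

/-- Structured programs over registers `0, 1, 2, …` holding binary strings (as stacks). Register `0`
is used for input, output and oracle queries. -/
inductive Prog : Type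
  | skip
  | push (k : ℕ) (b : Bool)
  | pop (k : ℕ)
  | ask
  | seq (P Q : Prog)
  | ite (k : ℕ) (P Q R : Prog)
  | loop (k : ℕ) (P : Prog)

/-- The contents of all registers. -/
abbrev Store := ℕ → List Bool

/-- `Exec g P s s' t`: with oracle `g`, the program `P` started on `s` terminates with `s'`, at
cost `t`. `ite k P Q R` branches on the top of register `k` being `true`, `false` or missing, and
`loop k P` repeats `P` while register `k` is nonempty. -/
inductive Exec (g : List Bool → List Bool) : Prog → Store → Store → ℕ → Prop
  | skip (s) : Exec g .skip s s 0
  | push (s k b) : Exec g (.push k b) s (Function.update s k (b :: s k)) 1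
  | pop (s k) : Exec g (.pop k) s (Function.update s k (s k).tail) 1
  | ask (s) : Exec g .ask s (Function.update s 0 (g (s 0))) (3 + (g (s 0)).length)
  | seq {P Q s s₁ s₂ t₁ t₂} : Exec g P s s₁ t₁ → Exec g Q s₁ s₂ t₂ →
      Exec g (.seq P Q) s s₂ (t₁ + t₂)
  | iteTrue {k P Q R s s' t} : (s k).head? = some true → Exec g P s s' t →
      Exec g (.ite k P Q R) s s' (t + 1)
  | iteFalse {k P Q R s s' t} : (s k).head? = some false → Exec g Q s s' t →
      Exec g (.ite k P Q R) s s' (t + 1)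
  | iteNil {k P Q R s s' t} : (s k).head? = none → Exec g R s s' t →
      Exec g (.ite k P Q R) s s' (t + 1)
  | loopNil {k P s} : s k = [] → Exec g (.loop k P) s s 1
  | loopCons {k P s s₁ s₂ t₁ t₂} : s k ≠ [] → Exec g P s s₁ t₁ → Exec g (.loop k P) s₁ s₂ t₂ →
      Exec g (.loop k P) s s₂ (t₁ + t₂ + 1)

/-! ### Compilation of structured programs to oracle machines -/

namespace Prog

/-- A strict upper bound of the registers used by a program. -/
def width : Prog → ℕ
  | skip => 1
  | push k _ => k + 1
  | pop k => k + 1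
  | ask => 1
  | seq P Q => max P.width Q.width
  | ite k P Q R => max (k + 1) (max P.width (max Q.width R.width))
  | loop k P => max (k + 1) P.width

/-- Machine instructions with explicit successor addresses. -/
inductive Instr : Type
  | push (k : ℕ) (b : Bool) (e : ℕ)
  | pop (k : ℕ) (e : ℕ)
  | ask (e : ℕ)
  | br (k : ℕ) (p q r : ℕ)
  | fin

/-- `Code C H R P o e`: the instructions `C` at addresses below `H`, using registers below `R`,
implement the program `P` with entry address `o` and exit address `e`. -/
def Code (C : ℕ → Instr) (H R : ℕ) : Prog → ℕ → ℕ → Prop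
  | skip, o, e => o = e
  | push k b, o, e => o < H ∧ k < R ∧ C o = .push k b e
  | pop k, o, e => o < H ∧ k < R ∧ C o = .pop k e
  | ask, o, e => o < H ∧ C o = .ask e
  | seq P Q, o, e => ∃ m, Code C H R P o m ∧ Code C H R Q m e
  | ite k P Q T, o, e => ∃ p q r, o < H ∧ k < R ∧ C o = .br k p q r ∧
      Code C H R P p e ∧ Code C H R Q q e ∧ Code C H R T r e
  | loop k P, o, e => ∃ p, o < H ∧ k < R ∧ C o = .br k p p e ∧ Code C H R P p o

/-- The code occupies the addresses in [lo, hi) and is required to work inside every larger code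
`C'` that agrees there. This makes it possible to glue the blocks of the subprograms. The exit
address is prescribed, so a continuation is compiled before the program that leads into it. -/
theorem exists_code (P : Prog) : ∀ lo e : ℕ, ∃ (hi o : ℕ) (C : ℕ → Instr), lo ≤ hi ∧
    ∀ (C' : ℕ → Instr) (H R : ℕ), (∀ i, lo ≤ i → i < hi → C' i = C i) → hi ≤ H → P.width ≤ R →
      Code C' H R P o e := by
  induction P with
  | skip => exact fun lo e => ⟨lo, e, fun _ => .fin, le_rfl, fun C' H R _ _ _ => rfl⟩
  | push k b =>
    refine fun lo e => ⟨lo + 1, lo, fun _ => .push k b e, by omega, fun C' H R h hH hR => ?_⟩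
    exact ⟨by omega, hR, h lo le_rfl (by omega)⟩
  | pop k =>
    refine fun lo e => ⟨lo + 1, lo, fun _ => .pop k e, by omega, fun C' H R h hH hR => ?_⟩
    exact ⟨by omega, hR, h lo le_rfl (by omega)⟩
  | ask =>
    refine fun lo e => ⟨lo + 1, lo, fun _ => .ask e, by omega, fun C' H R h hH hR => ?_⟩
    exact ⟨by omega, h lo le_rfl (by omega)⟩
  | seq P Q ihP ihQ =>
    intro lo e
    obtain ⟨m, o₂, C₂, hm, h₂⟩ := ihQ lo e
    obtain ⟨hi, o₁, C₁, hhi, h₁⟩ := ihP m o₂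
    refine ⟨hi, o₁, fun i => if i < m then C₂ i else C₁ i, by omega, fun C' H R h hH hR => ?_⟩
    simp only [width, max_le_iff] at hR
    refine ⟨o₂, h₁ C' H R (fun i hi₁ hi₂ => ?_) hH hR.1,
      h₂ C' H R (fun i hi₁ hi₂ => ?_) (by omega) hR.2⟩
    · exact (h i (by omega) hi₂).trans (if_neg (by omega))
    · exact (h i hi₁ (by omega)).trans (if_pos hi₂)
  | ite k P Q T ihP ihQ ihT =>
    intro lo e
    obtain ⟨m₁, p, C₁, hm₁, h₁⟩ := ihP (lo + 1) e
    obtain ⟨m₂, q, C₂, hm₂, h₂⟩ := ihQ m₁ e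
    obtain ⟨m₃, r, C₃, hm₃, h₃⟩ := ihT m₂ e
    refine ⟨m₃, lo, fun i => if i = lo then .br k p q r else if i < m₁ then C₁ i else
      if i < m₂ then C₂ i else C₃ i, by omega, fun C' H R h hH hR => ?_⟩
    simp only [width, max_le_iff] at hR
    refine ⟨p, q, r, by omega, by omega, ?_, h₁ C' H R (fun i hi₁ hi₂ => ?_) (by omega) hR.2.1,
      h₂ C' H R (fun i hi₁ hi₂ => ?_) (by omega) hR.2.2.1,
      h₃ C' H R (fun i hi₁ hi₂ => ?_) (by omega) hR.2.2.2⟩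
    · exact (h lo le_rfl (by omega)).trans (if_pos rfl)
    · exact (h i (by omega) (by omega)).trans ((if_neg (by omega)).trans (if_pos hi₂))
    · exact (h i (by omega) (by omega)).trans
        ((if_neg (by omega)).trans ((if_neg (by omega)).trans (if_pos hi₂)))
    · exact (h i (by omega) (by omega)).trans
        ((if_neg (by omega)).trans ((if_neg (by omega)).trans (if_neg (by omega))))
  | loop k P ih =>
    intro lo e
    -- The body of the loop exits to the test at `lo`.
    obtain ⟨m, p, C, hm, h₁⟩ := ih (lo + 1) lo
    refine ⟨m, lo, fun i => if i = lo then .br k p p e else C i, by omega,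
      fun C' H R h hH hR => ?_⟩
    simp only [width, max_le_iff] at hR
    refine ⟨p, by omega, by omega, ?_, h₁ C' H R (fun i hi₁ hi₂ => ?_) (by omega) hR.2⟩
    · exact (h lo le_rfl (by omega)).trans (if_pos rfl)
    · exact (h i (by omega) (by omega)).trans (if_neg (by omega))

/-- The label of an address. Besides the addresses, `Sum.inr true` is the query label and
`Sum.inr false` the answer label; the internal state holds a label as well. -/
def label (H : ℕ) [NeZero H] (i : ℕ) : Fin H ⊕ Bool := .inl (Fin.ofNat H i)

/-- The statement that executes one instruction. -/
def instrStmt (H R : ℕ) [NeZero H] [NeZero R] :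
    Instr → Turing.TM2.Stmt (fun _ : Fin R => Bool) (Fin H ⊕ Bool) (Fin H ⊕ Bool)
  | .push k b e => .push (Fin.ofNat R k) (fun _ => b) (.goto fun _ => label H e)
  | .pop k e => .pop (Fin.ofNat R k) (fun v _ => v) (.goto fun _ => label H e)
  | .ask e => .load (fun _ => label H e) (.goto fun _ => .inr true)
  | .br k p q r => .peek (Fin.ofNat R k) (fun _ o => match o with
      | some true => label H p
      | some false => label H q
      | none => label H r) (.goto fun v => v)
  | .fin => .peek 0 (fun _ o => .inr (o == some true)) .halt

/-- The machine that executes the instructions `C`, starting at address `o`, and accepts if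
finally the top of register `0` is `true`. -/
def machine (C : ℕ → Instr) (H R : ℕ) [NeZero H] [NeZero R] (o : ℕ) : OracleTM where
  K := Fin R
  Λ := Fin H ⊕ Bool
  σ := Fin H ⊕ Bool
  input := 0
  query := 0
  main := label H o
  ask := .inr true
  answer := .inr false
  start := .inr false
  accept := fun v => match v with
    | .inr b => b
    | .inl _ => false
  prog := fun l => match l with
    | .inl i => instrStmt H R (C i)
    | .inr _ => .goto fun v => v

variable {C : ℕ → Instr} {H R : ℕ} [NeZero H] [NeZero R] {o₀ : ℕ} {g : List Bool → List Bool}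

/-- A configuration of `machine` given by address, state and register contents. -/
def cfg (C : ℕ → Instr) (H R : ℕ) [NeZero H] [NeZero R] (o₀ i : ℕ) (v : Fin H ⊕ Bool)
    (s : Store) : (machine C H R o₀).Cfg where
  l := some (label H i)
  var := v
  stk := fun k : Fin R => s k

theorem restrict_update (s : Store) {k : ℕ} (hk : k < R) (x : List Bool) :
    Function.update (fun k : Fin R => s k) (Fin.ofNat R k) x =
      fun i : Fin R => Function.update s k x i := by
  funext i
  by_cases h : i = Fin.ofNat R k
  · subst h
    simp [Nat.mod_eq_of_lt hk]
  · have : (i : ℕ) ≠ k := fun h' => h (by ext; simp [h', Nat.mod_eq_of_lt hk])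
    rw [Function.update_of_ne h, Function.update_of_ne this]

theorem step_cfg {i : ℕ} (hi : i < H) (v : Fin H ⊕ Bool) (s : Store) :
    (machine C H R o₀).step g (cfg C H R o₀ i v s) =
      Turing.TM2.stepAux (instrStmt H R (C i)) v (fun k : Fin R => s k) := by
  have h : ((Fin.ofNat H i : Fin H) : ℕ) = i := by simp [Nat.mod_eq_of_lt hi]
  simp only [OracleTM.step, cfg, label]
  rw [if_neg (by simp [machine])]
  simp only [machine, h]
  rfl

/-- Control is carried by the address alone, so the internal state on entry is arbitrary; it serves
only to pass a jump target within an instruction or across an oracle call. -/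
theorem exec_simulation {P : Prog} {s s' : Store} {t : ℕ} (hex : Exec g P s s' t) :
    ∀ (o e : ℕ), Code C H R P o e → ∀ v, ∃ n ≤ t, ∃ v',
      ((machine C H R o₀).step g)^[n] (cfg C H R o₀ o v s) = cfg C H R o₀ e v' s' := by
  induction hex with
  | skip s => rintro o e rfl v; exact ⟨0, le_rfl, v, rfl⟩
  | push s k b =>
    rintro o e ⟨ho, hk, hC⟩ v
    refine ⟨1, le_rfl, v, ?_⟩
    have h : ((Fin.ofNat R k : Fin R) : ℕ) = k := by simp [Nat.mod_eq_of_lt hk]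
    rw [Function.iterate_one, step_cfg ho, hC]
    simp only [instrStmt, Turing.TM2.stepAux, cfg, h]
    rw [restrict_update s hk]
    rfl
  | pop s k =>
    rintro o e ⟨ho, hk, hC⟩ v
    refine ⟨1, le_rfl, v, ?_⟩
    have h : ((Fin.ofNat R k : Fin R) : ℕ) = k := by simp [Nat.mod_eq_of_lt hk]
    rw [Function.iterate_one, step_cfg ho, hC]
    simp only [instrStmt, Turing.TM2.stepAux, cfg, h]
    rw [restrict_update s hk]
    rfl
  | ask s =>
    rintro o e ⟨ho, hC⟩ v
    -- Three steps: store the return label in the state and go to the query label, let the oracle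
    -- answer, jump from the answer label to the stored label.
    refine ⟨3, by omega, label H e, ?_⟩
    change (machine C H R o₀).step g ((machine C H R o₀).step g ((machine C H R o₀).step g _)) = _
    rw [step_cfg ho, hC]
    have hR : 0 < R := Nat.pos_of_ne_zero (NeZero.ne R)
    simp only [instrStmt, Turing.TM2.stepAux, OracleTM.step, machine, cfg, if_true]
    rw [if_neg (by simp)]
    exact congrArg (Turing.TM2.Cfg.mk _ _) (restrict_update s hR (g (s 0)))
  | seq _ _ ih₁ ih₂ =>
    rintro o e ⟨m, h₁, h₂⟩ v
    obtain ⟨n₁, hn₁, v₁, e₁⟩ := ih₁ o m h₁ v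
    obtain ⟨n₂, hn₂, v₂, e₂⟩ := ih₂ m e h₂ v₁
    exact ⟨n₂ + n₁, by omega, v₂, by rw [Function.iterate_add_apply, e₁, e₂]⟩
  | @iteTrue k P Q T s s' t hs _ ih =>
    rintro o e ⟨p, q, r, ho, hk, hC, hP, -, -⟩ v
    obtain ⟨n, hn, v', e'⟩ := ih p e hP (label H p)
    refine ⟨n + 1, by omega, v', ?_⟩
    have h : ((Fin.ofNat R k : Fin R) : ℕ) = k := by simp [Nat.mod_eq_of_lt hk]
    rw [Function.iterate_succ_apply, step_cfg ho, hC, ← e']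
    simp only [instrStmt, Turing.TM2.stepAux, h, hs]
    rfl
  | @iteFalse k P Q T s s' t hs _ ih =>
    rintro o e ⟨p, q, r, ho, hk, hC, -, hQ, -⟩ v
    obtain ⟨n, hn, v', e'⟩ := ih q e hQ (label H q)
    refine ⟨n + 1, by omega, v', ?_⟩
    have h : ((Fin.ofNat R k : Fin R) : ℕ) = k := by simp [Nat.mod_eq_of_lt hk]
    rw [Function.iterate_succ_apply, step_cfg ho, hC, ← e']
    simp only [instrStmt, Turing.TM2.stepAux, h, hs]
    rfl
  | @iteNil k P Q T s s' t hs _ ih =>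
    rintro o e ⟨p, q, r, ho, hk, hC, -, -, hT⟩ v
    obtain ⟨n, hn, v', e'⟩ := ih r e hT (label H r)
    refine ⟨n + 1, by omega, v', ?_⟩
    have h : ((Fin.ofNat R k : Fin R) : ℕ) = k := by simp [Nat.mod_eq_of_lt hk]
    rw [Function.iterate_succ_apply, step_cfg ho, hC, ← e']
    simp only [instrStmt, Turing.TM2.stepAux, h, hs]
    rfl
  | @loopNil k P s hs =>
    rintro o e ⟨p, ho, hk, hC, -⟩ v
    refine ⟨1, le_rfl, label H e, ?_⟩
    have h : ((Fin.ofNat R k : Fin R) : ℕ) = k := by simp [Nat.mod_eq_of_lt hk]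
    rw [Function.iterate_one, step_cfg ho, hC]
    simp only [instrStmt, Turing.TM2.stepAux, h, hs, List.head?_nil]
    rfl
  | @loopCons k P s s₁ s₂ t₁ t₂ hs _ _ ih₁ ih₂ =>
    rintro o e ⟨p, ho, hk, hC, hP⟩ v
    obtain ⟨n₁, hn₁, v₁, e₁⟩ := ih₁ p o hP (label H p)
    obtain ⟨n₂, hn₂, v₂, e₂⟩ := ih₂ o e ⟨p, ho, hk, hC, hP⟩ v₁
    refine ⟨n₂ + n₁ + 1, by omega, v₂, ?_⟩
    have h : ((Fin.ofNat R k : Fin R) : ℕ) = k := by simp [Nat.mod_eq_of_lt hk]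
    have hstep : (machine C H R o₀).step g (cfg C H R o₀ o v s) = cfg C H R o₀ p (label H p) s := by
      rw [step_cfg ho, hC]
      simp only [instrStmt, Turing.TM2.stepAux, h]
      cases hsk : s k with
      | nil => exact absurd hsk hs
      | cons b l => cases b <;> rfl
    rw [Function.iterate_succ_apply, hstep, Function.iterate_add_apply, e₁, e₂]

end Prog

/-- The store with `x` in register `0` and all other registers empty. -/
def Store.single (x : List Bool) : Store := Function.update (fun _ => []) 0 x

theorem OracleTM.iterate_step_of_halted (M : OracleTM) (g : List Bool → List Bool) (c : M.Cfg)
    (h : c.l = none) (n : ℕ) : (M.step g)^[n] c = c := by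
  apply Function.iterate_fixed
  simp [OracleTM.step, h]

/-- A language decided by a structured program in polynomial time is in `P^g`. -/
theorem mem_PTime_of_exec {g : List Bool → List Bool} {L : Set (List Bool)} (P : Prog)
    (p : Polynomial ℕ) (f : List Bool → List Bool)
    (h : ∀ x, ∃ t ≤ p.eval x.length, Exec g P (Store.single x) (Store.single (f x)) t)
    (hf : ∀ x, (f x).head? = some true ↔ x ∈ L) : L ∈ PTime g := by
  -- Address `0` is kept free for the halting instruction, which is the exit of the program.
  obtain ⟨hi, o, C, hlo, hC⟩ := P.exists_code 1 0
  have : NeZero hi := ⟨by omega⟩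
  have : NeZero (P.width + 1) := ⟨by omega⟩
  set C' : ℕ → Prog.Instr := fun i => if i = 0 then .fin else C i with hC'
  have hcode : Prog.Code C' hi (P.width + 1) P o 0 :=
    hC C' hi _ (fun i h₁ _ => by rw [hC']; simp only; rw [if_neg (by omega)]) le_rfl (by omega)
  refine ⟨Prog.machine C' hi (P.width + 1) o, p + 1, fun x => ?_⟩
  obtain ⟨t, ht, hex⟩ := h x
  obtain ⟨n, hn, v', hrun⟩ :=
    Prog.exec_simulation (o₀ := o) hex o 0 hcode ((.inr false : Fin hi ⊕ Bool))
  have hinit : (Prog.machine C' hi (P.width + 1) o).initCfg x =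
      Prog.cfg C' hi (P.width + 1) o o (.inr false) (Store.single x) := by
    have := Prog.restrict_update (R := P.width + 1) (fun _ => []) (k := 0) (by omega) x
    simp only [OracleTM.initCfg, Prog.cfg, Store.single]
    congr 1
  have hfin : ((Prog.machine C' hi (P.width + 1) o).step g)^[n + 1]
      ((Prog.machine C' hi (P.width + 1) o).initCfg x) =
      { l := none, var := .inr ((f x).head? == some true),
        stk := fun k : Fin (P.width + 1) => Store.single (f x) k } := by
    rw [Function.iterate_succ_apply', hinit, hrun, Prog.step_cfg (by omega)]
    simp [hC', Prog.instrStmt, Turing.TM2.stepAux, Store.single]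
    rfl
  -- The unused part of the time bound is spent in the halted configuration, which does not change.
  obtain ⟨k, hk⟩ : ∃ k, (p + 1).eval x.length = k + (n + 1) :=
    ⟨(p + 1).eval x.length - (n + 1), by simp; omega⟩
  rw [OracleTM.DecidesWithin, hk, Function.iterate_add_apply, hfin,
    OracleTM.iterate_step_of_halted _ _ _ rfl]
  refine ⟨rfl, ?_⟩
  rw [← hf x]
  simp [Prog.machine]

end DeltaStab

end

noncomputable section

namespace DeltaStab

/-! ### Polynomial time string functions -/

theorem eval_mono_nat (p : Polynomial ℕ) {a b : ℕ} (h : a ≤ b) : p.eval a ≤ p.eval b := by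
  rw [Polynomial.eval_eq_sum, Polynomial.eval_eq_sum]
  exact Finset.sum_le_sum fun i _ => Nat.mul_le_mul_left _ (Nat.pow_le_pow_left h i)

/-- The store whose first registers hold the given strings. -/
def Store.ofList (l : List (List Bool)) : Store := fun k => l.getD k []

open Store

theorem Store.single_eq_ofList (x : List Bool) : single x = ofList [x] := by
  funext k
  rcases k with _ | k <;> simp [single, ofList]

@[simp]
theorem Store.update_ofList (l : List (List Bool)) (k : ℕ) (hk : k < l.length) (x : List Bool) :
    Function.update (ofList l) k x = ofList (l.set k x) := by
  funext i
  by_cases h : i = k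
  · subst h
    simp [ofList, hk]
  · simp [Function.update_of_ne h, ofList, List.getD, List.getElem?_set_ne (Ne.symm h)]

theorem Store.ofList_pad (l : List (List Bool)) : ofList (l ++ [[]]) = ofList l := by
  funext k
  simp only [ofList, List.getD_eq_getElem?_getD]
  rcases lt_trichotomy k l.length with h | h | h
  · rw [List.getElem?_append_left h]
  · subst h; simp
  · rw [List.getElem?_eq_none (by simp; omega), List.getElem?_eq_none (by omega)]

/-- A unit of cost adds at most one symbol to a register. For `ask` this is ensured by counting the
length of the answer in its cost. -/
theorem Exec.length_le {g : List Bool → List Bool} {P : Prog} {s s' : Store} {t : ℕ}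
    (h : Exec g P s s' t) (k : ℕ) : (s' k).length ≤ (s k).length + t := by
  have upd : ∀ (s : Store) (j : ℕ) (x : List Bool) (t : ℕ), x.length ≤ (s j).length + t →
      (Function.update s j x k).length ≤ (s k).length + t := by
    intro s j x t h
    by_cases hk : k = j
    · subst hk; simpa using h
    · rw [Function.update_of_ne hk]; omega
  induction h with
  | skip s => omega
  | push s j b => exact upd _ _ _ _ (by simp)
  | pop s j => exact upd _ _ _ _ (by simp; omega)
  | ask s => exact upd _ _ _ _ (by omega)
  | seq _ _ ih₁ ih₂ => omega
  | iteTrue _ _ ih => omega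
  | iteFalse _ _ ih => omega
  | iteNil _ _ ih => omega
  | loopNil _ => omega
  | loopCons _ _ _ ih₁ ih₂ => omega

/-- Renaming of registers. -/
def Prog.rename (ρ : ℕ → ℕ) : Prog → Prog
  | skip => skip
  | push k b => push (ρ k) b
  | pop k => pop (ρ k)
  | ask => ask
  | seq P Q => seq (P.rename ρ) (Q.rename ρ)
  | ite k P Q R => ite (ρ k) (P.rename ρ) (Q.rename ρ) (R.rename ρ)
  | loop k P => loop (ρ k) (P.rename ρ)

/-- Register `0` has to be fixed because oracle queries refer to it. The registers outside the range
of `ρ` survive the run, so a program can be called as a subroutine while other data are kept. -/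
theorem Exec.rename {g : List Bool → List Bool} {P : Prog} {s s' : Store} {t : ℕ}
    (h : Exec g P s s' t) {ρ : ℕ → ℕ} (hρ : Function.Injective ρ) (hρ0 : ρ 0 = 0) :
    ∀ S : Store, (∀ k, S (ρ k) = s k) → ∃ S' : Store, (∀ k, S' (ρ k) = s' k) ∧
      (∀ j, (∀ k, ρ k ≠ j) → S' j = S j) ∧ Exec g (P.rename ρ) S S' t := by
  have upd : ∀ (S s : Store) (j : ℕ) (x : List Bool), (∀ k, S (ρ k) = s k) →
      (∀ k, Function.update S (ρ j) x (ρ k) = Function.update s j x k) ∧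
      (∀ i, (∀ k, ρ k ≠ i) → Function.update S (ρ j) x i = S i) := by
    intro S s j x hS
    refine ⟨fun k => ?_, fun i hi => Function.update_of_ne (hi j).symm _ _⟩
    by_cases hk : k = j
    · subst hk; simp
    · rw [Function.update_of_ne hk, Function.update_of_ne (fun e => hk (hρ e)), hS]
  induction h with
  | skip s => exact fun S hS => ⟨S, hS, fun _ _ => rfl, .skip S⟩
  | push s k b =>
    intro S hS
    obtain ⟨h₁, h₂⟩ := upd S s k (b :: s k) hS
    exact ⟨_, h₁, h₂, by rw [← hS k]; exact .push S (ρ k) b⟩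
  | pop s k =>
    intro S hS
    obtain ⟨h₁, h₂⟩ := upd S s k (s k).tail hS
    exact ⟨_, h₁, h₂, by rw [← hS k]; exact .pop S (ρ k)⟩
  | ask s =>
    intro S hS
    obtain ⟨h₁, h₂⟩ := upd S s 0 (g (s 0)) hS
    refine ⟨_, h₁, h₂, ?_⟩
    have := hS 0
    rw [hρ0] at this
    rw [hρ0, ← this]
    exact .ask S
  | seq _ _ ih₁ ih₂ =>
    intro S hS
    obtain ⟨S₁, a₁, b₁, c₁⟩ := ih₁ S hS
    obtain ⟨S₂, a₂, b₂, c₂⟩ := ih₂ S₁ a₁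
    exact ⟨S₂, a₂, fun j hj => (b₂ j hj).trans (b₁ j hj), .seq c₁ c₂⟩
  | iteTrue hs _ ih =>
    intro S hS
    obtain ⟨S₁, a₁, b₁, c₁⟩ := ih S hS
    exact ⟨S₁, a₁, b₁, .iteTrue (by rw [hS, hs]) c₁⟩
  | iteFalse hs _ ih =>
    intro S hS
    obtain ⟨S₁, a₁, b₁, c₁⟩ := ih S hS
    exact ⟨S₁, a₁, b₁, .iteFalse (by rw [hS, hs]) c₁⟩
  | iteNil hs _ ih =>
    intro S hS
    obtain ⟨S₁, a₁, b₁, c₁⟩ := ih S hS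
    exact ⟨S₁, a₁, b₁, .iteNil (by rw [hS, hs]) c₁⟩
  | loopNil hs => exact fun S hS => ⟨S, hS, fun _ _ => rfl, .loopNil (by rw [hS, hs])⟩
  | loopCons hs _ _ ih₁ ih₂ =>
    intro S hS
    obtain ⟨S₁, a₁, b₁, c₁⟩ := ih₁ S hS
    obtain ⟨S₂, a₂, b₂, c₂⟩ := ih₂ S₁ a₁
    exact ⟨S₂, a₂, fun j hj => (b₂ j hj).trans (b₁ j hj), .loopCons (by rwa [hS]) c₁ c₂⟩

/-- The program acting on register `0` and on registers from `4` on. -/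
def Prog.shift (P : Prog) : Prog := P.rename fun k => if k = 0 then 0 else k + 3

theorem Exec.shift {g : List Bool → List Bool} {P : Prog} {x y : List Bool} {t : ℕ}
    (h : Exec g P (ofList [x]) (ofList [y]) t) (a b c : List Bool) :
    Exec g P.shift (ofList [x, a, b, c]) (ofList [y, a, b, c]) t := by
  have hinj : Function.Injective fun k : ℕ => if k = 0 then 0 else k + 3 := by
    intro i j hij
    simp only at hij
    split_ifs at hij <;> omega
  obtain ⟨S', h₁, h₂, h₃⟩ := h.rename hinj rfl (ofList [x, a, b, c]) (by
    intro k
    rcases k with _ | k <;> simp [ofList])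
  have : S' = ofList [y, a, b, c] := by
    funext k
    rcases k with _ | _ | _ | _ | k
    · simpa [ofList] using h₁ 0
    · rw [h₂ 1 (by intro k; split_ifs <;> omega)]; rfl
    · rw [h₂ 2 (by intro k; split_ifs <;> omega)]; rfl
    · rw [h₂ 3 (by intro k; split_ifs <;> omega)]; rfl
    · simpa [ofList] using h₁ (k + 1)
  rwa [this] at h₃

/-- Pop the bits of register `k` one by one and run `P b` for each bit `b`. -/
def Prog.drain (k : ℕ) (P : Bool → Prog) : Prog :=
  .loop k (.ite k (.seq (.pop k) (P true)) (.seq (.pop k) (P false)) .skip)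

/-- Each bit costs two tests and a pop besides the body; the final failing test gives the summand 1.
The invariant `I` is for bodies whose cost is bounded only on the values that really occur. -/
theorem Exec.drain {g : List Bool → List Bool} {α : Type} {k : ℕ} {P : Bool → Prog}
    (st : List Bool → α → Store) (F : Bool → α → α) (c : ℕ) (I : List Bool → α → Prop)
    (hk : ∀ l a, st l a k = l) (hupd : ∀ l l' a, Function.update (st l a) k l' = st l' a)
    (hP : ∀ b l a, I (b :: l) a → I l (F b a) ∧
      ∃ t ≤ c, Exec g (P b) (st l a) (st l (F b a)) t) :
    ∀ l a, I l a → ∃ t ≤ (c + 3) * l.length + 1,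
      Exec g (.drain k P) (st l a) (st [] (l.foldl (fun a b => F b a) a)) t := by
  intro l
  induction l with
  | nil => exact fun a _ => ⟨1, by simp, .loopNil (hk _ _)⟩
  | cons b l ih =>
    intro a hI
    obtain ⟨hI', t, ht, hex⟩ := hP b l a hI
    obtain ⟨t', ht', hex'⟩ := ih (F b a) hI'
    have hpop : Exec g (.pop k) (st (b :: l) a) (st l a) 1 := by
      have := Exec.pop (g := g) (st (b :: l) a) k
      rwa [hupd, hk, List.tail_cons] at this
    refine ⟨1 + t + 1 + t' + 1, ?_, .loopCons (by rw [hk]; simp) ?_ hex'⟩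
    · simp only [List.length_cons, mul_add]; omega
    · cases b
      · exact .iteFalse (by rw [hk]; rfl) (.seq hpop hex)
      · exact .iteTrue (by rw [hk]; rfl) (.seq hpop hex)

/-! ### Functions computable in polynomial time relative to an oracle -/

/-- A function oracle with polynomially long values. -/
structure Oracle where
  ask : List Bool → List Bool
  length_ask : ∃ p : Polynomial ℕ, ∀ x, (ask x).length ≤ p.eval x.length

/-- Types with codes of their elements as binary strings. -/
class Enc (α : Type) where
  enc : α → List Bool

open Enc (enc)

instance : Enc (List Bool) := ⟨fun x => x⟩

@[simp]
theorem enc_list (x : List Bool) : enc x = x := rfl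

variable {α β γ : Type} [Enc α] [Enc β] [Enc γ]

/-- `P` takes the store `a x` to the store `b x` in time polynomial in the length of the code of
`x`. -/
def PolyExec (g : Oracle) (P : Prog) (a b : α → Store) : Prop :=
  ∃ p : Polynomial ℕ, ∀ x, ∃ t ≤ p.eval (enc x).length, Exec g.ask P (a x) (b x) t

/-- The values of `f` are polynomially long. -/
def PolyLen (f : α → List Bool) : Prop :=
  ∃ p : Polynomial ℕ, ∀ x, (f x).length ≤ p.eval (enc x).length

/-- The function `f` is computed (on codes) by a program in polynomial time with oracle `g`. -/
@[fun_prop]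
def FP (g : Oracle) (f : α → β) : Prop :=
  ∃ P : Prog, PolyExec g P (fun x : α => ofList [enc x]) (fun x => ofList [enc (f x)])

variable {g : Oracle}

theorem PolyExec.seq {P Q : Prog} {a b c : α → Store} (h₁ : PolyExec g P a b)
    (h₂ : PolyExec g Q b c) : PolyExec g (.seq P Q) a c := by
  obtain ⟨p, hp⟩ := h₁
  obtain ⟨q, hq⟩ := h₂
  refine ⟨p + q, fun x => ?_⟩
  obtain ⟨t₁, ht₁, e₁⟩ := hp x
  obtain ⟨t₂, ht₂, e₂⟩ := hq x
  exact ⟨t₁ + t₂, by rw [Polynomial.eval_add]; omega, .seq e₁ e₂⟩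

theorem PolyExec.push (k : ℕ) (b : Bool) (a : α → List (List Bool))
    (hk : ∀ x, k < (a x).length) :
    PolyExec g (.push k b) (fun x => ofList (a x))
      (fun x => ofList ((a x).set k (b :: (a x).getD k []))) := by
  refine ⟨1, fun x => ⟨1, by simp, ?_⟩⟩
  have := Exec.push (g := g.ask) (ofList (a x)) k b
  rwa [update_ofList _ _ (hk x)] at this

theorem PolyLen.enc : PolyLen fun x : α => enc x := ⟨.X, fun x => by simp⟩

theorem PolyLen.reverse {f : α → List Bool} (hf : PolyLen f) : PolyLen fun x => (f x).reverse := by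
  obtain ⟨p, hp⟩ := hf
  exact ⟨p, fun x => by simpa using hp x⟩

theorem FP.polyLen {f : α → β} (hf : FP g f) : PolyLen fun x => enc (f x) := by
  obtain ⟨P, p, hp⟩ := hf
  refine ⟨.X + p, fun x => ?_⟩
  obtain ⟨t, ht, e⟩ := hp x
  have := e.length_le 0
  simp only [ofList, List.getD_cons_zero] at this
  simp only [Polynomial.eval_add, Polynomial.eval_X]
  omega

/-- A polynomial time subroutine applied to register `0`, the first registers being kept. -/
theorem PolyExec.shift {P : Prog} {h : β → γ} {u : α → β}
    (hP : PolyExec g P (fun x => ofList [enc x]) fun x => ofList [enc (h x)])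
    (hu : PolyLen fun x => enc (u x)) (a b c : α → List Bool) :
    PolyExec g P.shift (fun x => ofList [enc (u x), a x, b x, c x])
      (fun x => ofList [enc (h (u x)), a x, b x, c x]) := by
  obtain ⟨p, hp⟩ := hP
  obtain ⟨q, hq⟩ := hu
  refine ⟨p.comp q, fun x => ?_⟩
  obtain ⟨t, ht, e⟩ := hp (u x)
  exact ⟨t, ht.trans (by rw [Polynomial.eval_comp]; exact eval_mono_nat p (hq x)), e.shift _ _ _⟩

theorem PolyExec.drain {σ : Type} {k : ℕ} {P : Bool → Prog} (l : α → List Bool)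
    (hl : PolyLen l) (st : α → List Bool → σ → Store) (F : Bool → σ → σ) (c : ℕ)
    (a : α → σ)
    (hk : ∀ x l a, st x l a k = l) (hupd : ∀ x l l' a, Function.update (st x l a) k l' = st x l' a)
    (hP : ∀ x b l a, ∃ t ≤ c, Exec g.ask (P b) (st x l a) (st x l (F b a)) t) :
    PolyExec g (.drain k P) (fun x => st x (l x) (a x))
      (fun x => st x [] ((l x).foldl (fun a b => F b a) (a x))) := by
  obtain ⟨p, hp⟩ := hl
  refine ⟨.C (c + 3) * p + 1, fun x => ?_⟩
  obtain ⟨t, ht, e⟩ := Exec.drain (st x) F c (fun _ _ => True) (hk x) (hupd x)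
    (fun b l a _ => ⟨trivial, hP x b l a⟩) (l x) (a x) trivial
  refine ⟨t, ht.trans ?_, e⟩
  simp only [Polynomial.eval_add, Polynomial.eval_mul, Polynomial.eval_C, Polynomial.eval_one]
  exact Nat.add_le_add_right (Nat.mul_le_mul_left _ (hp x)) 1

/-- Move register `k`, reversed, on top of register `j`. -/
def Prog.move (k j : ℕ) : Prog := .drain k fun b => .push j b

theorem foldl_cons_eq (l a : List Bool) : l.foldl (fun a b => b :: a) a = l.reverse ++ a := by
  induction l generalizing a with
  | nil => rfl
  | cons b l ih => simp [ih]

theorem PolyExec.congr {P : Prog} {a a' b b' : α → Store} (h : PolyExec g P a b)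
    (ha : ∀ x, a' x = a x) (hb : ∀ x, b' x = b x) : PolyExec g P a' b' := by
  obtain rfl : a' = a := funext ha
  obtain rfl : b' = b := funext hb
  exact h

theorem PolyExec.move (k j : ℕ) (hkj : k ≠ j) (a : α → List (List Bool))
    (hk : ∀ x, k < (a x).length) (hj : ∀ x, j < (a x).length)
    (hl : PolyLen fun x => (a x).getD k []) :
    PolyExec g (.move k j) (fun x => ofList (a x))
      (fun x => ofList (((a x).set j (((a x).getD k []).reverse ++ (a x).getD j [])).set k [])) := by
  have := PolyExec.drain (g := g) (σ := List Bool) (k := k) (P := fun b => .push j b)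
    (fun x => (a x).getD k []) hl (fun x l b => ofList (((a x).set j b).set k l))
    (fun b a => b :: a) 1 (fun x => (a x).getD j [])
    (fun x l b => by simp [ofList, hk x])
    (fun x l l' b => by rw [update_ofList _ _ (by simpa using hk x), List.set_set])
    (fun x b l c => ⟨1, le_rfl, by
      have := Exec.push (g := g.ask) (ofList (((a x).set j c).set k l)) j b
      rw [update_ofList _ _ (by simpa using hj x)] at this
      convert this using 2
      have h0 : ofList (((a x).set j c).set k l) j = c := by
        simp [ofList, hj x, hkj]
      rw [h0, List.set_comm _ _ hkj, List.set_set, List.set_comm _ _ hkj.symm]⟩)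
  refine this.congr (fun x => ?_) (fun x => ?_)
  · congr 1
    have e₁ : (a x).set j ((a x).getD j []) = a x := by
      rw [List.getD_eq_getElem _ _ (hj x)]; exact List.set_getElem_self _
    rw [e₁, List.getD_eq_getElem _ _ (hk x)]
    exact (List.set_getElem_self _).symm
  · rw [foldl_cons_eq]

theorem Store.ofList_one (x : List Bool) : ofList [x] = ofList [x, [], [], []] := by
  rw [← ofList_pad [x], ← ofList_pad, ← ofList_pad]; rfl

/-- A program that computes `f x` (reversed, in register `1`) and `h x` (in register `0`). -/
theorem FP.exists_both {f : α → β} {h : α → γ} (hf : FP g f) (hh : FP g h) :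
    ∃ P, PolyExec g P (fun x => ofList [enc x, [], [], []])
      (fun x => ofList [enc (h x), (enc (f x)).reverse, [], []]) := by
  have hl := hf.polyLen
  obtain ⟨P, hP⟩ := hf
  obtain ⟨Q, hQ⟩ := hh
  -- The input is moved to register `1` and drained back into two copies. The first is consumed by
  -- the program for `f`; the second is saved through registers `2` and `3` and then given to the
  -- program for `h`. Every move reverses, which is why `f x` ends up reversed.
  have e₁ := PolyExec.move (g := g) 0 1 (by simp) (fun x : α => [enc x, [], [], []])
    (by simp) (by simp) .enc
  have e₂ := PolyExec.drain (g := g) (σ := List Bool × List Bool) (k := 1)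
    (P := fun b => .seq (.push 0 b) (.push 2 b)) (fun x : α => (enc x).reverse) PolyLen.enc.reverse
    (fun x l a => ofList [a.1, l, a.2, []]) (fun b a => (b :: a.1, b :: a.2)) 2 (fun x => ([], []))
    (fun x l a => by simp [ofList]) (fun x l l' a => by simp)
    (fun x b l a => ⟨1 + 1, le_rfl, by
      have h₁ := Exec.push (g := g.ask) (ofList [a.1, l, a.2, []]) 0 b
      have h₂ := Exec.push (g := g.ask) (ofList [b :: a.1, l, a.2, []]) 2 b
      rw [update_ofList _ _ (by simp)] at h₁ h₂
      exact .seq h₁ h₂⟩)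
  have fold : ∀ l a : List Bool, ∀ a' : List Bool,
      l.foldl (fun (a : List Bool × List Bool) b => (b :: a.1, b :: a.2)) (a, a') =
        (l.reverse ++ a, l.reverse ++ a') := by
    intro l
    induction l with
    | nil => simp
    | cons b l ih => simp [ih]
  simp only [fold, List.reverse_reverse, List.append_nil] at e₂
  have e₃ := hP.shift (u := fun x => x) .enc (fun _ => []) (fun x => enc x) (fun _ => [])
  have e₄ := PolyExec.move (g := g) 2 3 (by simp) (fun x : α => [enc (f x), [], enc x, []])
    (by simp) (by simp) .enc
  have e₅ := PolyExec.move (g := g) 0 1 (by simp) (fun x : α => [enc (f x), [], [], (enc x).reverse])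
    (by simp) (by simp) hl
  have e₆ := PolyExec.move (g := g) 3 0 (by simp)
    (fun x : α => [[], (enc (f x)).reverse, [], (enc x).reverse])
    (by simp) (by simp) PolyLen.enc.reverse
  have e₇ := hQ.shift (u := fun x => x) .enc (fun x => (enc (f x)).reverse) (fun _ => [])
    (fun _ => [])
  simp only [List.set, List.getD_cons_zero, List.getD_cons_succ, List.append_nil,
    List.reverse_reverse] at e₁ e₄ e₅ e₆
  exact ⟨_, e₁.seq (e₂.seq (e₃.seq (e₄.seq (e₅.seq (e₆.seq e₇)))))⟩

end DeltaStab

end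

/-! ### Coded lists of strings and closure properties of `FP` -/

noncomputable section

namespace DeltaStab

open Store Enc

variable {g : Oracle} {α β γ : Type} [Enc α] [Enc β] [Enc γ]

/-- Put the string `x` in front of the list of strings coded by `y`. -/
def lcons (x y : List Bool) : List Bool := (x.flatMap fun b => [true, b]) ++ false :: y

/-- The first string of a coded list of strings. -/
def lhead : List Bool → List Bool
  | true :: b :: z => b :: lhead z
  | _ => []

/-- A coded list of strings without the first string. -/
def ltail : List Bool → List Bool
  | true :: _ :: z => ltail z
  | false :: z => z
  | _ => []

@[simp]
theorem encodeList_nil : encodeList [] = [] := rfl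

@[simp]
theorem encodeList_cons (x : List Bool) (l : List (List Bool)) :
    encodeList (x :: l) = lcons x (encodeList l) := by
  simp [encodeList, lcons]

@[simp]
theorem lhead_lcons (x y : List Bool) : lhead (lcons x y) = x := by
  induction x with
  | nil => rfl
  | cons b x ih =>
    change b :: lhead (lcons x y) = _
    rw [ih]

@[simp]
theorem ltail_lcons (x y : List Bool) : ltail (lcons x y) = y := by
  induction x with
  | nil => rfl
  | cons b x ih => exact ih

@[simp]
theorem length_lcons (x y : List Bool) : (lcons x y).length = 2 * x.length + 1 + y.length := by
  induction x with
  | nil => simp [lcons]; omega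
  | cons b x ih =>
    have : (lcons (b :: x) y).length = (lcons x y).length + 2 := rfl
    rw [this, ih, List.length_cons]; omega

theorem length_ltail_le (z : List Bool) : (ltail z).length ≤ z.length := by
  induction z using ltail.induct with
  | case1 b z ih => simp only [ltail, List.length_cons]; omega
  | case2 z => simp [ltail]
  | case3 z h₁ h₂ => rw [ltail] <;> simp_all

namespace Prog

/-- Empty register `k`. -/
def clear (k : ℕ) : Prog := drain k fun _ => skip

/-- Read the first string of the list coded in register `0`, reversed, into register `1`. -/
def readHead : Prog :=
  loop 0 (ite 0 (seq (pop 0) (ite 0 (seq (pop 0) (push 1 true)) (seq (pop 0) (push 1 false)) skip))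
    (clear 0) skip)

/-- Move the list coded in register `0` without its first string, reversed, to register `1`. -/
def dropHead : Prog :=
  loop 0 (ite 0 (seq (pop 0) (pop 0)) (seq (pop 0) (move 0 1)) skip)

end Prog

theorem PolyExec.clear (k : ℕ) (a : α → List (List Bool))
    (hk : ∀ x, k < (a x).length) (hl : PolyLen fun x => (a x).getD k []) :
    PolyExec g (.clear k) (fun x => ofList (a x)) (fun x => ofList ((a x).set k [])) := by
  have := PolyExec.drain (g := g) (σ := Unit) (k := k) (P := fun _ => .skip)
    (fun x => (a x).getD k []) hl (fun x l _ => ofList ((a x).set k l)) (fun _ a => a) 0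
    (fun _ => ()) (fun x l b => by simp [ofList, hk x])
    (fun x l l' b => by rw [update_ofList _ _ (by simpa using hk x), List.set_set])
    (fun x b l c => ⟨0, le_rfl, .skip _⟩)
  refine this.congr (fun x => ?_) (fun x => rfl)
  rw [List.getD_eq_getElem _ _ (hk x), List.set_getElem_self]

instance : Enc Bool := ⟨fun b => [b]⟩

@[simp]
theorem enc_bool (b : Bool) : enc b = [b] := rfl

namespace FP

@[fun_prop]
theorem id : FP g fun x : α => x := ⟨.skip, 0, fun x => ⟨0, by simp, .skip _⟩⟩

/-- `FP` depends only on codes, so operations on typed data can be obtained from operations on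
strings. -/
theorem recode {f : α → β} {f' : α → γ} (hf : FP g f) (h : ∀ x, enc (f' x) = enc (f x)) :
    FP g f' := by
  obtain ⟨P, hP⟩ := hf
  exact ⟨P, hP.congr (fun _ => rfl) fun x => by rw [h]⟩

theorem enc : FP g fun x : α => enc x := id.recode fun _ => rfl

@[fun_prop]
theorem comp {h : β → γ} {f : α → β} (hh : FP g h) (hf : FP g f) : FP g fun x => h (f x) := by
  have hl := hf.polyLen
  obtain ⟨P, hP⟩ := hf
  obtain ⟨Q, q, hq⟩ := hh
  obtain ⟨p, hp⟩ := hl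
  refine ⟨_, hP.seq (Q := Q) ⟨q.comp p, fun x => ?_⟩⟩
  obtain ⟨t, ht, e⟩ := hq (f x)
  exact ⟨t, ht.trans (by rw [Polynomial.eval_comp]; exact eval_mono_nat q (hp x)), e⟩

theorem cons (b : Bool) : FP g fun x : List Bool => b :: x :=
  ⟨_, PolyExec.push 0 b (fun x : List Bool => [x]) (by simp)⟩

@[fun_prop]
theorem tail : FP g fun x : List Bool => x.tail := by
  refine ⟨.pop 0, 1, fun x => ⟨1, by simp, ?_⟩⟩
  have := Exec.pop (g := g.ask) (ofList [x]) 0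
  rwa [update_ofList _ _ (by simp)] at this

@[fun_prop]
theorem ask : FP g fun x => g.ask x := by
  obtain ⟨p, hp⟩ := g.length_ask
  refine ⟨.ask, 3 + p, fun x => ⟨3 + (g.ask x).length, ?_, ?_⟩⟩
  · have := hp x
    simp only [Polynomial.eval_add, Polynomial.eval_ofNat, enc_list]
    omega
  · have := Exec.ask (g := g.ask) (ofList [x])
    rwa [update_ofList _ _ (by simp)] at this

theorem nil : FP g fun _ : α => ([] : List Bool) :=
  ⟨_, PolyExec.clear 0 (fun x : α => [Enc.enc x]) (by simp) .enc⟩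

theorem constString (l : List Bool) : FP g fun _ : α => l := by
  induction l with
  | nil => exact nil
  | cons b l ih => exact (cons b).comp ih

@[fun_prop]
theorem const (c : β) : FP g fun _ : α => c := (constString (Enc.enc c)).recode fun _ => rfl

@[fun_prop]
theorem append {f h : α → List Bool} (hf : FP g f) (hh : FP g h) : FP g fun x => f x ++ h x := by
  have hl := hf.polyLen
  obtain ⟨P, hP⟩ := hf.exists_both hh
  have e := PolyExec.move (g := g) 1 0 (by simp) (fun x : α => [h x, (f x).reverse, [], []])
    (by simp) (by simp) hl.reverse
  exact ⟨_, (hP.seq e).congr (fun x => ofList_one _) fun x => by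
    rw [ofList_one]; simp⟩

@[fun_prop]
theorem lcons {f h : α → List Bool} (hf : FP g f) (hh : FP g h) :
    FP g fun x => lcons (f x) (h x) := by
  have hl := hf.polyLen
  obtain ⟨P, hP⟩ := hf.exists_both hh
  have e₁ := PolyExec.push (g := g) 0 false (fun x : α => [h x, (f x).reverse, [], []]) (by simp)
  have e₂ := PolyExec.drain (g := g) (σ := List Bool) (k := 1)
    (P := fun b => .seq (.push 0 b) (.push 0 true)) (fun x : α => (f x).reverse) hl.reverse
    (fun x l a => ofList [a, l, [], []]) (fun b a => true :: b :: a) 2 (fun x => false :: h x)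
    (fun x l a => by simp [ofList]) (fun x l l' a => by simp)
    (fun x b l a => ⟨1 + 1, le_rfl, by
      have h₁ := Exec.push (g := g.ask) (ofList [a, l, [], []]) 0 b
      have h₂ := Exec.push (g := g.ask) (ofList [b :: a, l, [], []]) 0 true
      rw [update_ofList _ _ (by simp)] at h₁ h₂
      exact .seq h₁ h₂⟩)
  refine ⟨_, (hP.seq (e₁.seq e₂)).congr (fun x => ofList_one _) fun x => ?_⟩
  have fold : ∀ l y : List Bool,
      l.reverse.foldl (fun a b => true :: b :: a) (false :: y) = DeltaStab.lcons l y := by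
    intro l y
    rw [List.foldl_reverse]
    induction l with
    | nil => rfl
    | cons b l ih => exact congrArg (fun z => true :: b :: z) ih
  rw [ofList_one, fold]
  rfl

@[fun_prop]
theorem reverse : FP g fun x : List Bool => x.reverse := by
  have e₁ := PolyExec.move (g := g) 0 1 (by simp) (fun x : List Bool => [x, [], [], []]) (by simp) (by simp)
    .enc
  have e₂ := PolyExec.move (g := g) 1 2 (by simp) (fun x : List Bool => [[], x.reverse, [], []])
    (by simp) (by simp) PolyLen.enc.reverse
  have e₃ := PolyExec.move (g := g) 2 0 (by simp) (fun x : List Bool => [[], [], x, []])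
    (by simp) (by simp) PolyLen.enc
  simp only [List.set, List.getD_cons_zero, List.getD_cons_succ, List.append_nil,
    List.reverse_reverse] at e₁ e₂ e₃
  exact ⟨_, (e₁.seq (e₂.seq e₃)).congr (fun x => ofList_one _) fun x => ofList_one _⟩

@[fun_prop]
theorem cond {u : α → Bool} {f h : α → β} (hu : FP g u) (hf : FP g f) (hh : FP g h) :
    FP g fun x => cond (u x) (f x) (h x) := by
  have hl := hu.polyLen
  obtain ⟨P, hP⟩ := hu.exists_both (g := g) id
  obtain ⟨Q, hQ⟩ := hf
  obtain ⟨R, hR⟩ := hh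
  have e := PolyExec.clear (g := g) 1 (fun x : α => [Enc.enc x, [u x], [], []]) (by simp) hl.reverse
  obtain ⟨p, hp⟩ := e.seq (hQ.shift (u := fun x => x) .enc (fun _ => []) (fun _ => []) (fun _ => []))
  obtain ⟨q, hq⟩ := e.seq (hR.shift (u := fun x => x) .enc (fun _ => []) (fun _ => []) (fun _ => []))
  refine ⟨_, (hP.seq (Q := .ite 1 (.seq (.clear 1) Q.shift) (.seq (.clear 1) R.shift) .skip)
    (c := fun x => ofList [Enc.enc (bif u x then f x else h x), [], [], []])
    ⟨p + q + 1, fun x => ?_⟩).congr (fun x => ofList_one _) fun x => ofList_one _⟩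
  obtain ⟨t₁, ht₁, e₁⟩ := hp x
  obtain ⟨t₂, ht₂, e₂⟩ := hq x
  simp only [Polynomial.eval_add, Polynomial.eval_one]
  cases hc : u x
  · exact ⟨t₂ + 1, by omega, .iteFalse (by simp [ofList]) (by simpa [hc] using e₂)⟩
  · exact ⟨t₁ + 1, by omega, .iteTrue (by simp [ofList]) (by simpa [hc] using e₁)⟩

/-- Iteration of a polynomial time function, if the values stay polynomially long. -/
theorem iterate {u : α → List Bool} {f : α → β} {h : β → β} (hu : FP g u) (hf : FP g f)
    (hh : FP g h)
    (hb : ∃ p : Polynomial ℕ, ∀ x, ∀ j ≤ (u x).length, 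
      (Enc.enc (h^[j] (f x))).length ≤ p.eval (Enc.enc x).length) :
    FP g fun x => h^[(u x).length] (f x) := by
  obtain ⟨q, hq⟩ := hu.polyLen
  obtain ⟨P, hP⟩ := hu.exists_both hf
  obtain ⟨Q, r, hQ⟩ := hh
  obtain ⟨p, hp⟩ := hb
  refine ⟨_, (hP.seq (Q := .drain 1 fun _ => Q.shift) (c := fun x => ofList
      [Enc.enc (h^[(u x).length] (f x)), [], [], []])
    -- There are at most `q` rounds, each running `Q` on an iterate of length at most `p`. Without
    -- the bound `p`, repeated application could lengthen the argument exponentially.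
    ⟨(r.comp p + 3) * q + 1, fun x => ?_⟩).congr (fun x => ofList_one _) fun x => ofList_one _⟩
  obtain ⟨t, ht, e⟩ := Exec.drain (g := g.ask) (k := 1) (P := fun _ => Q.shift)
    (fun l a => ofList [Enc.enc a, l, [], []]) (fun _ a => h a) (r.eval (p.eval (Enc.enc x).length))
    -- The invariant records that the current value is one of the iterates whose length is bounded
    -- by `p`.
    (fun l a => ∃ j, j + l.length = (u x).length ∧ a = h^[j] (f x))
    (fun l a => by simp [ofList]) (fun l l' a => by simp)
    (fun b l a => by
      rintro ⟨j, hj, rfl⟩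
      simp only [List.length_cons] at hj
      refine ⟨⟨j + 1, by omega, (Function.iterate_succ_apply' _ _ _).symm⟩, ?_⟩
      obtain ⟨t, ht, e⟩ := hQ (h^[j] (f x))
      exact ⟨t, ht.trans (eval_mono_nat r (hp x j (by omega))), e.shift _ _ _⟩)
    (u x).reverse (f x) ⟨0, by simp, rfl⟩
  refine ⟨t, ht.trans ?_, ?_⟩
  · simp only [Polynomial.eval_add, Polynomial.eval_mul, Polynomial.eval_comp,
      Polynomial.eval_one, Polynomial.eval_ofNat, List.length_reverse]
    exact Nat.add_le_add_right (Nat.mul_le_mul_left _ (hq x)) 1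
  · have fold : ∀ (l : List Bool) (a : β), l.foldl (fun a _ => h a) a = h^[l.length] a := by
      intro l
      induction l with
      | nil => exact fun a => rfl
      | cons b l ih => intro a; simp [ih]
    rw [fold, List.length_reverse] at e
    exact e

@[fun_prop]
theorem isEmpty : FP g fun x : List Bool => x.isEmpty := by
  obtain ⟨p, hp⟩ := (PolyExec.clear (g := g) 0 (fun x : List Bool => [x]) (by simp) .enc).seq
    (PolyExec.push (g := g) 0 false (fun _ : List Bool => [[]]) (by simp))
  refine ⟨.ite 0 (.seq (.clear 0) (.push 0 false)) (.seq (.clear 0) (.push 0 false))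
    (.push 0 true), p + 2, fun x => ?_⟩
  obtain ⟨t, ht, e⟩ := hp x
  simp only [Polynomial.eval_add, Polynomial.eval_ofNat]
  rcases x with _ | ⟨_ | _, x⟩
  · refine ⟨1 + 1, by omega, .iteNil rfl ?_⟩
    have := Exec.push (g := g.ask) (ofList [[]]) 0 true
    rwa [update_ofList _ _ (by simp)] at this
  · exact ⟨t + 1, by omega, .iteFalse rfl e⟩
  · exact ⟨t + 1, by omega, .iteTrue rfl e⟩

@[fun_prop]
theorem headBit : FP g fun x : List Bool => x.headD false := by
  have e := PolyExec.clear (g := g) 0 (fun x : List Bool => [x]) (by simp) .enc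
  obtain ⟨p, hp⟩ := e.seq (PolyExec.push (g := g) 0 false (fun _ : List Bool => [[]]) (by simp))
  obtain ⟨q, hq⟩ := e.seq (PolyExec.push (g := g) 0 true (fun _ : List Bool => [[]]) (by simp))
  refine ⟨.ite 0 (.seq (.clear 0) (.push 0 true)) (.seq (.clear 0) (.push 0 false))
    (.seq (.clear 0) (.push 0 false)), p + q + 1, fun x => ?_⟩
  obtain ⟨t, ht, e⟩ := hp x
  obtain ⟨t', ht', e'⟩ := hq x
  simp only [Polynomial.eval_add, Polynomial.eval_one]
  rcases x with _ | ⟨_ | _, x⟩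
  · exact ⟨t + 1, by omega, .iteNil rfl e⟩
  · exact ⟨t + 1, by omega, .iteFalse rfl e⟩
  · exact ⟨t' + 1, by omega, .iteTrue rfl e'⟩

@[fun_prop]
theorem lhead : FP g fun x => DeltaStab.lhead x := by
  have hpush : ∀ (a l : List Bool) (b : Bool),
      Exec g.ask (.seq (.pop 0) (.push 1 b)) (ofList [b :: l, a, [], []])
        (ofList [l, b :: a, [], []]) 2 := by
    intro a l b
    have h₁ := Exec.pop (g := g.ask) (ofList [b :: l, a, [], []]) 0
    have h₂ := Exec.push (g := g.ask) (ofList [l, a, [], []]) 1 b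
    rw [update_ofList _ _ (by simp)] at h₁ h₂
    exact .seq h₁ h₂
  have key : ∀ z a : List Bool, ∃ t ≤ 6 * z.length + 4, Exec g.ask .readHead
      (ofList [z, a, [], []]) (ofList [[], (DeltaStab.lhead z).reverse ++ a, [], []]) t := by
    intro z
    induction z using DeltaStab.lhead.induct with
    | case1 b z ih =>
      intro a
      obtain ⟨t, ht, e⟩ := ih (b :: a)
      refine ⟨1 + (2 + 1) + 1 + t + 1, by simp only [List.length_cons]; omega, .loopCons (by simp [ofList])
        (.iteTrue rfl (.seq (s₁ := ofList [b :: z, a, [], []]) ?_ ?_))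
        (s₁ := ofList [z, b :: a, [], []]) ?_⟩
      · have h₁ := Exec.pop (g := g.ask) (ofList [true :: b :: z, a, [], []]) 0
        rwa [update_ofList _ _ (by simp)] at h₁
      · cases b
        · exact .iteFalse rfl (hpush _ _ _)
        · exact .iteTrue rfl (hpush _ _ _)
      · simpa [DeltaStab.lhead, Prog.readHead] using e
    | case2 z hz =>
      intro a
      rw [DeltaStab.lhead] <;> [skip; exact hz]
      rcases z with _ | ⟨_ | _, z⟩
      · exact ⟨1, by simp, .loopNil rfl⟩
      · obtain ⟨t, ht, e⟩ := Exec.drain (g := g.ask) (k := 0) (P := fun _ => .skip)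
          (fun l (_ : Unit) => ofList [l, a, [], []]) (fun _ a => a) 0 (fun _ _ => True)
          (fun l a => by simp [ofList]) (fun l l' a => by simp)
          (fun b l a _ => ⟨trivial, 0, le_rfl, .skip _⟩) (false :: z) () trivial
        refine ⟨t + 1 + 1 + 1, ?_, .loopCons (by simp [ofList]) (.iteFalse rfl e) (.loopNil rfl)⟩
        simp only [List.length_cons] at ht ⊢; omega
      · rcases z with _ | ⟨b, z⟩
        · refine ⟨1 + (0 + 1) + 1 + 1 + 1, by simp, .loopCons (by simp [ofList])
            (s₁ := ofList [[], a, [], []]) (.iteTrue rfl (.seq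
              (s₁ := ofList [[], a, [], []]) ?_ (.iteNil rfl (.skip _)))) (.loopNil rfl)⟩
          have h₁ := Exec.pop (g := g.ask) (ofList [[true], a, [], []]) 0
          rwa [update_ofList _ _ (by simp)] at h₁
        · exact (hz b z rfl).elim
  have hlen : PolyLen fun x : List Bool => (DeltaStab.lhead x).reverse := by
    refine ⟨6 * .X + 4, fun x => ?_⟩
    obtain ⟨t, ht, e⟩ := key x []
    have := e.length_le 1
    simp only [ofList, List.getD_cons_succ, List.getD_cons_zero, List.append_nil,
      List.length_nil] at this
    simpa using this.trans (by simpa using ht)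
  have e := PolyExec.move (g := g) 1 0 (by simp)
    (fun x : List Bool => [[], (DeltaStab.lhead x).reverse, [], []]) (by simp) (by simp) hlen
  refine ⟨_, (PolyExec.seq (P := .readHead) (a := fun x : List Bool => ofList [x, [], [], []]) ⟨6 * .X + 4, fun x => ?_⟩
    e).congr (fun x => ofList_one _) fun x => ?_⟩
  · obtain ⟨t, ht, e⟩ := key x []
    rw [List.append_nil] at e
    exact ⟨t, by simpa using ht, e⟩
  · rw [ofList_one]; simp

@[fun_prop]
theorem ltail : FP g fun x => DeltaStab.ltail x := by
  have key : ∀ z : List Bool, ∃ t ≤ 6 * z.length + 6, Exec g.ask .dropHead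
      (ofList [z, [], [], []]) (ofList [[], (DeltaStab.ltail z).reverse, [], []]) t := by
    have hpop : ∀ (b : Bool) (z : List Bool),
        Exec g.ask (.pop 0) (ofList [b :: z, [], [], []]) (ofList [z, [], [], []]) 1 := by
      intro b z
      have h₁ := Exec.pop (g := g.ask) (ofList [b :: z, [], [], []]) 0
      rwa [update_ofList _ _ (by simp)] at h₁
    intro z
    induction z using DeltaStab.ltail.induct with
    | case1 b z ih =>
      obtain ⟨t, ht, e⟩ := ih
      exact ⟨1 + 1 + 1 + t + 1, by simp only [List.length_cons]; omega, .loopCons (by simp [ofList])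
        (.iteTrue rfl (.seq (hpop _ _) (hpop _ _))) e⟩
    | case2 z =>
      obtain ⟨t, ht, e⟩ := Exec.drain (g := g.ask) (k := 0) (P := fun b => .push 1 b)
        (fun l a => ofList [l, a, [], []]) (fun b a => b :: a) 1 (fun _ _ => True)
        (fun l a => by simp [ofList]) (fun l l' a => by simp)
        (fun b l a _ => ⟨trivial, 1, le_rfl, by
          have h₁ := Exec.push (g := g.ask) (ofList [l, a, [], []]) 1 b
          rwa [update_ofList _ _ (by simp)] at h₁⟩) z [] trivial
      rw [foldl_cons_eq, List.append_nil] at e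
      refine ⟨1 + t + 1 + 1 + 1, by simp only [List.length_cons]; omega, .loopCons (by simp [ofList])
        (.iteFalse rfl (.seq (hpop _ _) e)) (.loopNil rfl)⟩
    | case3 z h₁ h₂ =>
      rw [DeltaStab.ltail] <;> [skip; exact h₁; exact h₂]
      rcases z with _ | ⟨_ | _, z⟩
      · exact ⟨1, by simp, .loopNil rfl⟩
      · exact (h₂ z rfl).elim
      · rcases z with _ | ⟨b, z⟩
        · refine ⟨1 + 1 + 1 + 1 + 1, by simp, .loopCons (by simp [ofList])
            (.iteTrue rfl (.seq (hpop _ _) ?_)) (.loopNil rfl)⟩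
          have h₁ := Exec.pop (g := g.ask) (ofList [[], [], [], []]) 0
          rwa [update_ofList _ _ (by simp)] at h₁
        · exact (h₁ b z rfl).elim
  have hlen : PolyLen fun x : List Bool => (DeltaStab.ltail x).reverse :=
    ⟨.X, fun x => by simpa using length_ltail_le x⟩
  have e := PolyExec.move (g := g) 1 0 (by simp)
    (fun x : List Bool => [[], (DeltaStab.ltail x).reverse, [], []]) (by simp) (by simp) hlen
  refine ⟨_, (PolyExec.seq (P := .dropHead) (a := fun x : List Bool => ofList [x, [], [], []]) ⟨6 * .X + 6, fun x => ?_⟩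
    e).congr (fun x => ofList_one _) fun x => ?_⟩
  · obtain ⟨t, ht, e⟩ := key x
    exact ⟨t, by simpa using ht, e⟩
  · rw [ofList_one]; simp

end FP

end DeltaStab

end

noncomputable section

namespace DeltaStab

open Enc

/-! ### Arithmetic in polynomial time -/

instance : Enc ℕ := ⟨Nat.bits⟩

theorem enc_nat (n : ℕ) : enc n = n.bits := rfl

theorem length_enc_nat (n : ℕ) : (enc n).length = n.size := Nat.size_eq_bits_len n

instance {α β : Type} [Enc α] [Enc β] : Enc (α × β) :=
  ⟨fun p => encodeList [enc p.1, enc p.2]⟩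

theorem enc_prod {α β : Type} [Enc α] [Enc β] (p : α × β) :
    enc p = lcons (enc p.1) (lcons (enc p.2) []) := by
  simp [enc]

@[simp]
theorem length_enc_prod {α β : Type} [Enc α] [Enc β] (p : α × β) :
    (enc p).length = 2 * (enc p.1).length + 2 * (enc p.2).length + 2 := by
  rw [enc_prod]; simp; omega

variable {g : Oracle} {α β γ : Type} [Enc α] [Enc β] [Enc γ]

namespace FP

@[fun_prop]
theorem prodMk {f : α → β} {h : α → γ} (hf : FP g f) (hh : FP g h) : FP g fun x => (f x, h x) :=
  ((FP.enc.comp hf).lcons ((FP.enc.comp hh).lcons nil)).recode fun x => by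
    rw [enc_prod]; rfl

@[fun_prop]
theorem fst : FP g fun x : α × β => x.1 :=
  (lhead.comp FP.enc).recode fun x => by rw [enc_prod]; simp

@[fun_prop]
theorem snd : FP g fun x : α × β => x.2 :=
  (lhead.comp (ltail.comp FP.enc)).recode fun x => by rw [enc_prod]; simp

@[fun_prop]
theorem and {f h : α → Bool} (hf : FP g f) (hh : FP g h) : FP g fun x => (f x && h x) :=
  (hf.cond hh (const false)).recode fun x => by cases f x <;> rfl

@[fun_prop]
theorem or {f h : α → Bool} (hf : FP g f) (hh : FP g h) : FP g fun x => (f x || h x) :=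
  (hf.cond (const true) hh).recode fun x => by cases f x <;> rfl

@[fun_prop]
theorem not {f : α → Bool} (hf : FP g f) : FP g fun x => !f x :=
  (hf.cond (const false) (const true)).recode fun x => by cases f x <;> rfl

@[fun_prop]
theorem xor {f h : α → Bool} (hf : FP g f) (hh : FP g h) : FP g fun x => Bool.xor (f x) (h x) :=
  (hf.cond hh.not hh).recode fun x => by cases f x <;> simp

@[fun_prop]
theorem listCons {f : α → Bool} {h : α → List Bool} (hf : FP g f) (hh : FP g h) :
    FP g fun x => f x :: h x :=
  (hf.cond ((cons true).comp hh) ((cons false).comp hh)).recode fun x => by cases f x <;> rfl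

@[fun_prop]
theorem bits : FP g fun n : ℕ => n.bits := FP.enc

end FP

/-- Parity as a bit. -/
def isOdd (n : ℕ) : Bool := decide (n % 2 = 1)

/-- Half of a number, rounded down. -/
def half (n : ℕ) : ℕ := n / 2

/-- The number `2 n + b`. -/
def twiceAdd (b : Bool) (n : ℕ) : ℕ := 2 * n + b.toNat

theorem twiceAdd_half (n : ℕ) : twiceAdd (isOdd n) (half n) = n := by
  unfold twiceAdd isOdd half
  rcases Nat.mod_two_eq_zero_or_one n with h | h <;> simp [h] <;> omega

/-- The excluded case is the digit 0 put in front of the empty numeral: `Nat.bits` has no leading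
zeros and represents 0 by the empty list. -/
theorem bits_twiceAdd (b : Bool) (n : ℕ) (h : b = true ∨ n ≠ 0) :
    (twiceAdd b n).bits = b :: n.bits := by
  cases b
  · simpa [twiceAdd] using Nat.bit0_bits n (by simpa using h)
  · simp [twiceAdd]

theorem bits_eq (n : ℕ) (h : n ≠ 0) : n.bits = isOdd n :: (half n).bits := by
  conv_lhs => rw [← twiceAdd_half n]
  apply bits_twiceAdd
  by_contra! hc
  apply h
  rw [← twiceAdd_half n, hc.2]
  simp [twiceAdd, hc.1]

namespace FP

@[fun_prop]
theorem isOdd : FP g fun n => isOdd n :=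
  (headBit.comp bits).recode fun n => by
    by_cases h : n = 0
    · subst h; rfl
    · rw [bits_eq n h]; rfl

@[fun_prop]
theorem half : FP g fun n => half n :=
  (tail.comp bits).recode fun n => by
    by_cases h : n = 0
    · subst h; rfl
    · rw [bits_eq n h]; rfl

@[fun_prop]
theorem twiceAdd {f : α → Bool} {h : α → ℕ} (hf : FP g f) (hh : FP g h) :
    FP g fun x => twiceAdd (f x) (h x) := by
  have : FP g fun x => bif (h x).bits.isEmpty && !f x then [] else f x :: (h x).bits := by fun_prop
  refine this.recode fun x => ?_
  by_cases hx : f x = true ∨ h x ≠ 0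
  · have e : ((h x).bits.isEmpty && !f x) = false := by
      rcases hx with hx | hx
      · simp [hx]
      · simp [bits_eq _ hx]
    rw [e, enc_nat, bits_twiceAdd _ _ hx]
    rfl
  · push Not at hx
    rw [hx.2]
    simp [hx.1, DeltaStab.twiceAdd, enc_nat]

/-- A typed form of iteration with an explicit bound on the iterates. -/
theorem iterate_of_le {u : α → List Bool} {f : α → β} {h : β → β} (hu : FP g u) (hf : FP g f)
    (hh : FP g h) (p : Polynomial ℕ)
    (hb : ∀ x, ∀ j ≤ (u x).length, (Enc.enc (h^[j] (f x))).length ≤ p.eval (Enc.enc x).length)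
    {k : α → β} (hk : ∀ x, k x = h^[(u x).length] (f x)) : FP g k := by
  obtain rfl : k = _ := funext hk
  exact hu.iterate hf hh ⟨p, hb⟩

end FP

/-- The number with given binary digits, the most significant first. -/
def ofDigits (l : List Bool) : ℕ := l.foldl (fun n b => twiceAdd b n) 0

theorem foldl_twiceAdd (l : List Bool) (n : ℕ) :
    l.foldl (fun n b => twiceAdd b n) n = n * 2 ^ l.length + ofDigits l := by
  unfold ofDigits
  induction l generalizing n with
  | nil => simp
  | cons b l ih =>
    simp only [List.foldl_cons, List.length_cons]
    rw [ih, ih (twiceAdd b 0)]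
    simp only [twiceAdd]
    ring

theorem ofDigits_cons (b : Bool) (l : List Bool) :
    ofDigits (b :: l) = b.toNat * 2 ^ l.length + ofDigits l := by
  rw [ofDigits, List.foldl_cons, foldl_twiceAdd]
  simp [twiceAdd]

theorem ofDigits_lt (l : List Bool) : ofDigits l < 2 ^ l.length := by
  induction l with
  | nil => simp [ofDigits]
  | cons b l ih =>
    rw [ofDigits_cons, List.length_cons, pow_succ]
    have := Bool.toNat_le b
    nlinarith

theorem ofDigits_reverse_bits (n : ℕ) : ofDigits n.bits.reverse = n := by
  induction n using Nat.strong_induction_on with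
  | _ n ih =>
    by_cases h : n = 0
    · subst h; rfl
    · have hlt : half n < n := by unfold half; omega
      rw [bits_eq n h, List.reverse_cons]
      unfold ofDigits
      rw [List.foldl_append]
      change twiceAdd (isOdd n) (ofDigits (half n).bits.reverse) = n
      rw [ih _ hlt, twiceAdd_half]

@[fun_prop]
theorem FP.ofDigits : FP g fun l => ofDigits l := by
  have hstep : FP g fun s : List Bool × ℕ => (s.1.tail, DeltaStab.twiceAdd (s.1.headD false) s.2) := by
    fun_prop
  have key : ∀ (j : ℕ) (l : List Bool) (n : ℕ), j ≤ l.length →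
      (fun s : List Bool × ℕ => (s.1.tail, DeltaStab.twiceAdd (s.1.headD false) s.2))^[j] (l, n) =
        (l.drop j, (l.take j).foldl (fun n b => DeltaStab.twiceAdd b n) n) := by
    intro j
    induction j with
    | zero => simp
    | succ j ih =>
      intro l n hj
      rcases l with _ | ⟨b, l⟩
      · simp at hj
      · rw [Function.iterate_succ_apply]
        simpa using ih l (DeltaStab.twiceAdd b n) (by simpa using hj)
  have : FP g fun l : List Bool =>
      (fun s : List Bool × ℕ => (s.1.tail, DeltaStab.twiceAdd (s.1.headD false) s.2))^[l.length]
        (l, 0) := by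
    refine FP.iterate_of_le (u := fun l => l) (f := fun l => (l, 0)) (by fun_prop) (by fun_prop)
      hstep (4 * .X + 2) (fun l j hj => ?_) (fun _ => rfl)
    rw [key j l 0 hj, length_enc_prod, length_enc_nat]
    have h₁ : (DeltaStab.ofDigits (l.take j)).size ≤ l.length := by
      rw [Nat.size_le]
      refine (ofDigits_lt _).trans_le (Nat.pow_le_pow_right (by omega) ?_)
      simp
    change 2 * (l.drop j).length + 2 * (DeltaStab.ofDigits (l.take j)).size + 2 ≤ _
    simp
    omega
  refine (FP.snd.comp this).recode fun l => ?_
  rw [key _ l 0 le_rfl]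
  simp [DeltaStab.ofDigits]

theorem iterate_half (n j : ℕ) : half^[j] n = n / 2 ^ j := by
  induction j with
  | zero => simp
  | succ j ih => rw [Function.iterate_succ_apply', ih, half, Nat.div_div_eq_div_mul, pow_succ]

/-- One step of binary addition on `(a, b, carry, digits of the sum)`. -/
def addStep (s : ℕ × ℕ × Bool × List Bool) : ℕ × ℕ × Bool × List Bool :=
  (half s.1, half s.2.1,
    (isOdd s.1 && isOdd s.2.1) || (s.2.2.1 && (isOdd s.1 || isOdd s.2.1)),
    Bool.xor (Bool.xor (isOdd s.1) (isOdd s.2.1)) s.2.2.1 :: s.2.2.2)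

/-- Schoolbook addition: the digits already produced, together with the shifted sum of the remaining
parts and the carry, always represent a + b. -/
theorem addStep_iterate (a b j : ℕ) :
    ∃ c o, addStep^[j] (a, b, false, []) = (a / 2 ^ j, b / 2 ^ j, c, o) ∧ o.length = j ∧
      a + b = 2 ^ j * (a / 2 ^ j + b / 2 ^ j + c.toNat) + ofDigits o := by
  induction j with
  | zero => exact ⟨false, [], by simp [ofDigits]⟩
  | succ j ih =>
    obtain ⟨c, o, h₁, h₂, h₃⟩ := ih
    rw [Function.iterate_succ_apply', h₁]
    refine ⟨_, _, by
      simp only [addStep, half, Nat.div_div_eq_div_mul, ← pow_succ]; rfl, by simp [h₂], ?_⟩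
    rw [ofDigits_cons, h₂, h₃, pow_succ, ← Nat.div_div_eq_div_mul, ← Nat.div_div_eq_div_mul]
    generalize a / 2 ^ j = a'
    generalize b / 2 ^ j = b'
    rw [← add_assoc, mul_assoc, mul_comm _ (2 ^ j), ← mul_add]
    congr 2
    unfold isOdd
    rcases Nat.mod_two_eq_zero_or_one a' with ha | ha <;>
      rcases Nat.mod_two_eq_zero_or_one b' with hb | hb <;> cases c <;> simp [ha, hb] <;> omega

theorem FP.natAdd : FP g fun p : ℕ × ℕ => p.1 + p.2 := by
  have hstep : FP g addStep := by unfold addStep; fun_prop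
  have : FP g fun p : ℕ × ℕ =>
      addStep^[(DeltaStab.lcons p.1.bits p.2.bits).length] (p.1, p.2, false, []) := by
    refine FP.iterate_of_le (u := fun p : ℕ × ℕ => DeltaStab.lcons p.1.bits p.2.bits)
      (f := fun p : ℕ × ℕ => (p.1, p.2, false, [])) (by fun_prop) (by fun_prop)
      hstep (100 * .X + 100) (fun p j hj => ?_) (fun _ => rfl)
    obtain ⟨c, o, h₁, h₂, -⟩ := addStep_iterate p.1 p.2 j
    have e₁ := Nat.size_le_size (Nat.div_le_self p.1 (2 ^ j))
    have e₂ := Nat.size_le_size (Nat.div_le_self p.2 (2 ^ j))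
    rw [length_lcons, Nat.size_eq_bits_len, Nat.size_eq_bits_len] at hj
    rw [h₁]
    simp only [length_enc_prod, length_enc_nat, enc_bool, enc_list, List.length_singleton,
      Polynomial.eval_add, Polynomial.eval_mul, Polynomial.eval_ofNat, Polynomial.eval_X]
    omega
  have h2 : FP g fun p : ℕ × ℕ => DeltaStab.ofDigits
      (addStep^[(DeltaStab.lcons p.1.bits p.2.bits).length] (p.1, p.2, false, [])).2.2.2 := by
    fun_prop
  refine h2.recode fun p => ?_
  congr 1
  obtain ⟨c, o, h₁, h₂, h₃⟩ :=
    addStep_iterate p.1 p.2 (DeltaStab.lcons p.1.bits p.2.bits).length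
  rw [h₁]
  simp only
  set j := (DeltaStab.lcons p.1.bits p.2.bits).length with hj
  rw [length_lcons, Nat.size_eq_bits_len, Nat.size_eq_bits_len] at hj
  -- The number of rounds exceeds the lengths of both summands by at least one, so that the final
  -- carry is zero as well.
  have l₁ : p.1 < 2 ^ (j - 1) :=
    p.1.lt_size_self.trans_le (Nat.pow_le_pow_right (by omega) (by omega))
  have l₂ : p.2 < 2 ^ (j - 1) :=
    p.2.lt_size_self.trans_le (Nat.pow_le_pow_right (by omega) (by omega))
  have l₃ : 2 ^ j = 2 ^ (j - 1) * 2 := by rw [← pow_succ]; congr 1; omega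
  have : p.1 / 2 ^ j + p.2 / 2 ^ j + c.toNat = 0 := by
    by_contra hne
    have : 2 ^ j * 1 ≤ 2 ^ j * (p.1 / 2 ^ j + p.2 / 2 ^ j + c.toNat) :=
      Nat.mul_le_mul_left _ (Nat.pos_of_ne_zero hne)
    omega
  rw [this] at h₃
  omega

@[fun_prop]
theorem FP.add {f h : α → ℕ} (hf : FP g f) (hh : FP g h) : FP g fun x => f x + h x :=
  FP.natAdd.comp (hf.prodMk hh)

/-- One step of binary multiplication on `(a, b, product so far)`. -/
def mulStep (s : ℕ × ℕ × ℕ) : ℕ × ℕ × ℕ :=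
  (half s.1, twiceAdd false s.2.1, bif isOdd s.1 then s.2.2 + s.2.1 else s.2.2)

/-- Multiplication by shifting and adding. The invariant also shows that the partial product `c`
never exceeds a b, which bounds its length during the iteration. -/
theorem mulStep_iterate (a b j : ℕ) :
    ∃ c, mulStep^[j] (a, b, 0) = (a / 2 ^ j, b * 2 ^ j, c) ∧
      a * b = (a / 2 ^ j) * (b * 2 ^ j) + c := by
  induction j with
  | zero => exact ⟨0, by simp⟩
  | succ j ih =>
    obtain ⟨c, h₁, h₂⟩ := ih
    rw [Function.iterate_succ_apply', h₁]
    refine ⟨_, by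
      simp only [mulStep, half, Nat.div_div_eq_div_mul, twiceAdd, Bool.toNat_false,
        add_zero, pow_succ, mul_comm 2, mul_assoc]; rfl, ?_⟩
    rw [h₂, pow_succ, ← Nat.div_div_eq_div_mul]
    generalize a / 2 ^ j = a'
    unfold isOdd
    rcases Nat.mod_two_eq_zero_or_one a' with ha | ha
    · obtain ⟨k, rfl⟩ : ∃ k, a' = 2 * k := ⟨a' / 2, by omega⟩
      simp [ha]; ring
    · obtain ⟨k, rfl⟩ : ∃ k, a' = 2 * k + 1 := ⟨a' / 2, by omega⟩
      have : (2 * k + 1) / 2 = k := by omega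
      simp [ha, this]; ring

theorem size_mul_le (a b : ℕ) : (a * b).size ≤ a.size + b.size := by
  rw [Nat.size_le, pow_add]
  exact Nat.mul_lt_mul'' a.lt_size_self b.lt_size_self

theorem FP.natMul : FP g fun p : ℕ × ℕ => p.1 * p.2 := by
  have hstep : FP g mulStep := by unfold mulStep; fun_prop
  have : FP g fun p : ℕ × ℕ => mulStep^[p.1.bits.length] (p.1, p.2, 0) := by
    refine FP.iterate_of_le (u := fun p : ℕ × ℕ => p.1.bits)
      (f := fun p : ℕ × ℕ => (p.1, p.2, 0)) (by fun_prop) (by fun_prop)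
      hstep (100 * .X + 100) (fun p j hj => ?_) (fun _ => rfl)
    obtain ⟨c, h₁, h₂⟩ := mulStep_iterate p.1 p.2 j
    have e₁ := Nat.size_le_size (Nat.div_le_self p.1 (2 ^ j))
    have e₂ := size_mul_le p.2 (2 ^ j)
    have e₃ : c.size ≤ p.1.size + p.2.size :=
      (Nat.size_le_size (by omega)).trans (size_mul_le p.1 p.2)
    rw [Nat.size_pow] at e₂
    rw [Nat.size_eq_bits_len] at hj
    rw [h₁]
    simp only [length_enc_prod, length_enc_nat,
      Polynomial.eval_add, Polynomial.eval_mul, Polynomial.eval_ofNat, Polynomial.eval_X]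
    omega
  refine (FP.snd.comp (FP.snd.comp this)).recode fun p => ?_
  obtain ⟨c, h₁, h₂⟩ := mulStep_iterate p.1 p.2 p.1.bits.length
  rw [h₁, h₂, Nat.size_eq_bits_len, Nat.div_eq_of_lt p.1.lt_size_self]
  simp

@[fun_prop]
theorem FP.mul {f h : α → ℕ} (hf : FP g f) (hh : FP g h) : FP g fun x => f x * h x :=
  FP.natMul.comp (hf.prodMk hh)

/-- One step of the comparison of binary numbers, on `(a, b, result for the lower digits)`. -/
def bleStep (s : ℕ × ℕ × Bool) : ℕ × ℕ × Bool :=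
  (half s.1, half s.2.1,
    bif Bool.xor (isOdd s.1) (isOdd s.2.1) then isOdd s.2.1 else s.2.2)

/-- Reading from the lowest digit upwards, the last position where the digits differ decides; `c` is
the comparison of the parts already read. -/
theorem bleStep_iterate (a b j : ℕ) :
    ∃ c, bleStep^[j] (a, b, true) = (a / 2 ^ j, b / 2 ^ j, c) ∧
      (a ≤ b ↔ a / 2 ^ j < b / 2 ^ j ∨ (a / 2 ^ j = b / 2 ^ j ∧ c = true)) := by
  induction j with
  | zero => exact ⟨true, by simp, by simp; omega⟩
  | succ j ih =>
    obtain ⟨c, h₁, h₂⟩ := ih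
    rw [Function.iterate_succ_apply', h₁]
    refine ⟨_, by
      simp only [bleStep, half, Nat.div_div_eq_div_mul, ← pow_succ]; rfl, ?_⟩
    rw [h₂, pow_succ, ← Nat.div_div_eq_div_mul, ← Nat.div_div_eq_div_mul]
    generalize a / 2 ^ j = a'
    generalize b / 2 ^ j = b'
    unfold isOdd
    rcases Nat.mod_two_eq_zero_or_one a' with ha | ha <;>
      rcases Nat.mod_two_eq_zero_or_one b' with hb | hb <;> cases c <;> simp [ha, hb] <;> omega

theorem FP.natBle : FP g fun p : ℕ × ℕ => Nat.ble p.1 p.2 := by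
  have hstep : FP g bleStep := by unfold bleStep; fun_prop
  have : FP g fun p : ℕ × ℕ =>
      bleStep^[(DeltaStab.lcons p.1.bits p.2.bits).length] (p.1, p.2, true) := by
    refine FP.iterate_of_le (u := fun p : ℕ × ℕ => DeltaStab.lcons p.1.bits p.2.bits)
      (f := fun p : ℕ × ℕ => (p.1, p.2, true)) (by fun_prop) (by fun_prop)
      hstep (100 * .X + 100) (fun p j hj => ?_) (fun _ => rfl)
    obtain ⟨c, h₁, -⟩ := bleStep_iterate p.1 p.2 j
    have e₁ := Nat.size_le_size (Nat.div_le_self p.1 (2 ^ j))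
    have e₂ := Nat.size_le_size (Nat.div_le_self p.2 (2 ^ j))
    rw [h₁]
    simp only [length_enc_prod, length_enc_nat, enc_bool, List.length_singleton,
      Polynomial.eval_add, Polynomial.eval_mul, Polynomial.eval_ofNat, Polynomial.eval_X]
    omega
  refine (FP.snd.comp (FP.snd.comp this)).recode fun p => ?_
  obtain ⟨c, h₁, h₂⟩ := bleStep_iterate p.1 p.2 (DeltaStab.lcons p.1.bits p.2.bits).length
  rw [h₁]
  set j := (DeltaStab.lcons p.1.bits p.2.bits).length with hj
  rw [length_lcons, Nat.size_eq_bits_len, Nat.size_eq_bits_len] at hj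
  have l₁ : p.1 < 2 ^ j := p.1.lt_size_self.trans_le (Nat.pow_le_pow_right (by omega) (by omega))
  have l₂ : p.2 < 2 ^ j := p.2.lt_size_self.trans_le (Nat.pow_le_pow_right (by omega) (by omega))
  rw [Nat.div_eq_of_lt l₁, Nat.div_eq_of_lt l₂] at h₂
  simp only [lt_irrefl, false_or, true_and] at h₂
  congr 1
  rw [Bool.eq_iff_iff, ← h₂, Nat.ble_eq]

@[fun_prop]
theorem FP.ble {f h : α → ℕ} (hf : FP g f) (hh : FP g h) : FP g fun x => Nat.ble (f x) (h x) :=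
  FP.natBle.comp (hf.prodMk hh)

/-- Two to the length of a string. -/
def pow2 (u : List Bool) : ℕ := 2 ^ u.length

@[fun_prop]
theorem FP.pow2 : FP g fun u => pow2 u := by
  have key : ∀ j : ℕ, (DeltaStab.twiceAdd false)^[j] 1 = 2 ^ j := by
    intro j
    induction j with
    | zero => rfl
    | succ j ih => rw [Function.iterate_succ_apply', ih]; simp [DeltaStab.twiceAdd]; ring
  refine FP.iterate_of_le (u := fun u => u) (f := fun _ => 1) (h := DeltaStab.twiceAdd false)
    (by fun_prop) (by fun_prop) (by fun_prop) (.X + 1) (fun u j hj => ?_)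
    (fun u => by rw [key]; rfl)
  rw [key, length_enc_nat, Nat.size_pow]
  simpa using hj

/-- Division by two to the length of a string, rounded down. -/
def shiftDown (u : List Bool) (n : ℕ) : ℕ := n / 2 ^ u.length

@[fun_prop]
theorem FP.shiftDown {u : α → List Bool} {f : α → ℕ} (hu : FP g u) (hf : FP g f) :
    FP g fun x => shiftDown (u x) (f x) := by
  obtain ⟨p, hp⟩ := hf.polyLen
  refine FP.iterate_of_le (u := u) (f := f) (h := DeltaStab.half) hu hf (by fun_prop) p
    (fun x j hj => ?_) (fun x => by rw [iterate_half]; rfl)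
  rw [iterate_half, length_enc_nat]
  exact (Nat.size_le_size (Nat.div_le_self _ _)).trans (by rw [← length_enc_nat]; exact hp x)

/-- The string with a given index in a coded list of strings. -/
def nthString (u y : List Bool) : List Bool := lhead (ltail^[u.length] y)

theorem length_iterate_ltail_le (y : List Bool) (j : ℕ) : (ltail^[j] y).length ≤ y.length := by
  induction j with
  | zero => simp
  | succ j ih => rw [Function.iterate_succ_apply']; exact (length_ltail_le _).trans ih

@[fun_prop]
theorem FP.nthString {u f : α → List Bool} (hu : FP g u) (hf : FP g f) :
    FP g fun x => nthString (u x) (f x) := by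
  obtain ⟨p, hp⟩ := hf.polyLen
  exact FP.lhead.comp (FP.iterate_of_le (u := u) (f := f) (h := DeltaStab.ltail) hu hf
    (by fun_prop) p (fun x j hj => (length_iterate_ltail_le _ _).trans (hp x)) (fun x => rfl))

/-! ### Folds over an initial segment of the natural numbers -/

theorem length_unary (k : ℕ) : (unary k).length = k := by simp [unary]

/-- By `hsize` each round lengthens the accumulator only by the length of the new value and a
constant, so its length stays polynomial after polynomially many rounds. -/
theorem FP.rangeFold {u : α → List Bool} {f : α × List Bool → β} {op : γ × β → γ} (hu : FP g u)
    (hf : FP g f) (hop : FP g op) (a₀ : γ) (κ : ℕ)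
    (hsize : ∀ p : γ × β, (Enc.enc (op p)).length ≤ (Enc.enc p.1).length + (Enc.enc p.2).length + κ) :
    FP g fun x => (List.range (u x).length).foldl (fun a j => op (a, f (x, unary j))) a₀ := by
  -- The iterated state consists of the input, the counter in unary and the accumulator.
  have hstep : FP g fun s : α × List Bool × γ =>
      (s.1, true :: s.2.1, op (s.2.2, f (s.1, s.2.1))) := by fun_prop
  have key : ∀ (x : α) (j : ℕ), (fun s : α × List Bool × γ =>
      (s.1, true :: s.2.1, op (s.2.2, f (s.1, s.2.1))))^[j] (x, [], a₀) =
        (x, unary j, (List.range j).foldl (fun a j => op (a, f (x, unary j))) a₀) := by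
    intro x j
    induction j with
    | zero => rfl
    | succ j ih =>
      rw [Function.iterate_succ_apply', ih, List.range_succ, List.foldl_append]
      rfl
  obtain ⟨q, hq⟩ := hu.polyLen
  obtain ⟨p, hp⟩ := hf.polyLen
  set r : Polynomial ℕ := p.comp (2 * .X + 2 * q + 2) with hr
  have hfold : ∀ (x : α) (j : ℕ), j ≤ (u x).length →
      (Enc.enc ((List.range j).foldl (fun a j => op (a, f (x, unary j))) a₀)).length ≤
        (Enc.enc a₀).length + j * (r.eval (Enc.enc x).length + κ) := by
    intro x j
    induction j with
    | zero => simp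
    | succ j ih =>
      intro hj
      rw [List.range_succ, List.foldl_append]
      have h₁ := hsize ((List.range j).foldl (fun a j => op (a, f (x, unary j))) a₀,
        f (x, unary j))
      have h₂ : (Enc.enc (f (x, unary j))).length ≤ r.eval (Enc.enc x).length := by
        refine (hp _).trans ?_
        rw [hr, Polynomial.eval_comp]
        apply eval_mono_nat
        have := hq x
        simp only [enc_list] at this
        simp only [length_enc_prod, enc_list, length_unary, Polynomial.eval_add,
          Polynomial.eval_mul, Polynomial.eval_ofNat, Polynomial.eval_X]
        omega
      have h₃ := ih (by omega)
      simp only [List.foldl_cons, List.foldl_nil, add_mul, one_mul] at h₁ ⊢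
      omega
  have : FP g fun x => (fun s : α × List Bool × γ =>
      (s.1, true :: s.2.1, op (s.2.2, f (s.1, s.2.1))))^[(u x).length] (x, [], a₀) := by
    refine FP.iterate_of_le (u := u) (f := fun x => (x, [], a₀)) hu (by fun_prop) hstep
      (2 * .X + 4 * q + 4 * (.C (Enc.enc a₀).length + q * (r + .C κ)) + 6) (fun x j hj => ?_)
      (fun _ => rfl)
    rw [key]
    have h₁ := hfold x j hj
    have h₂ : j ≤ q.eval (Enc.enc x).length := hj.trans (hq x)
    have h₃ : j * (r.eval (Enc.enc x).length + κ) ≤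
        q.eval (Enc.enc x).length * (r.eval (Enc.enc x).length + κ) := Nat.mul_le_mul_right _ h₂
    simp only [length_enc_prod, enc_list, length_unary, Polynomial.eval_add,
      Polynomial.eval_mul, Polynomial.eval_ofNat, Polynomial.eval_X, Polynomial.eval_C]
    omega
  refine (FP.snd.comp (FP.snd.comp this)).recode fun x => ?_
  rw [key]

/-- The sum `∑ j < |u|, f j`, the argument given in unary. -/
def sumBelow (u : List Bool) (f : List Bool → ℕ) : ℕ :=
  ∑ j ∈ Finset.range u.length, f (unary j)

/-- The concatenation of the strings `f j`, `j < |u|`, the argument given in unary. -/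
def concatBelow (u : List Bool) (f : List Bool → List Bool) : List Bool :=
  (List.range u.length).flatMap fun j => f (unary j)

/-- The conjunction of the conditions `f j`, `j < |u|`, the argument given in unary. -/
def allBelow (u : List Bool) (f : List Bool → Bool) : Bool :=
  (List.range u.length).all fun j => f (unary j)

theorem FP.sumBelow {u : α → List Bool} {f : α → List Bool → ℕ} (hu : FP g u)
    (hf : FP g fun p : α × List Bool => f p.1 p.2) : FP g fun x => sumBelow (u x) (f x) := by
  have hop : FP g fun p : ℕ × ℕ => p.1 + p.2 := by fun_prop
  refine (FP.rangeFold hu hf hop 0 1 fun p => ?_).recode fun x => ?_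
  · rw [length_enc_nat, length_enc_nat, length_enc_nat, Nat.size_le]
    have h₁ := p.1.lt_size_self
    have h₂ := p.2.lt_size_self
    have h₃ : 2 ^ p.1.size ≤ 2 ^ (p.1.size + p.2.size) := Nat.pow_le_pow_right (by omega) (by omega)
    have h₄ : 2 ^ p.2.size ≤ 2 ^ (p.1.size + p.2.size) := Nat.pow_le_pow_right (by omega) (by omega)
    rw [pow_succ]
    omega
  · congr 1
    rw [DeltaStab.sumBelow]
    induction (u x).length with
    | zero => rfl
    | succ j ih => rw [Finset.sum_range_succ, ih, List.range_succ, List.foldl_append]; rfl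

theorem FP.concatBelow {u : α → List Bool} {f : α → List Bool → List Bool} (hu : FP g u)
    (hf : FP g fun p : α × List Bool => f p.1 p.2) : FP g fun x => concatBelow (u x) (f x) := by
  have hop : FP g fun p : List Bool × List Bool => p.1 ++ p.2 := by fun_prop
  refine (FP.rangeFold hu hf hop [] 0 fun p => by simp).recode fun x => ?_
  congr 1
  rw [DeltaStab.concatBelow]
  induction (u x).length with
  | zero => rfl
  | succ j ih => rw [List.range_succ, List.foldl_append, List.flatMap_append, ih]; simp

theorem FP.allBelow {u : α → List Bool} {f : α → List Bool → Bool} (hu : FP g u)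
    (hf : FP g fun p : α × List Bool => f p.1 p.2) : FP g fun x => allBelow (u x) (f x) := by
  have hop : FP g fun p : Bool × Bool => (p.1 && p.2) := by fun_prop
  refine (FP.rangeFold hu hf hop true 0 fun p => by simp).recode fun x => ?_
  congr 1
  rw [DeltaStab.allBelow]
  induction (u x).length with
  | zero => rfl
  | succ j ih => rw [List.range_succ, List.foldl_append, List.all_append, ih]; simp

/-- This makes polynomial precisions available to programs. In unary, addition is concatenation and
multiplication by the length of the input is repetition, so induction over the polynomial suffices.
-/
theorem FP.unaryEval (p : Polynomial ℕ) : FP g fun x : List Bool => unary (p.eval x.length) := by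
  have hadd : ∀ a b, unary (a + b) = unary a ++ unary b := fun a b => by
    rw [unary, List.replicate_add]; rfl
  have hmul : ∀ (u : List Bool) (b : ℕ), unary (b * u.length) =
      DeltaStab.concatBelow u fun _ => unary b := by
    intro u b
    rw [DeltaStab.concatBelow]
    induction u.length with
    | zero => rfl
    | succ j ih => rw [mul_add, hadd, ih, List.range_succ, List.flatMap_append]; simp
  induction p using Polynomial.induction_on with
  | C a => simp only [Polynomial.eval_C]; fun_prop
  | add p q hp hq => simp only [Polynomial.eval_add, hadd]; fun_prop
  | monomial n a ih =>
    have : ∀ k : ℕ, (Polynomial.C a * Polynomial.X ^ (n + 1)).eval k =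
        (Polynomial.C a * Polynomial.X ^ n).eval k * k := fun k => by simp; ring
    simp only [this, hmul]
    exact FP.concatBelow FP.id (ih.comp FP.fst)

end DeltaStab

end

noncomputable section

namespace DeltaStab

open Enc

/-! ### Membership in the polynomial hierarchy -/

theorem mem_PTime_of_FP {g : Oracle} {f : List Bool → Bool} (hf : FP g f) :
    {x | f x = true} ∈ PTime g.ask := by
  obtain ⟨P, p, hp⟩ := hf
  refine mem_PTime_of_exec P p (fun x => [f x]) (fun x => ?_) (fun x => by simp)
  rw [Store.single_eq_ofList, Store.single_eq_ofList]
  exact hp x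

theorem compl_mem_PTime_charFn (B : Set (List Bool)) : Bᶜ ∈ PTime (charFn B) := by
  let g : Oracle := ⟨charFn B, 1, fun x => by simp [charFn]⟩
  have hf : FP g fun x => !(g.ask x).headD false := by fun_prop
  have := mem_PTime_of_FP hf
  convert this using 1
  ext x
  simp [g, charFn]

/-- One step up the hierarchy: a short string is guessed, and a single query to `B` is asked and
negated. -/
theorem exists_notMem_mem_SigmaP {g : List Bool → List Bool} {k : ℕ} {B : Set (List Bool)}
    (hB : B ∈ SigmaP g k) (p : Polynomial ℕ) :
    {x | ∃ y : List Bool, y.length ≤ p.eval x.length ∧ encodeList [x, y] ∉ B} ∈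
      SigmaP g (k + 1) :=
  ⟨B, hB, Bᶜ, compl_mem_PTime_charFn B, p, fun _ => Iff.rfl⟩

/-- Universal quantification over short strings, preceded by trivial quantifiers, gives a language
on the fourth level. -/
theorem exists_mem_SigmaP_four {g : Oracle} {r : List Bool → List Bool → Bool}
    (hr : FP g fun p : List Bool × List Bool => r p.1 p.2) (p : Polynomial ℕ) :
    ∃ L ∈ SigmaP g.ask 4, ∀ x,
      (x ∈ L → ∀ y : List Bool, y.length ≤ p.eval x.length → r x y = false) ∧
      (x ∉ L → ∃ y, r x y = true) := by
  -- Each of the four levels wraps its input in a pair, so the original input is reached by four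
  -- heads. The certificate is the second component of the outermost pair.
  have hV : FP g fun z => !r (lhead (lhead (lhead (lhead z)))) (lhead (ltail z)) := by
    have : FP g fun z : List Bool => (lhead (lhead (lhead (lhead z))), lhead (ltail z)) := by
      fun_prop
    exact (hr.comp this).not
  have h₀ : _ ∈ SigmaP g.ask 0 := mem_PTime_of_FP hV
  have h₁ := exists_notMem_mem_SigmaP h₀ p
  -- With the bound 0 only the empty string can be guessed, so this and the next two levels just
  -- complement. The three complements turn the existential statement of the first level into a
  -- universal one.
  have h₂ := exists_notMem_mem_SigmaP h₁ 0
  have h₃ := exists_notMem_mem_SigmaP h₂ 0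
  have h₄ := exists_notMem_mem_SigmaP h₃ 0
  refine ⟨_, h₄, fun x => ?_⟩
  simp only [Polynomial.eval_zero, nonpos_iff_eq_zero, List.length_eq_zero_iff, Set.mem_ofPred_eq,
    exists_eq_left, encodeList_cons, encodeList_nil, lhead_lcons, ltail_lcons, not_exists, not_and,
    not_not, not_forall, Bool.not_eq_true', Bool.not_eq_false]
  -- The certificate bound refers to the wrapped input, which is longer than `x`; by monotonicity of
  -- `p` all strings within the bound for `x` are covered.
  refine ⟨fun h y hy => Bool.eq_false_iff.mpr (h y (hy.trans (eval_mono_nat p ?_))), fun h => ?_⟩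
  · simp only [length_lcons, List.length_nil]; omega
  · obtain ⟨y, hy, hry⟩ := h
    exact ⟨y, hry⟩

/-! ### The verification of refutations of stability -/

section Verifier

variable (g : Oracle) (m : Polynomial ℕ)

/-- The binary logarithm of `2 ^ (|x| + 4)`, in unary. -/
def guard (x : List Bool) : List Bool := unary ((Polynomial.X + 4 : Polynomial ℕ).eval x.length)

/-- The precision with which values of the flow are computed, in unary. -/
def coarse (x : List Bool) : List Bool :=
  unary ((2 * Polynomial.X + 5 : Polynomial ℕ).eval x.length)

/-- The precision, in addition to `coarse x`, of the arguments of the flow, in unary. -/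
def extra (x : List Bool) : List Bool :=
  unary ((m.comp (5 * Polynomial.X + 65) + 4 : Polynomial ℕ).eval x.length)

/-- The precision with which constants and arguments of the flow are represented, in unary. -/
def fine (x : List Bool) : List Bool := coarse x ++ extra m x

/-- The dimension in unary, for an instance code `x`. -/
def dimOf (x : List Bool) : List Bool := lhead (ltail x)

/-- The oracle's answer for the term with code `c` at the arguments `d` with precision `i`. -/
def answer (x c d i : List Bool) : List Bool :=
  g.ask (encodeList [encodeList [lhead x, dimOf x, c], d, i])

/-- The integer with given sign and absolute value as a difference of natural numbers. -/
def signed (b : Bool) (v : ℕ) : ℕ × ℕ := bif b then (0, v) else (v, 0)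

/-- The dyadic coded by `s`, multiplied by `2 ^ |k|` and rounded to an integer. -/
def scaled (k s : List Bool) : ℕ × ℕ :=
  signed ((lhead s).headD false)
    (shiftDown (lhead (ltail (ltail s))) (pow2 k * ofDigits (lhead (ltail s)).reverse))

/-- The constant with code `c`, in units `2 ^ (-|fine m x|)`. -/
def constVal (x c : List Bool) : ℕ × ℕ := scaled (fine m x) (answer g x c [] (fine m x))

/-- A lower bound of the box, in units `2 ^ (-|fine m x|)`. -/
def loVal (x l : List Bool) : ℕ × ℕ := constVal g m x (encodeList [unary 1, l])

/-- An upper bound of the box, in units `2 ^ (-|fine m x|)`. -/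
def hiVal (x l : List Bool) : ℕ × ℕ := constVal g m x (encodeList [unary 2, l])

/-- A quantifier bound, in units `2 ^ (-|fine m x|)`. -/
def boundVal (k : Bound) (x : List Bool) : ℕ × ℕ :=
  constVal g m x (encodeList [unary 3, unary k.ctorIdx])

/-- An argument of the flow given by the certificate `y`, as a signed binary number. -/
def entry (y l : List Bool) : List Bool := nthString l (ltail y)

/-- The value of an entry, in units `2 ^ (-|fine m x|)`. -/
def entryVal (y l : List Bool) : ℕ × ℕ :=
  signed ((entry y l).headD false) (ofDigits (entry y l).tail.reverse)

/-- The code of an entry as a dyadic. -/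
def entryCode (x y l : List Bool) : List Bool :=
  encodeList [[(entry y l).headD false && !(ofDigits (entry y l).tail.reverse).bits.isEmpty],
    (ofDigits (entry y l).tail.reverse).bits, fine m x]

/-- The code of all arguments of the flow given by `y`. -/
def arguments (x y : List Bool) : List Bool :=
  concatBelow (true :: dimOf x) fun l => encodeList [entryCode m x y l]

/-- A coordinate of the flow, in units `2 ^ (-|fine m x|)`. -/
def flowVal (x y l : List Bool) : ℕ × ℕ :=
  scaled (fine m x) (answer g x (encodeList [unary 0, l]) (arguments m x y) (coarse x))

/-- `a ≤ b + s`. -/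
def leAdd (a b : ℕ × ℕ) (s : ℕ) : Bool := Nat.ble (a.1 + b.2) (b.1 + a.2 + s)

/-- `a - s ≤ v ≤ b + s`. -/
def inRange (a v b : ℕ × ℕ) (s : ℕ) : Bool := leAdd a v s && leAdd v b s

/-- The square of the integer `a`, if one of the parts of `a` is zero. -/
def sq (a : ℕ × ℕ) : ℕ := a.1 * a.1 + a.2 * a.2

/-- `s < (a + h) ^ 2`. -/
def sqrtLt (s : ℕ) (a : ℕ × ℕ) (h : ℕ) : Bool :=
  !Nat.ble ((a.1 + h) * (a.1 + h) + a.2 * a.2) (s + 2 * ((a.1 + h) * a.2))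

/-- `a - h ≤ 0` or `(a - h) ^ 2 ≤ s`. -/
def sqrtGe (s : ℕ) (a : ℕ × ℕ) (h : ℕ) : Bool :=
  Nat.ble a.1 (a.2 + h) ||
    Nat.ble (a.1 * a.1 + (a.2 + h) * (a.2 + h)) (s + 2 * (a.1 * (a.2 + h)))

/-- The squared norm of the initial point. -/
def startSq (x y : List Bool) : ℕ := sumBelow (dimOf x) fun l => sq (entryVal y (true :: l))

/-- The squared norm of the value of the flow. -/
def flowSq (x y : List Bool) : ℕ := sumBelow (dimOf x) fun l => sq (flowVal g m x y l)

/-- The initial point is approximately in the box. -/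
def startInBox (x y : List Bool) : Bool :=
  allBelow (dimOf x) fun l => inRange (loVal g m x l) (entryVal y (true :: l)) (hiVal g m x l) 8

/-- The value of the flow is approximately in the box. -/
def flowInBox (x y : List Bool) : Bool :=
  allBelow (dimOf x) fun l => inRange (loVal g m x l) (flowVal g m x y l) (hiVal g m x l)
    (pow2 (true :: extra m x))

/-- Half of the perturbation, in units `2 ^ (-|fine m x|)`. -/
def margin (x : List Bool) : ℕ := pow2 (extra m x ++ guard x)

/-- `y` refutes the strengthened bounded form of Lyapunov stability. -/
def refutesStable (x y : List Bool) : Bool :=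
  inRange (0, 0) (entryVal y []) (boundVal g m .T x) 8 && startInBox g m x y &&
    sqrtLt (startSq x y) (boundVal g m .δlo x) (margin m x) && flowInBox g m x y &&
    sqrtGe (flowSq g m x y) (boundVal g m .εlo x) (margin m x)

/-- `y` refutes the strengthened bounded form of convergence. -/
def refutesAttractive (x y : List Bool) : Bool :=
  inRange ((boundVal g m .T' x).1 + (boundVal g m .δ''lo x).2,
      (boundVal g m .T' x).2 + (boundVal g m .δ''lo x).1) (entryVal y [])
    ((boundVal g m .T' x).1 + (boundVal g m .δ''lo x).1,
      (boundVal g m .T' x).2 + (boundVal g m .δ''lo x).2) 8 && startInBox g m x y &&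
    sqrtLt (startSq x y) (boundVal g m .δ'lo x) (margin m x) &&
    sqrtGe (flowSq g m x y) (boundVal g m .ε'lo x) (margin m x)

/-- `y` refutes strengthened bounded asymptotic stability for the instance `x`. -/
def refutes (x y : List Bool) : Bool :=
  bif (lhead y).headD false then refutesAttractive g m x y else refutesStable g m x y

end Verifier

/-! ### The verifier runs in polynomial time -/

namespace FP

variable {g : Oracle} {m : Polynomial ℕ} {α : Type} [Enc α]
  {f h k l : α → List Bool} {a b c : α → ℕ × ℕ} {s t : α → ℕ} {u : α → Bool}

@[fun_prop]
theorem guard (hf : FP g f) : FP g fun x => guard (f x) := (unaryEval _).comp hf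

@[fun_prop]
theorem coarse (hf : FP g f) : FP g fun x => coarse (f x) := (unaryEval _).comp hf

@[fun_prop]
theorem extra (hf : FP g f) : FP g fun x => extra m (f x) := (unaryEval _).comp hf

@[fun_prop]
theorem fine (hf : FP g f) : FP g fun x => fine m (f x) := by
  unfold DeltaStab.fine; fun_prop

@[fun_prop]
theorem dimOf (hf : FP g f) : FP g fun x => dimOf (f x) := by
  unfold DeltaStab.dimOf; fun_prop

@[fun_prop]
theorem answer (hf : FP g f) (hh : FP g h) (hk : FP g k) (hl : FP g l) :
    FP g fun x => answer g (f x) (h x) (k x) (l x) := by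
  simp only [DeltaStab.answer, encodeList_cons, encodeList_nil]; fun_prop

@[fun_prop]
theorem signed (hu : FP g u) (hs : FP g s) : FP g fun x => signed (u x) (s x) := by
  unfold DeltaStab.signed; fun_prop

@[fun_prop]
theorem scaled (hf : FP g f) (hh : FP g h) : FP g fun x => scaled (f x) (h x) := by
  unfold DeltaStab.scaled; fun_prop

@[fun_prop]
theorem constVal (hf : FP g f) (hh : FP g h) : FP g fun x => constVal g m (f x) (h x) := by
  unfold DeltaStab.constVal; fun_prop

@[fun_prop]
theorem loVal (hf : FP g f) (hh : FP g h) : FP g fun x => loVal g m (f x) (h x) := by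
  simp only [DeltaStab.loVal, encodeList_cons, encodeList_nil]; fun_prop

@[fun_prop]
theorem hiVal (hf : FP g f) (hh : FP g h) : FP g fun x => hiVal g m (f x) (h x) := by
  simp only [DeltaStab.hiVal, encodeList_cons, encodeList_nil]; fun_prop

@[fun_prop]
theorem boundVal (k : Bound) (hf : FP g f) : FP g fun x => boundVal g m k (f x) := by
  unfold DeltaStab.boundVal; fun_prop

@[fun_prop]
theorem entry (hf : FP g f) (hh : FP g h) : FP g fun x => entry (f x) (h x) := by
  unfold DeltaStab.entry; fun_prop

@[fun_prop]
theorem entryVal (hf : FP g f) (hh : FP g h) : FP g fun x => entryVal (f x) (h x) := by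
  unfold DeltaStab.entryVal; fun_prop

@[fun_prop]
theorem entryCode (hf : FP g f) (hh : FP g h) (hk : FP g k) :
    FP g fun x => entryCode m (f x) (h x) (k x) := by
  simp only [DeltaStab.entryCode, encodeList_cons, encodeList_nil]; fun_prop

@[fun_prop]
theorem arguments (hf : FP g f) (hh : FP g h) : FP g fun x => arguments m (f x) (h x) := by
  simp only [DeltaStab.arguments, encodeList_cons, encodeList_nil]
  exact concatBelow (by fun_prop) (by fun_prop)

@[fun_prop]
theorem flowVal (hf : FP g f) (hh : FP g h) (hk : FP g k) :
    FP g fun x => flowVal g m (f x) (h x) (k x) := by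
  simp only [DeltaStab.flowVal, encodeList_cons, encodeList_nil]; fun_prop

@[fun_prop]
theorem leAdd (ha : FP g a) (hb : FP g b) (hs : FP g s) :
    FP g fun x => leAdd (a x) (b x) (s x) := by
  unfold DeltaStab.leAdd; fun_prop

@[fun_prop]
theorem inRange (ha : FP g a) (hb : FP g b) (hc : FP g c) (hs : FP g s) :
    FP g fun x => inRange (a x) (b x) (c x) (s x) := by
  unfold DeltaStab.inRange; fun_prop

@[fun_prop]
theorem sq (ha : FP g a) : FP g fun x => sq (a x) := by
  unfold DeltaStab.sq; fun_prop

@[fun_prop]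
theorem sqrtLt (hs : FP g s) (ha : FP g a) (ht : FP g t) :
    FP g fun x => sqrtLt (s x) (a x) (t x) := by
  unfold DeltaStab.sqrtLt; fun_prop

@[fun_prop]
theorem sqrtGe (hs : FP g s) (ha : FP g a) (ht : FP g t) :
    FP g fun x => sqrtGe (s x) (a x) (t x) := by
  unfold DeltaStab.sqrtGe; fun_prop

@[fun_prop]
theorem startSq (hf : FP g f) (hh : FP g h) : FP g fun x => startSq (f x) (h x) := by
  unfold DeltaStab.startSq
  exact sumBelow (by fun_prop) (by fun_prop)

@[fun_prop]
theorem flowSq (hf : FP g f) (hh : FP g h) : FP g fun x => flowSq g m (f x) (h x) := by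
  unfold DeltaStab.flowSq
  exact sumBelow (by fun_prop) (by fun_prop)

@[fun_prop]
theorem startInBox (hf : FP g f) (hh : FP g h) : FP g fun x => startInBox g m (f x) (h x) := by
  unfold DeltaStab.startInBox
  exact allBelow (by fun_prop) (by fun_prop)

@[fun_prop]
theorem flowInBox (hf : FP g f) (hh : FP g h) : FP g fun x => flowInBox g m (f x) (h x) := by
  unfold DeltaStab.flowInBox
  exact allBelow (by fun_prop) (by fun_prop)

@[fun_prop]
theorem margin (hf : FP g f) : FP g fun x => margin m (f x) := by
  unfold DeltaStab.margin; fun_prop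

@[fun_prop]
theorem refutesStable (hf : FP g f) (hh : FP g h) :
    FP g fun x => refutesStable g m (f x) (h x) := by
  unfold DeltaStab.refutesStable; fun_prop

@[fun_prop]
theorem refutesAttractive (hf : FP g f) (hh : FP g h) :
    FP g fun x => refutesAttractive g m (f x) (h x) := by
  unfold DeltaStab.refutesAttractive; fun_prop

theorem refutes : FP g fun p : List Bool × List Bool => refutes g m p.1 p.2 := by
  unfold DeltaStab.refutes; fun_prop

end FP

end DeltaStab

end

noncomputable section

namespace DeltaStab

/-! ### The stability formula -/

namespace Formula

variable {V : Type}

/-- The perturbation of a formula by the same constant at all atoms. -/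
def strengthen (c : ℝ) : Formula V → Formula V
  | gt t => gt fun a => t a - c
  | ge t => ge fun a => t a - c
  | and φ ψ => and (φ.strengthen c) (ψ.strengthen c)
  | or φ ψ => or (φ.strengthen c) (ψ.strengthen c)
  | all x u v φ => all x u v (φ.strengthen c)
  | ex x u v φ => ex x u v (φ.strengthen c)

theorem isPerturbation_strengthen {δ c : ℝ} (hc : |c| ≤ δ) (φ : Formula V) :
    IsPerturbation δ φ (φ.strengthen c) := by
  induction φ with
  | gt t => exact .gt t c hc
  | ge t => exact .ge t c hc
  | and φ ψ h₁ h₂ => exact .and h₁ h₂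
  | or φ ψ h₁ h₂ => exact .or h₁ h₂
  | all x u v φ h => exact .all x u v h
  | ex x u v φ h => exact .ex x u v h

theorem strengthen_allBox {n : ℕ} (c : ℝ) (x : Fin n → V) (lo hi : Fin n → ℝ) (φ : Formula V) :
    (allBox x lo hi φ).strengthen c = allBox x lo hi (φ.strengthen c) := by
  unfold allBox
  induction List.finRange n with
  | nil => rfl
  | cons i l ih => simp only [List.foldr_cons, strengthen, ih]

variable [DecidableEq V]

/-- The assignment that gives the variables `x i` the values `v i`. -/
def assign {n : ℕ} (x : Fin n → V) (v : Fin n → ℝ) (a : V → ℝ) : V → ℝ :=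
  (List.finRange n).foldl (fun a i => Function.update a (x i) (v i)) a

theorem foldl_update_of_notMem {n : ℕ} (x : Fin n → V) (v : Fin n → ℝ) (z : V)
    (l : List (Fin n)) (h : ∀ i ∈ l, x i ≠ z) (a : V → ℝ) :
    l.foldl (fun a i => Function.update a (x i) (v i)) a z = a z := by
  induction l generalizing a with
  | nil => rfl
  | cons i l ih =>
    rw [List.foldl_cons, ih fun j hj => h j (List.mem_cons_of_mem _ hj),
      Function.update_of_ne (h i List.mem_cons_self).symm]

theorem foldl_update_congr {n : ℕ} (x : Fin n → V) (v w : Fin n → ℝ)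
    (l : List (Fin n)) (h : ∀ i ∈ l, v i = w i) (a : V → ℝ) :
    l.foldl (fun a i => Function.update a (x i) (v i)) a =
      l.foldl (fun a i => Function.update a (x i) (w i)) a := by
  induction l generalizing a with
  | nil => rfl
  | cons i l ih =>
    rw [List.foldl_cons, List.foldl_cons, h i List.mem_cons_self,
      ih fun j hj => h j (List.mem_cons_of_mem _ hj)]

theorem assign_of_ne {n : ℕ} (x : Fin n → V) (v : Fin n → ℝ) (a : V → ℝ) (z : V)
    (h : ∀ i, x i ≠ z) : assign x v a z = a z :=
  foldl_update_of_notMem x v z _ (fun i _ => h i) a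

theorem assign_apply {n : ℕ} {x : Fin n → V} (hx : Function.Injective x) (v : Fin n → ℝ)
    (a : V → ℝ) (i : Fin n) : assign x v a (x i) = v i := by
  unfold assign
  suffices ∀ l : List (Fin n), l.Nodup → i ∈ l → ∀ a : V → ℝ,
      l.foldl (fun a i => Function.update a (x i) (v i)) a (x i) = v i from
    this _ (List.nodup_finRange n) (List.mem_finRange i) a
  intro l
  induction l with
  | nil => simp
  | cons j l ih =>
    intro hl hi a
    rw [List.nodup_cons] at hl
    rw [List.foldl_cons]
    rcases List.mem_cons.mp hi with rfl | hi
    · rw [foldl_update_of_notMem x v _ l (fun k hk e => hl.1 (by rw [← hx e]; exact hk))]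
      simp
    · exact ih hl.2 hi _

/-- The nested quantifiers update the assignment in the same order as `assign`, so injectivity of
`x` is not needed. The induction runs over arbitrary duplicate-free index lists. -/
theorem holds_allBox {n : ℕ} (x : Fin n → V) (lo hi : Fin n → ℝ) (φ : Formula V) (a : V → ℝ) :
    (allBox x lo hi φ).Holds a ↔
      ∀ v : Fin n → ℝ, (∀ i, lo i ≤ v i ∧ v i ≤ hi i) → φ.Holds (assign x v a) := by
  unfold allBox assign
  suffices ∀ l : List (Fin n), l.Nodup → ∀ a : V → ℝ,
      (l.foldr (fun i ψ => all (x i) (fun _ => lo i) (fun _ => hi i) ψ) φ).Holds a ↔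
        ∀ v : Fin n → ℝ, (∀ i ∈ l, lo i ≤ v i ∧ v i ≤ hi i) →
          φ.Holds (l.foldl (fun a i => Function.update a (x i) (v i)) a) by
    simpa using this _ (List.nodup_finRange n) a
  intro l
  induction l with
  | nil => exact fun _ a => ⟨fun h _ _ => h, fun h => h 0 (by simp)⟩
  | cons i l ih =>
    intro hl a
    rw [List.nodup_cons] at hl
    simp only [List.foldr_cons, Holds, List.foldl_cons]
    constructor
    · intro h v hv
      exact (ih hl.2 _).mp (h (v i) (hv i List.mem_cons_self)) v
        fun j hj => hv j (List.mem_cons_of_mem _ hj)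
    · intro h r hr
      refine (ih hl.2 _).mpr fun v hv => ?_
      have hne : ∀ j ∈ l, j ≠ i := fun j hj e => hl.1 (e ▸ hj)
      have := h (Function.update v i r) fun j hj => by
        rcases List.mem_cons.mp hj with rfl | hj
        · simpa using hr
        · rw [Function.update_of_ne (hne j hj)]; exact hv j hj
      rw [foldl_update_congr x _ v l fun j hj => Function.update_of_ne (hne j hj) _ _] at this
      simpa using this

end Formula

/-! ### The stability formula under strengthening of its atoms -/

namespace BoundedSystem

open Formula

variable (B : BoundedSystem)

/-- The points of the box. -/
def box : Set (Fin B.n → ℝ) := {v | ∀ i, B.lo i ≤ v i ∧ v i ≤ B.hi i}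

/-- The flow on coordinate vectors. -/
def flowAt (t : ℝ) (v : Fin B.n → ℝ) : EuclideanSpace ℝ (Fin B.n) := flowMap B.f t (WithLp.toLp 2 v)

theorem flowAt_zero (v : Fin B.n → ℝ) : B.flowAt 0 v = WithLp.toLp 2 v := by
  simp [flowAt, flowMap]

theorem vec_assign {n : ℕ} {x : Fin n → Var n} (hx : Function.Injective x) (v : Fin n → ℝ)
    (a : Var n → ℝ) : vec x (assign x v a) = WithLp.toLp 2 v := by
  unfold vec
  congr 1
  funext i
  exact assign_apply hx v a i

theorem vec_congr {n : ℕ} {x : Fin n → Var n} {a b : Var n → ℝ} (h : ∀ i, a (x i) = b (x i)) :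
    vec x a = vec x b := by
  unfold vec
  congr 1
  funext i
  exact h i

theorem x₀_injective {n : ℕ} : Function.Injective (Var.x₀ : Fin n → Var n) :=
  fun _ _ h => by cases h; rfl

theorem xₜ_injective {n : ℕ} : Function.Injective (Var.xₜ : Fin n → Var n) :=
  fun _ _ h => by cases h; rfl

/-- The premises of the implication occur negated, so raising the atoms by `c` relaxes them: norms
below δ + c and a distance to the flow of up to `c` are admitted. The conclusion is tightened to ε -
c. -/
theorem holds_strengthen_lStable (c : ℝ) (a : Var B.n → ℝ) :
    (B.lStable.strengthen c).Holds a ↔ ∀ ε, B.b .εlo ≤ ε ∧ ε ≤ B.b .εhi →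
      ∃ δ, (B.b .δlo ≤ δ ∧ δ ≤ ε) ∧ ∀ t, 0 ≤ t ∧ t ≤ B.b .T → ∀ v ∈ B.box, ∀ w ∈ B.box,
        (‖WithLp.toLp 2 v‖ ≥ δ + c ∨ ‖WithLp.toLp 2 w - B.flowAt t v‖ > c) ∨
          ‖WithLp.toLp 2 w‖ < ε - c := by
  simp only [lStable, strengthen, strengthen_allBox, Holds, holds_allBox, imp, neg, Formula.lt,
    flow, const, box, Set.mem_ofPred_eq, Function.update_self]
  have hv : ∀ (v w : Fin B.n → ℝ) (a : Var B.n → ℝ),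
      vec .x₀ (assign .xₜ w (assign .x₀ v a)) = WithLp.toLp 2 v := fun v w a => by
    rw [vec_congr (b := assign .x₀ v a) fun i => assign_of_ne _ _ _ _ (by simp),
      vec_assign x₀_injective]
  simp only [hv, vec_assign xₜ_injective]
  have hne : ∀ (z : Var B.n) (v w : Fin B.n → ℝ) (a : Var B.n → ℝ), (∀ i, Var.x₀ i ≠ z) →
      (∀ i, Var.xₜ i ≠ z) → assign .xₜ w (assign .x₀ v a) z = a z := fun z v w a h₁ h₂ => by
    rw [assign_of_ne _ _ _ _ h₂, assign_of_ne _ _ _ _ h₁]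
  simp only [hne Var.ε _ _ _ (by simp) (by simp), hne Var.δ _ _ _ (by simp) (by simp),
    hne Var.t _ _ _ (by simp) (by simp)]
  simp only [Function.update_self, ne_eq, reduceCtorEq, not_false_eq_true, Function.update_of_ne,
    flowAt]
  have e₁ : ∀ x y : ℝ, -(x - y) - c ≥ 0 ↔ y ≥ x + c := fun x y => by
    constructor <;> intro h <;> linarith
  have e₂ : ∀ x : ℝ, - -x - c > 0 ↔ x > c := fun x => by
    constructor <;> intro h <;> linarith
  have e₃ : ∀ x y : ℝ, x - y - c > 0 ↔ y < x - c := fun x y => by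
    constructor <;> intro h <;> linarith
  simp only [e₁, e₂, e₃]

theorem holds_strengthen_attractive (c : ℝ) (a : Var B.n → ℝ) :
    (B.attractive.strengthen c).Holds a ↔ ∃ δ', (B.b .δ'lo ≤ δ' ∧ δ' ≤ B.b .δ'hi) ∧
      ∀ t, 0 ≤ t ∧ t ≤ B.b .T' → ∀ v ∈ B.box, ∀ w ∈ B.box,
        (‖WithLp.toLp 2 v‖ ≥ δ' + c ∨ ‖WithLp.toLp 2 w - B.flowAt t v‖ > c) ∨
          ∀ ε', B.b .ε'lo ≤ ε' ∧ ε' ≤ B.b .ε'hi →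
            ∃ δ'', (B.b .δ''lo ≤ δ'' ∧ δ'' ≤ B.b .δ''hi) ∧
              ∀ s, B.b .T' - δ'' ≤ s ∧ s ≤ B.b .T' + δ'' → ‖B.flowAt s v‖ < ε' - c := by
  simp only [attractive, limAtT', strengthen, strengthen_allBox, Holds, holds_allBox, imp, neg,
    Formula.lt, flow, const, box, Set.mem_ofPred_eq, Function.update_self]
  have hup : ∀ (a : Var B.n → ℝ) (z : Var B.n) (r : ℝ), (∀ i, Var.x₀ i ≠ z) →
      vec .x₀ (Function.update a z r) = vec .x₀ a := fun a z r h =>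
    vec_congr fun i => Function.update_of_ne (h i) _ _
  simp only [hup _ Var.s _ (by simp), hup _ Var.δ'' _ (by simp), hup _ Var.ε' _ (by simp)]
  have hv : ∀ (v w : Fin B.n → ℝ) (a : Var B.n → ℝ),
      vec .x₀ (assign .xₜ w (assign .x₀ v a)) = WithLp.toLp 2 v := fun v w a => by
    rw [vec_congr (b := assign .x₀ v a) fun i => assign_of_ne _ _ _ _ (by simp),
      vec_assign x₀_injective]
  simp only [hv, vec_assign xₜ_injective]
  have hne : ∀ (z : Var B.n) (v w : Fin B.n → ℝ) (a : Var B.n → ℝ), (∀ i, Var.x₀ i ≠ z) →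
      (∀ i, Var.xₜ i ≠ z) → assign .xₜ w (assign .x₀ v a) z = a z := fun z v w a h₁ h₂ => by
    rw [assign_of_ne _ _ _ _ h₂, assign_of_ne _ _ _ _ h₁]
  simp only [hne Var.δ' _ _ _ (by simp) (by simp), hne Var.t _ _ _ (by simp) (by simp)]
  simp only [Function.update_self, ne_eq, reduceCtorEq, not_false_eq_true, Function.update_of_ne,
    flowAt]
  have e₁ : ∀ x y : ℝ, -(x - y) - c ≥ 0 ↔ y ≥ x + c := fun x y => by
    constructor <;> intro h <;> linarith
  have e₂ : ∀ x : ℝ, - -x - c > 0 ↔ x > c := fun x => by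
    constructor <;> intro h <;> linarith
  have e₃ : ∀ x y : ℝ, x - y - c > 0 ↔ y < x - c := fun x y => by
    constructor <;> intro h <;> linarith
  simp only [e₁, e₂, e₃, sub_zero, abs_norm]

/-- This allows the description of the strengthened formula to be used for the exact one, with c =
0. -/
theorem holds_strengthen_zero {V : Type} [DecidableEq V] (φ : Formula V) (a : V → ℝ) :
    (φ.strengthen 0).Holds a ↔ φ.Holds a := by
  induction φ generalizing a <;> simp_all [strengthen, Holds]

/-- Sufficient conditions for stability: the thresholds enter the formula monotonically, so that
the smallest ones can be chosen. -/
theorem aStable_isTrue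
    (hL : ∀ t, 0 ≤ t → t ≤ B.b .T → ∀ v ∈ B.box, ‖WithLp.toLp 2 v‖ < B.b .δlo →
      (B.flowAt t v).ofLp ∈ B.box → ‖B.flowAt t v‖ < B.b .εlo)
    (hA : ∀ s, B.b .T' - B.b .δ''lo ≤ s → s ≤ B.b .T' + B.b .δ''lo → ∀ v ∈ B.box,
      ‖WithLp.toLp 2 v‖ < B.b .δ'lo → ‖B.flowAt s v‖ < B.b .ε'lo) : B.aStable.IsTrue := by
  rw [Formula.IsTrue, ← holds_strengthen_zero]
  refine ⟨(B.holds_strengthen_lStable 0 _).mpr fun ε hε => ⟨B.b .δlo, ⟨le_rfl, B.δ_le.trans hε.1⟩,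
    fun t ht v hv w hw => ?_⟩, (B.holds_strengthen_attractive 0 _).mpr
    ⟨B.b .δ'lo, ⟨le_rfl, B.δ'_le⟩, fun t ht v hv w hw => ?_⟩⟩
  · rw [add_zero, sub_zero]
    by_contra! h
    obtain ⟨⟨h₁, h₂⟩, h₃⟩ := h
    have e : WithLp.toLp 2 w = B.flowAt t v := sub_eq_zero.mp (norm_le_zero_iff.mp h₂)
    have := hL t ht.1 ht.2 v hv h₁ (by rw [← e]; exact hw)
    rw [← e] at this
    linarith [hε.1]
  · rw [add_zero]
    by_cases h₁ : ‖WithLp.toLp 2 v‖ < B.b .δ'lo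
    · refine Or.inr fun ε' hε' => ⟨B.b .δ''lo, ⟨le_rfl, B.δ''_le⟩, fun s hs => ?_⟩
      rw [sub_zero]
      exact (hA s hs.1 hs.2 v hv h₁).trans_le hε'.1
    · exact Or.inl (Or.inl (not_lt.mp h₁))

/-- The value ε = ε₁ refutes the formula: any admissible δ is at least δ₁, so the point `v`
satisfies the relaxed premise for all of them. -/
theorem not_strengthen_aStable_of_lStable {c t : ℝ} (ht₀ : 0 ≤ t) (ht : t ≤ B.b .T)
    {v w : Fin B.n → ℝ} (hv : v ∈ B.box) (hw : w ∈ B.box) (h₁ : ‖WithLp.toLp 2 v‖ < B.b .δlo + c)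
    (h₂ : ‖WithLp.toLp 2 w - B.flowAt t v‖ ≤ c) (h₃ : B.b .εlo - c ≤ ‖WithLp.toLp 2 w‖) :
    ¬ (B.aStable.strengthen c).IsTrue := by
  rintro ⟨h, -⟩
  obtain ⟨δ, hδ, h⟩ := (B.holds_strengthen_lStable c _).mp h _ ⟨le_rfl, B.ε_le⟩
  rcases h t ⟨ht₀, ht⟩ v hv w hw with (h | h) | h
  · linarith [hδ.1]
  · linarith
  · linarith

theorem not_strengthen_aStable_of_attractive {c s : ℝ} (hc : 0 ≤ c)
    (hs₁ : B.b .T' - B.b .δ''lo ≤ s) (hs₂ : s ≤ B.b .T' + B.b .δ''lo)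
    {v : Fin B.n → ℝ} (hv : v ∈ B.box) (h₁ : ‖WithLp.toLp 2 v‖ < B.b .δ'lo + c)
    (h₂ : B.b .ε'lo - c ≤ ‖B.flowAt s v‖) : ¬ (B.aStable.strengthen c).IsTrue := by
  rintro ⟨-, h⟩
  obtain ⟨δ', hδ', h⟩ := (B.holds_strengthen_attractive c _).mp h
  -- The variables t and x_t do not occur in the limit, so the flow equation is satisfied trivially
  -- by t = 0 and x_t = x₀.
  rcases h 0 ⟨le_rfl, B.T'_pos.le⟩ v hv v hv with (h | h) | h
  · linarith [hδ'.1]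
  · rw [flowAt_zero, sub_self, norm_zero] at h
    linarith
  · obtain ⟨δ'', hδ'', h⟩ := h _ ⟨le_rfl, B.ε'_le⟩
    linarith [h s ⟨by linarith [hδ''.1], by linarith [hδ''.1]⟩]

end BoundedSystem

end DeltaStab

end

noncomputable section

namespace DeltaStab

/-! ### Meaning of the numerical checks -/

/-- The integer represented by a pair of natural numbers, as a real number. -/
def diff (a : ℕ × ℕ) : ℝ := (a.1 : ℝ) - a.2

theorem leAdd_iff (a b : ℕ × ℕ) (s : ℕ) : leAdd a b s = true ↔ diff a ≤ diff b + s := by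
  rw [leAdd, Nat.ble_eq, ← Nat.cast_le (α := ℝ), diff, diff]
  push_cast
  constructor <;> intro h <;> linarith

theorem inRange_iff (a v b : ℕ × ℕ) (s : ℕ) :
    inRange a v b s = true ↔ diff a ≤ diff v + s ∧ diff v ≤ diff b + s := by
  rw [inRange, Bool.and_eq_true, leAdd_iff, leAdd_iff]

/-- The check compares squares without subtraction, by moving the mixed term to the other side.
Squaring is faithful only for a positive right-hand side. -/
theorem sqrtLt_iff (s : ℕ) (a : ℕ × ℕ) (h : ℕ) (hpos : 0 < diff a + h) :
    sqrtLt s a h = true ↔ √(s : ℝ) < diff a + h := by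
  rw [Real.sqrt_lt' hpos, sqrtLt, Bool.not_eq_true', ← Bool.not_eq_true, Nat.ble_eq, not_le,
    ← Nat.cast_lt (α := ℝ), diff]
  push_cast
  constructor <;> intro h <;> nlinarith

theorem sqrtGe_iff (s : ℕ) (a : ℕ × ℕ) (h : ℕ) :
    sqrtGe s a h = true ↔ diff a - h ≤ √(s : ℝ) := by
  rw [sqrtGe, Bool.or_eq_true, Nat.ble_eq, Nat.ble_eq, ← Nat.cast_le (α := ℝ),
    ← Nat.cast_le (α := ℝ), diff]
  push_cast
  by_cases hle : (a.1 : ℝ) - a.2 - h ≤ 0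
  · exact ⟨fun _ => hle.trans (Real.sqrt_nonneg _), fun _ => Or.inl (by linarith)⟩
  · rw [Real.le_sqrt' (by linarith)]
    constructor
    · rintro (h' | h')
      · linarith
      · nlinarith
    · intro h'
      right
      nlinarith

theorem diff_signed (b : Bool) (v : ℕ) : diff (signed b v) = if b then -(v : ℝ) else v := by
  cases b <;> simp [signed, diff]

theorem sq_signed (b : Bool) (v : ℕ) : ((sq (signed b v) : ℕ) : ℝ) = diff (signed b v) ^ 2 := by
  cases b <;> simp [signed, diff, sq] <;> ring

theorem sq_scaled (k s : List Bool) : ((sq (scaled k s) : ℕ) : ℝ) = diff (scaled k s) ^ 2 :=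
  sq_signed _ _

/-- The absolute value is rounded down and the sign is put back afterwards, so rounding costs less
than one unit. -/
theorem scaled_encodeDyadic (k : List Bool) (r : ℤ × ℕ) :
    |diff (scaled k (encodeDyadic r)) - 2 ^ k.length * dyadicVal r| < 1 := by
  have hv : scaled k (encodeDyadic r) =
      signed (decide (r.1 < 0)) (2 ^ k.length * r.1.natAbs / 2 ^ r.2) := by
    simp [scaled, encodeDyadic, shiftDown, pow2, ofDigits_reverse_bits, length_unary]
  rw [hv, diff_signed, dyadicVal]
  set v := 2 ^ k.length * r.1.natAbs / 2 ^ r.2 with hvdef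
  have hpow : (0 : ℝ) < 2 ^ r.2 := by positivity
  have h₁ : (v : ℝ) ≤ 2 ^ k.length * (r.1.natAbs : ℝ) / 2 ^ r.2 := by
    rw [le_div_iff₀ hpow]
    exact_mod_cast Nat.div_mul_le_self _ _
  have h₂ : 2 ^ k.length * (r.1.natAbs : ℝ) / 2 ^ r.2 < v + 1 := by
    rw [div_lt_iff₀ hpow]
    have := Nat.lt_mul_div_succ (2 ^ k.length * r.1.natAbs) (b := 2 ^ r.2) (by positivity)
    rw [mul_comm ((v : ℝ) + 1)]
    exact_mod_cast this
  by_cases hr : r.1 < 0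
  · have e : (r.1 : ℝ) = -(r.1.natAbs : ℝ) := by
      rw [Nat.cast_natAbs, abs_of_neg hr]; push_cast; ring
    rw [if_pos (by simpa using hr), e, abs_lt]
    have : (2 : ℝ) ^ k.length * (-(r.1.natAbs : ℝ) / 2 ^ r.2) =
      -(2 ^ k.length * (r.1.natAbs : ℝ) / 2 ^ r.2) := by ring
    rw [this]
    constructor <;> linarith
  · have e : (r.1 : ℝ) = (r.1.natAbs : ℝ) := by
      rw [Nat.cast_natAbs, abs_of_nonneg (by omega)]
    rw [if_neg (by simpa using hr), e, abs_lt, ← mul_div_assoc]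
    constructor <;> linarith

theorem sumBelow_unary (n : ℕ) (f : List Bool → ℕ) :
    sumBelow (unary n) f = ∑ i : Fin n, f (unary i) := by
  rw [sumBelow, length_unary, Finset.sum_range]

theorem allBelow_unary (n : ℕ) (f : List Bool → Bool) :
    allBelow (unary n) f = true ↔ ∀ i : Fin n, f (unary i) = true := by
  rw [allBelow, length_unary, List.all_eq_true]
  simp only [List.mem_range]
  exact ⟨fun h i => h i i.2, fun h i hi => h ⟨i, hi⟩⟩

theorem sqrt_sum_sq {n : ℕ} (v : Fin n → ℝ) : √(∑ i, v i ^ 2) = ‖WithLp.toLp 2 v‖ := by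
  rw [EuclideanSpace.norm_eq]
  simp

/-- The factor n instead of √n is generous but keeps all error bounds linear; the margin allows for
it. -/
theorem norm_toLp_le {n : ℕ} {v : Fin n → ℝ} {b : ℝ} (h : ∀ i, |v i| ≤ b) :
    ‖WithLp.toLp 2 v‖ ≤ n * b := by
  rcases Nat.eq_zero_or_pos n with rfl | hn
  · rw [← sqrt_sum_sq]; simp
  have hb : 0 ≤ b := (abs_nonneg _).trans (h ⟨0, hn⟩)
  rw [← sqrt_sum_sq, Real.sqrt_le_left (by positivity)]
  calc ∑ i, v i ^ 2 ≤ ∑ _i : Fin n, b ^ 2 := Finset.sum_le_sum fun i _ => by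
        rw [← sq_abs]; exact pow_le_pow_left₀ (abs_nonneg _) (h i) 2
    _ = n * b ^ 2 := by simp
    _ ≤ (n * b) ^ 2 := by
        have : (1 : ℝ) ≤ n := by exact_mod_cast hn
        rw [mul_pow]
        exact mul_le_mul_of_nonneg_right (by nlinarith) (sq_nonneg b)

/-- Vectors whose coordinates are close after scaling have close norms after scaling. -/
theorem abs_norm_sub_mul_norm_le {n : ℕ} {u v : Fin n → ℝ} {U b : ℝ} (hU : 0 ≤ U)
    (h : ∀ i, |u i - U * v i| ≤ b) : |‖WithLp.toLp 2 u‖ - U * ‖WithLp.toLp 2 v‖| ≤ n * b := by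
  have e : WithLp.toLp 2 (fun i => u i - U * v i) = WithLp.toLp 2 u - U • WithLp.toLp 2 v := by
    ext i; simp
  have := norm_toLp_le h
  rw [e] at this
  refine le_trans ?_ this
  have h' := abs_norm_sub_norm_le (WithLp.toLp 2 u) (U • WithLp.toLp 2 v)
  rwa [norm_smul, Real.norm_of_nonneg hU] at h'

/-- The point is the projection of e / U to [a, b]. It turns a check passed with tolerance into a
real number that satisfies the exact bounds. -/
theorem exists_clamp {e U a b r : ℝ} (hU : 0 < U) (hab : a ≤ b) (hr : 0 ≤ r) (h₁ : U * a ≤ e + r)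
    (h₂ : e ≤ U * b + r) : ∃ c, (a ≤ c ∧ c ≤ b) ∧ |e - U * c| ≤ r := by
  by_cases ha : e < U * a
  · exact ⟨a, ⟨le_rfl, hab⟩, abs_le.mpr ⟨by linarith, by linarith⟩⟩
  by_cases hb : U * b < e
  · exact ⟨b, ⟨hab, le_rfl⟩, abs_le.mpr ⟨by linarith, by linarith⟩⟩
  · push Not at ha hb
    refine ⟨e / U, ⟨?_, ?_⟩, ?_⟩
    · rw [le_div_iff₀ hU]; linarith
    · rw [div_le_iff₀ hU]; linarith
    · rw [mul_div_cancel₀ _ hU.ne', sub_self, abs_zero]; exact hr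

/-! ### Approximation of the terms by the oracle -/

theorem unary_add (a b : ℕ) : unary a ++ unary b = unary (a + b) := by
  rw [unary, unary, unary, List.replicate_add]

theorem length_extra (m : Polynomial ℕ) (x : List Bool) :
    (extra m x).length = m.eval (5 * x.length + 65) + 4 := by
  simp [extra, length_unary, Polynomial.eval_comp]

theorem length_coarse (x : List Bool) : (coarse x).length = 2 * x.length + 5 := by
  simp [coarse, length_unary]

theorem coarse_eq_unary (x : List Bool) : coarse x = unary (2 * x.length + 5) := by
  simp [coarse]

theorem length_fine (m : Polynomial ℕ) (x : List Bool) :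
    (fine m x).length = (coarse x).length + (extra m x).length := by
  simp [fine]

theorem fine_eq_unary (m : Polynomial ℕ) (x : List Bool) :
    fine m x = unary (fine m x).length := by
  rw [length_fine, ← unary_add]
  simp [fine, coarse, extra, length_unary]

/-- The margin of the checks, in units of `2 ^ (-|fine m x|)`. -/
theorem margin_eq (m : Polynomial ℕ) (x : List Bool) :
    margin m x = 2 ^ (extra m x).length * (16 * 2 ^ x.length) := by
  simp [margin, pow2, guard, length_unary, pow_add]
  ring

/-- The integer given by an entry of a certificate. -/
def entryInt (y l : List Bool) : ℤ :=
  if (entry y l).headD false then -(ofDigits (entry y l).tail.reverse : ℤ)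
  else (ofDigits (entry y l).tail.reverse : ℤ)

theorem diff_entryVal (y l : List Bool) : diff (entryVal y l) = entryInt y l := by
  rw [entryVal, diff_signed, entryInt]
  split_ifs <;> simp

/-- The oracle is specified only on canonical codes of dyadics. A certificate may contain a negative
zero or leading zeros; `entryCode` removes both. -/
theorem entryCode_eq (m : Polynomial ℕ) (x y l : List Bool) :
    entryCode m x y l = encodeDyadic (entryInt y l, (fine m x).length) := by
  rw [entryCode, encodeDyadic, ← fine_eq_unary, entryInt]
  generalize ofDigits (entry y l).tail.reverse = v
  cases (entry y l).headD false
  · have : ¬ (v : ℤ) < 0 := by omega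
    simp [this]
  · rcases Nat.eq_zero_or_pos v with rfl | hv
    · simp
    · have : v.bits.isEmpty = false := by rw [bits_eq v hv.ne']; rfl
      simp [hv, this]

theorem flatMap_encodeList {ι : Type} (l : List ι) (h : ι → List Bool) :
    l.flatMap (fun j => encodeList [h j]) = encodeList (l.map h) := by
  induction l with
  | nil => rfl
  | cons j l ih => rw [List.flatMap_cons, ih]; simp [lcons]

theorem arguments_eq (m : Polynomial ℕ) {x : List Bool} (y : List Bool) {n : ℕ}
    (hx : dimOf x = unary n) : arguments m x y = encodeList (List.ofFn fun l : Fin (n + 1) =>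
      encodeDyadic (entryInt y (unary l), (fine m x).length)) := by
  have : (true :: dimOf x).length = n + 1 := by rw [hx]; simp [length_unary]
  rw [arguments, concatBelow, this, flatMap_encodeList, List.ofFn_eq_map,
    ← List.map_coe_finRange_eq_range, List.map_map]
  simp only [entryCode_eq]
  rfl

end DeltaStab

end

/-! ### Error bounds for the values obtained from the oracle -/

noncomputable section

namespace DeltaStab

open BoundedSystem

/-- The oracle `g` with modulus `m` represents the terms of the system `B` with code `w`. -/
def Represents (g : Oracle) (m : Polynomial ℕ) (w : List Bool) (B : BoundedSystem) : Prop :=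
  ∀ (τ : TermName B.n) (i : ℕ), ∀ z ∈ (B.term τ).dom, ∀ d : Fin (B.term τ).arity → ℤ × ℕ,
    (∀ l, |dyadicVal (d l) - z l| ≤
      (2 : ℝ)⁻¹ ^ (m.eval ((encodeList [w, unary B.n, τ.code]).length + i))) →
    ∃ r : ℤ × ℕ,
      g.ask (encodeList [encodeList [w, unary B.n, τ.code],
        encodeList (List.ofFn fun l => encodeDyadic (d l)), unary i]) = encodeDyadic r ∧
      |dyadicVal r - (B.term τ).toFun z| < (2 : ℝ)⁻¹ ^ i

theorem Bound.ctorIdx_le (k : Bound) : k.ctorIdx ≤ 10 := by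
  cases k <;> decide

theorem length_code_le {n : ℕ} (τ : TermName n) : τ.code.length ≤ 2 * n + 28 := by
  rcases τ with i | i | i | k
  · have := i.2
    simp [TermName.code, length_unary]; omega
  · have := i.2
    simp [TermName.code, length_unary]; omega
  · have := i.2
    simp [TermName.code, length_unary]; omega
  · have := k.ctorIdx_le
    simp [TermName.code, length_unary]; omega

section Instance

variable {g : Oracle} {m : Polynomial ℕ} {w q x : List Bool} {B : BoundedSystem}

theorem dim_lt_of_eq (hx : x = encodeList [w, unary B.n, q]) : B.n + 1 ≤ 2 ^ x.length := by
  have : B.n < x.length := by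
    rw [hx]; simp [length_unary]; omega
  exact (this.trans Nat.lt_two_pow_self)

theorem answer_eq (hx : x = encodeList [w, unary B.n, q]) (c d i : List Bool) :
    answer g x c d i = g.ask (encodeList [encodeList [w, unary B.n, c], d, i]) := by
  subst hx
  simp [answer, dimOf]

theorem dimOf_eq (hx : x = encodeList [w, unary B.n, q]) : dimOf x = unary B.n := by
  subst hx
  simp [dimOf]

theorem length_termCode_le (hx : x = encodeList [w, unary B.n, q]) (τ : TermName B.n) :
    (encodeList [w, unary B.n, τ.code]).length ≤ 3 * x.length + 60 := by
  have := length_code_le τ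
  rw [hx]
  simp only [encodeList_cons, encodeList_nil, length_lcons, length_unary, List.length_nil]
  omega

theorem two_inv_pow_mul (k : ℕ) : (2 : ℝ) ^ k * 2⁻¹ ^ k = 1 := by
  rw [← mul_pow]; norm_num

/-- One unit of error comes from the oracle's precision and one from rounding. -/
theorem constVal_close (hrep : Represents g m w B) (hx : x = encodeList [w, unary B.n, q])
    (τ : TermName B.n) (c : ℝ) (hτ : B.term τ = ⟨0, Set.univ, fun _ => c⟩) :
    |diff (constVal g m x τ.code) - 2 ^ (fine m x).length * c| < 2 := by
  have h := hrep τ (fine m x).length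
  rw [hτ] at h
  obtain ⟨r, hr, hc⟩ := h (fun l => l.elim0) trivial (fun l => l.elim0) (fun l => l.elim0)
  rw [← fine_eq_unary] at hr
  have hans : answer g x τ.code [] (fine m x) = encodeDyadic r := by
    rw [answer_eq hx, ← hr]; simp
  have h₁ := scaled_encodeDyadic (fine m x) r
  rw [← hans] at h₁
  change |diff (constVal g m x τ.code) - _| < 1 at h₁
  set U : ℝ := 2 ^ (fine m x).length with hU
  have h₂ : |U * dyadicVal r - U * c| < 1 := by
    rw [← mul_sub, abs_mul, abs_of_pos (by positivity), ← two_inv_pow_mul (fine m x).length]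
    exact mul_lt_mul_of_pos_left hc (by positivity)
  have := abs_sub_le (diff (constVal g m x τ.code)) (U * dyadicVal r) (U * c)
  linarith

/-- The oracle's error 2^(-|coarse x|) amounts to 2^|extra m x| fine units, and rounding adds one.
Entry 0 of the certificate is the time and entry i + 1 is coordinate i; an inaccuracy of 16 units in
them is permitted by the modulus. -/
theorem flowVal_close (hrep : Represents g m w B) (hx : x = encodeList [w, unary B.n, q])
    (y : List Bool) {t : ℝ} {v : Fin B.n → ℝ} (ht : t ∈ B.times) (hv : v ∈ B.box)
    (ht' : |diff (entryVal y []) - 2 ^ (fine m x).length * t| ≤ 16)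
    (hv' : ∀ i : Fin B.n,
      |diff (entryVal y (true :: unary i)) - 2 ^ (fine m x).length * v i| ≤ 16) (i : Fin B.n) :
    |diff (flowVal g m x y (unary i)) - 2 ^ (fine m x).length * B.flowAt t v i| ≤
      2 ^ (extra m x).length + 1 := by
  set U : ℝ := 2 ^ (fine m x).length with hU
  have hUpos : 0 < U := by positivity
  have h := hrep (.flow i) (coarse x).length (Fin.cons t v) ⟨ht, fun j => hv j⟩
    (fun l => (entryInt y (unary l), (fine m x).length)) (by
      intro l
      have hl : |diff (entryVal y (unary l)) -
          U * (Fin.cons t v : Fin (B.n + 1) → ℝ) l| ≤ 16 := by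
        refine Fin.cases ?_ (fun j => ?_) l
        · exact ht'
        · exact hv' j
      rw [diff_entryVal] at hl
      have e : dyadicVal (entryInt y (unary l), (fine m x).length) -
          (Fin.cons t v : Fin (B.n + 1) → ℝ) l = (entryInt y (unary l) -
            U * (Fin.cons t v : Fin (B.n + 1) → ℝ) l) / U := by
        rw [dyadicVal, sub_div, mul_div_cancel_left₀ _ hUpos.ne']
      -- This explains the polynomial in `extra`: 3|x| + 60 bounds the name of the term and 2|x| + 5
      -- is the output precision. The additional 4 bits pay for the 16 units.
      have hM : m.eval ((encodeList [w, unary B.n,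
          (TermName.flow i).code]).length + (coarse x).length) + 4 ≤ (fine m x).length := by
        have h₁ := length_termCode_le hx (.flow i)
        rw [length_fine, length_extra, length_coarse]
        have := eval_mono_nat m (show (encodeList [w, unary B.n,
          (TermName.flow i).code]).length + (2 * x.length + 5) ≤ 5 * x.length + 65 by omega)
        omega
      set M := m.eval ((encodeList [w, unary B.n,
          (TermName.flow i).code]).length + (coarse x).length)
      change |dyadicVal (entryInt y (unary l), (fine m x).length) -
        (Fin.cons t v : Fin (B.n + 1) → ℝ) l| ≤ _
      rw [e, abs_div, abs_of_pos hUpos, div_le_iff₀ hUpos]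
      refine hl.trans ?_
      have h₂ : (2 : ℝ) ^ (M + 4) ≤ U := pow_le_pow_right₀ (by norm_num) hM
      calc (16 : ℝ) = 2⁻¹ ^ M * 2 ^ (M + 4) := by
            rw [pow_add, ← mul_assoc, mul_comm (2⁻¹ ^ M), two_inv_pow_mul]; norm_num
        _ ≤ 2⁻¹ ^ M * U := by gcongr)
  obtain ⟨r, hr, hc⟩ := h
  have hans : answer g x (encodeList [unary 0, unary i]) (arguments m x y) (coarse x) =
      encodeDyadic r := by
    rw [answer_eq hx, arguments_eq m y (dimOf_eq hx), ← hr]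
    congr 2
    rw [length_coarse, ← coarse_eq_unary]
    rfl
  have h₁ := scaled_encodeDyadic (fine m x) r
  rw [← hans] at h₁
  change |diff (flowVal g m x y (unary i)) - U * _| < 1 at h₁
  change |dyadicVal r - B.flowAt t v i| < _ at hc
  have h₂ : |U * dyadicVal r - U * B.flowAt t v i| ≤ 2 ^ (extra m x).length := by
    rw [← mul_sub, abs_mul, abs_of_pos hUpos]
    have e : (2 : ℝ) ^ (extra m x).length = U * 2⁻¹ ^ (coarse x).length := by
      rw [hU, length_fine, pow_add, mul_right_comm, two_inv_pow_mul, one_mul]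
    rw [e]
    exact mul_le_mul_of_nonneg_left hc.le hUpos.le
  have := abs_sub_le (diff (flowVal g m x y (unary i))) (U * dyadicVal r) (U * B.flowAt t v i)
  linarith

theorem sqrt_startSq (hx : x = encodeList [w, unary B.n, q]) (y : List Bool) :
    √(startSq x y : ℝ) =
      ‖WithLp.toLp 2 fun i : Fin B.n => diff (entryVal y (true :: unary i))‖ := by
  rw [startSq, dimOf_eq hx, sumBelow_unary, ← sqrt_sum_sq]
  push_cast
  simp only [entryVal, sq_signed]

theorem sqrt_flowSq (hx : x = encodeList [w, unary B.n, q]) (y : List Bool) :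
    √(flowSq g m x y : ℝ) =
      ‖WithLp.toLp 2 fun i : Fin B.n => diff (flowVal g m x y (unary i))‖ := by
  rw [flowSq, dimOf_eq hx, sumBelow_unary, ← sqrt_sum_sq]
  push_cast
  simp only [flowVal, sq_scaled]

theorem startInBox_iff (hx : x = encodeList [w, unary B.n, q]) (y : List Bool) :
    startInBox g m x y = true ↔ ∀ i : Fin B.n,
      diff (loVal g m x (unary i)) ≤ diff (entryVal y (true :: unary i)) + 8 ∧
      diff (entryVal y (true :: unary i)) ≤ diff (hiVal g m x (unary i)) + 8 := by
  rw [startInBox, dimOf_eq hx, allBelow_unary]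
  simp only [inRange_iff]
  norm_num

theorem flowInBox_iff (hx : x = encodeList [w, unary B.n, q]) (y : List Bool) :
    flowInBox g m x y = true ↔ ∀ i : Fin B.n,
      diff (loVal g m x (unary i)) ≤
        diff (flowVal g m x y (unary i)) + 2 * 2 ^ (extra m x).length ∧
      diff (flowVal g m x y (unary i)) ≤
        diff (hiVal g m x (unary i)) + 2 * 2 ^ (extra m x).length := by
  rw [flowInBox, dimOf_eq hx, allBelow_unary]
  simp only [inRange_iff, pow2, List.length_cons, pow_succ, mul_comm _ 2]
  norm_num

theorem loVal_close (hrep : Represents g m w B) (hx : x = encodeList [w, unary B.n, q])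
    (i : Fin B.n) : |diff (loVal g m x (unary i)) - 2 ^ (fine m x).length * B.lo i| < 2 :=
  constVal_close hrep hx (.lo i) (B.lo i) rfl

theorem hiVal_close (hrep : Represents g m w B) (hx : x = encodeList [w, unary B.n, q])
    (i : Fin B.n) : |diff (hiVal g m x (unary i)) - 2 ^ (fine m x).length * B.hi i| < 2 :=
  constVal_close hrep hx (.hi i) (B.hi i) rfl

theorem boundVal_close (hrep : Represents g m w B) (hx : x = encodeList [w, unary B.n, q])
    (k : Bound) : |diff (boundVal g m k x) - 2 ^ (fine m x).length * B.b k| < 2 :=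
  constVal_close hrep hx (.bound k) (B.b k) rfl

end Instance

end DeltaStab

end

/-! ### Soundness and completeness of the numerical checks -/

noncomputable section

namespace DeltaStab

open BoundedSystem

section Instance

variable {g : Oracle} {m : Polynomial ℕ} {w q x y : List Bool} {B : BoundedSystem}

/-- With W = 2^|extra m x|, the margin is half of the perturbation 2^(-|x|) in fine units. It
exceeds 16 (n + 1) W, hence every error that occurs below. One half is used as tolerance of the
checks, the other half absorbs the errors when a passed check is converted back. -/
theorem margin_bounds (hx : x = encodeList [w, unary B.n, q]) :
    (16 : ℝ) ≤ 2 ^ (extra m x).length ∧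
    (16 : ℝ) * B.n ≤ B.n * 2 ^ (extra m x).length ∧
    (16 : ℝ) * (B.n * 2 ^ (extra m x).length) + 16 * 2 ^ (extra m x).length ≤ margin m x ∧
    (2 : ℝ) ^ (fine m x).length * 2⁻¹ ^ x.length = 2 * margin m x := by
  have hW : (16 : ℝ) ≤ 2 ^ (extra m x).length := by
    calc (16 : ℝ) = 2 ^ 4 := by norm_num
      _ ≤ 2 ^ (extra m x).length :=
        pow_le_pow_right₀ (by norm_num) (by rw [length_extra]; omega)
  have hn : (B.n : ℝ) + 1 ≤ 2 ^ x.length := by exact_mod_cast dim_lt_of_eq hx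
  have hn₀ : (0 : ℝ) ≤ B.n := Nat.cast_nonneg _
  rw [margin_eq]
  push_cast
  refine ⟨hW, by nlinarith, by nlinarith, ?_⟩
  rw [length_fine, length_coarse, pow_add, show 2 * x.length + 5 = x.length + (x.length + 5) by ring,
    pow_add, pow_add]
  have := two_inv_pow_mul x.length
  linear_combination (2 ^ x.length * 2 ^ 5 * 2 ^ (extra m x).length : ℝ) * this

theorem exists_start (hrep : Represents g m w B) (hx : x = encodeList [w, unary B.n, q])
    (h : startInBox g m x y = true) : ∃ v ∈ B.box, ∀ i : Fin B.n,
      |diff (entryVal y (true :: unary i)) - 2 ^ (fine m x).length * v i| ≤ 10 := by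
  rw [startInBox_iff hx] at h
  have key : ∀ i, ∃ c, (B.lo i ≤ c ∧ c ≤ B.hi i) ∧
      |diff (entryVal y (true :: unary i)) - 2 ^ (fine m x).length * c| ≤ 10 := fun i => by
    have h₁ := abs_lt.mp (loVal_close hrep hx i)
    have h₂ := abs_lt.mp (hiVal_close hrep hx i)
    exact exists_clamp (by positivity) (B.lo_le_hi i) (by norm_num) (by linarith [h i])
      (by linarith [h i])
  choose v hv hv' using key
  exact ⟨v, hv, hv'⟩

theorem norm_start_lt (hrep : Represents g m w B) (hx : x = encodeList [w, unary B.n, q])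
    {v : Fin B.n → ℝ} (hv : ∀ i : Fin B.n,
      |diff (entryVal y (true :: unary i)) - 2 ^ (fine m x).length * v i| ≤ 10)
    (k : Bound) (hk : 0 ≤ B.b k)
    (h : sqrtLt (startSq x y) (boundVal g m k x) (margin m x) = true) :
    ‖WithLp.toLp 2 v‖ < B.b k + 2⁻¹ ^ x.length := by
  obtain ⟨hW, hnW, hH, hη⟩ := margin_bounds (m := m) hx
  have hb := abs_lt.mp (boundVal_close hrep hx k)
  have hU : (0 : ℝ) < 2 ^ (fine m x).length := by positivity
  have hn₀ : (0 : ℝ) ≤ B.n := Nat.cast_nonneg _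
  have hUk : 0 ≤ 2 ^ (fine m x).length * B.b k := by positivity
  rw [sqrtLt_iff _ _ _ (by linarith), sqrt_startSq hx] at h
  have := abs_le.mp (abs_norm_sub_mul_norm_le hU.le hv)
  refine lt_of_mul_lt_mul_left ?_ hU.le
  rw [mul_add, hη]
  linarith

theorem sqrtLt_start (hrep : Represents g m w B) (hx : x = encodeList [w, unary B.n, q])
    {v : Fin B.n → ℝ} (hv : ∀ i : Fin B.n,
      |diff (entryVal y (true :: unary i)) - 2 ^ (fine m x).length * v i| ≤ 1)
    (k : Bound) (hk : 0 ≤ B.b k) (h : ‖WithLp.toLp 2 v‖ < B.b k) :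
    sqrtLt (startSq x y) (boundVal g m k x) (margin m x) = true := by
  obtain ⟨hW, hnW, hH, hη⟩ := margin_bounds (m := m) hx
  have hb := abs_lt.mp (boundVal_close hrep hx k)
  have hU : (0 : ℝ) < 2 ^ (fine m x).length := by positivity
  have hn₀ : (0 : ℝ) ≤ B.n := Nat.cast_nonneg _
  have hUk : 0 ≤ 2 ^ (fine m x).length * B.b k := by positivity
  rw [sqrtLt_iff _ _ _ (by linarith), sqrt_startSq hx]
  have := abs_le.mp (abs_norm_sub_mul_norm_le hU.le hv)
  have := mul_lt_mul_of_pos_left h hU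
  linarith

theorem startInBox_of_close (hrep : Represents g m w B) (hx : x = encodeList [w, unary B.n, q])
    {v : Fin B.n → ℝ} (hbox : v ∈ B.box) (hv : ∀ i : Fin B.n,
      |diff (entryVal y (true :: unary i)) - 2 ^ (fine m x).length * v i| ≤ 1) :
    startInBox g m x y = true := by
  rw [startInBox_iff hx]
  intro i
  have h₁ := abs_lt.mp (loVal_close hrep hx i)
  have h₂ := abs_lt.mp (hiVal_close hrep hx i)
  have h₃ := abs_le.mp (hv i)
  have hU : (0 : ℝ) < 2 ^ (fine m x).length := by positivity
  have h₄ := mul_le_mul_of_nonneg_left (hbox i).1 hU.le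
  have h₅ := mul_le_mul_of_nonneg_left (hbox i).2 hU.le
  constructor <;> linarith

theorem sqrtGe_flow (hrep : Represents g m w B) (hx : x = encodeList [w, unary B.n, q])
    {z : EuclideanSpace ℝ (Fin B.n)} (hz : ∀ i : Fin B.n,
      |diff (flowVal g m x y (unary i)) - 2 ^ (fine m x).length * z i| ≤
        2 ^ (extra m x).length + 1)
    (k : Bound) (h : B.b k ≤ ‖z‖) :
    sqrtGe (flowSq g m x y) (boundVal g m k x) (margin m x) = true := by
  obtain ⟨hW, hnW, hH, hη⟩ := margin_bounds (m := m) hx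
  have hb := abs_lt.mp (boundVal_close hrep hx k)
  have hU : (0 : ℝ) < 2 ^ (fine m x).length := by positivity
  have hn₀ : (0 : ℝ) ≤ B.n := Nat.cast_nonneg _
  rw [sqrtGe_iff, sqrt_flowSq hx]
  have h₁ := abs_le.mp (abs_norm_sub_mul_norm_le hU.le hz)
  rw [WithLp.toLp_ofLp] at h₁
  have := mul_le_mul_of_nonneg_left h hU.le
  linarith

theorem le_norm_of_sqrtGe (hrep : Represents g m w B) (hx : x = encodeList [w, unary B.n, q])
    {v : Fin B.n → ℝ} (hv : ∀ i : Fin B.n,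
      |diff (flowVal g m x y (unary i)) - 2 ^ (fine m x).length * v i| ≤
        2 * 2 ^ (extra m x).length + 2)
    (k : Bound) (h : sqrtGe (flowSq g m x y) (boundVal g m k x) (margin m x) = true) :
    B.b k - 2⁻¹ ^ x.length ≤ ‖WithLp.toLp 2 v‖ := by
  obtain ⟨hW, hnW, hH, hη⟩ := margin_bounds (m := m) hx
  have hb := abs_lt.mp (boundVal_close hrep hx k)
  have hU : (0 : ℝ) < 2 ^ (fine m x).length := by positivity
  have hn₀ : (0 : ℝ) ≤ B.n := Nat.cast_nonneg _
  rw [sqrtGe_iff, sqrt_flowSq hx] at h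
  have h₁ := abs_le.mp (abs_norm_sub_mul_norm_le hU.le hv)
  refine le_of_mul_le_mul_left ?_ hU
  rw [mul_sub, hη]
  linarith

theorem not_strengthen_of_refutesStable (hrep : Represents g m w B)
    (hx : x = encodeList [w, unary B.n, q]) (h : refutesStable g m x y = true) :
    ¬ (B.aStable.strengthen (2⁻¹ ^ x.length)).IsTrue := by
  simp only [refutesStable, Bool.and_eq_true] at h
  obtain ⟨⟨⟨⟨ht, hstart⟩, hlt⟩, hflow⟩, hge⟩ := h
  obtain ⟨hW, hnW, hH, hη⟩ := margin_bounds (m := m) hx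
  have hU : (0 : ℝ) < 2 ^ (fine m x).length := by positivity
  have hn₀ : (0 : ℝ) ≤ B.n := Nat.cast_nonneg _
  obtain ⟨v, hv, hv'⟩ := exists_start hrep hx hstart
  rw [inRange_iff] at ht
  have hT := abs_lt.mp (boundVal_close hrep hx .T)
  -- The radius 10 is the tolerance 8 of the check plus the error 2 of the constant; it stays below
  -- the 16 allowed for arguments of the flow.
  obtain ⟨t, ⟨ht₀, htT⟩, ht'⟩ := exists_clamp (e := diff (entryVal y [])) (r := 10) hU B.T_pos.le
    (by norm_num)
    (by have := ht.1; simp [diff] at this ⊢; linarith)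
    (by have := ht.2; push_cast at this; linarith)
  have hF := flowVal_close hrep hx y (Or.inl (Or.inl ⟨ht₀, htT⟩)) hv (by linarith)
    (fun i => (hv' i).trans (by norm_num))
  rw [flowInBox_iff hx] at hflow
  have key : ∀ i, ∃ c, (B.lo i ≤ c ∧ c ≤ B.hi i) ∧
      |diff (flowVal g m x y (unary i)) - 2 ^ (fine m x).length * c| ≤
        2 * 2 ^ (extra m x).length + 2 := fun i => by
    have h₁ := abs_lt.mp (loVal_close hrep hx i)
    have h₂ := abs_lt.mp (hiVal_close hrep hx i)
    exact exists_clamp hU (B.lo_le_hi i) (by linarith) (by linarith [hflow i])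
      (by linarith [hflow i])
  choose c hc hc' using key
  -- The value of the flow need not lie in the box. Its clamped approximation `c` does, and serves
  -- as x_t, because the strengthened formula tolerates a distance to the flow.
  refine B.not_strengthen_aStable_of_lStable ht₀ htT hv (w := c) hc
    (norm_start_lt hrep hx hv' .δlo B.δ_nonneg hlt) ?_ (le_norm_of_sqrtGe hrep hx hc' .εlo hge)
  have e : WithLp.toLp 2 c - B.flowAt t v = WithLp.toLp 2 fun i => c i - B.flowAt t v i := by
    ext i; simp
  rw [e]
  refine le_of_mul_le_mul_left ?_ hU
  rw [hη]
  -- The clamped value is within 2W + 2 of the computed one and this within W + 1 of the flow; the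
  -- sum is at most 4W since W ≥ 16. Comparison with the zero vector converts this into a bound on
  -- the norm.
  have h₁ := abs_norm_sub_mul_norm_le (u := fun _ : Fin B.n => (0 : ℝ)) hU.le
    (v := fun i => c i - B.flowAt t v i) (b := 4 * 2 ^ (extra m x).length) (fun i => by
      have h₁ := abs_le.mp (hc' i)
      have h₂ := abs_le.mp (hF i)
      rw [abs_le, mul_sub]
      constructor <;> linarith)
  have h₂ := (abs_le.mp h₁).1
  have h₃ : ‖WithLp.toLp 2 fun _ : Fin B.n => (0 : ℝ)‖ = 0 := by
    rw [← sqrt_sum_sq]; simp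
  rw [h₃] at h₂
  linarith

theorem not_strengthen_of_refutesAttractive (hrep : Represents g m w B)
    (hx : x = encodeList [w, unary B.n, q]) (h : refutesAttractive g m x y = true) :
    ¬ (B.aStable.strengthen (2⁻¹ ^ x.length)).IsTrue := by
  simp only [refutesAttractive, Bool.and_eq_true] at h
  obtain ⟨⟨⟨ht, hstart⟩, hlt⟩, hge⟩ := h
  obtain ⟨hW, hnW, hH, hη⟩ := margin_bounds (m := m) hx
  have hU : (0 : ℝ) < 2 ^ (fine m x).length := by positivity
  obtain ⟨v, hv, hv'⟩ := exists_start hrep hx hstart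
  rw [inRange_iff] at ht
  have hT := abs_lt.mp (boundVal_close hrep hx .T')
  have hδ := abs_lt.mp (boundVal_close hrep hx .δ''lo)
  simp only [diff, Nat.cast_add] at ht hT hδ
  -- Each endpoint combines two constants with error 2, in addition to the tolerance 8.
  obtain ⟨s, ⟨hs₁, hs₂⟩, hs'⟩ := exists_clamp (e := diff (entryVal y [])) (r := 12)
    (a := B.b .T' - B.b .δ''lo) (b := B.b .T' + B.b .δ''lo) hU (by linarith [B.δ''_nonneg])
    (by norm_num)
    (by have := ht.1; rw [mul_sub, diff]; push_cast at this; linarith)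
    (by have := ht.2; rw [mul_add, diff]; push_cast at this; linarith)
  -- The time lies in the third interval of `times`, as δ₁'' is at most its upper bound.
  have hF := flowVal_close hrep hx y (t := s)
    (Or.inr ⟨by linarith [B.δ''_le], by linarith [B.δ''_le]⟩) hv (by linarith)
    (fun i => (hv' i).trans (by norm_num))
  exact B.not_strengthen_aStable_of_attractive (by positivity) hs₁ hs₂ hv
    (norm_start_lt hrep hx hv' .δ'lo B.δ'_nonneg hlt)
    (le_norm_of_sqrtGe hrep hx (v := (B.flowAt s v).ofLp)
      (fun i => (hF i).trans (by linarith)) .ε'lo hge)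

theorem refutesStable_of_close (hrep : Represents g m w B) (hx : x = encodeList [w, unary B.n, q])
    {t : ℝ} (ht₀ : 0 ≤ t) (htT : t ≤ B.b .T) {v : Fin B.n → ℝ} (hv : v ∈ B.box)
    (h₁ : ‖WithLp.toLp 2 v‖ < B.b .δlo) (h₂ : (B.flowAt t v).ofLp ∈ B.box)
    (h₃ : B.b .εlo ≤ ‖B.flowAt t v‖)
    (ht' : |diff (entryVal y []) - 2 ^ (fine m x).length * t| ≤ 1)
    (hv' : ∀ i : Fin B.n,
      |diff (entryVal y (true :: unary i)) - 2 ^ (fine m x).length * v i| ≤ 1) :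
    refutesStable g m x y = true := by
  obtain ⟨hW, hnW, hH, hη⟩ := margin_bounds (m := m) hx
  have hU : (0 : ℝ) < 2 ^ (fine m x).length := by positivity
  have hF := flowVal_close hrep hx y (Or.inl (Or.inl ⟨ht₀, htT⟩)) hv (by linarith)
    (fun i => (hv' i).trans (by norm_num))
  simp only [refutesStable, Bool.and_eq_true]
  refine ⟨⟨⟨⟨?_, startInBox_of_close hrep hx hv hv'⟩,
    sqrtLt_start hrep hx hv' .δlo B.δ_nonneg h₁⟩, ?_⟩, sqrtGe_flow hrep hx hF .εlo h₃⟩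
  · rw [inRange_iff]
    have hT := abs_lt.mp (boundVal_close hrep hx .T)
    have h := abs_le.mp ht'
    have e₁ : 0 ≤ 2 ^ (fine m x).length * t := by positivity
    have e₂ := mul_le_mul_of_nonneg_left htT hU.le
    have e₃ : diff (0, 0) = 0 := by simp [diff]
    rw [e₃]
    push_cast
    constructor <;> linarith
  · rw [flowInBox_iff hx]
    intro i
    have e₁ := abs_lt.mp (loVal_close hrep hx i)
    have e₂ := abs_lt.mp (hiVal_close hrep hx i)
    have e₃ := abs_le.mp (hF i)
    have e₄ := mul_le_mul_of_nonneg_left (h₂ i).1 hU.le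
    have e₅ := mul_le_mul_of_nonneg_left (h₂ i).2 hU.le
    constructor <;> linarith

theorem refutesAttractive_of_close (hrep : Represents g m w B)
    (hx : x = encodeList [w, unary B.n, q])
    {s : ℝ} (hs₁ : B.b .T' - B.b .δ''lo ≤ s) (hs₂ : s ≤ B.b .T' + B.b .δ''lo) {v : Fin B.n → ℝ}
    (hv : v ∈ B.box) (h₁ : ‖WithLp.toLp 2 v‖ < B.b .δ'lo) (h₂ : B.b .ε'lo ≤ ‖B.flowAt s v‖)
    (hs' : |diff (entryVal y []) - 2 ^ (fine m x).length * s| ≤ 1)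
    (hv' : ∀ i : Fin B.n,
      |diff (entryVal y (true :: unary i)) - 2 ^ (fine m x).length * v i| ≤ 1) :
    refutesAttractive g m x y = true := by
  have hU : (0 : ℝ) < 2 ^ (fine m x).length := by positivity
  have hF := flowVal_close hrep hx y (t := s)
    (Or.inr ⟨by linarith [B.δ''_le], by linarith [B.δ''_le]⟩) hv (by linarith)
    (fun i => (hv' i).trans (by norm_num))
  simp only [refutesAttractive, Bool.and_eq_true]
  refine ⟨⟨⟨?_, startInBox_of_close hrep hx hv hv'⟩,
    sqrtLt_start hrep hx hv' .δ'lo B.δ'_nonneg h₁⟩, sqrtGe_flow hrep hx hF .ε'lo h₂⟩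
  rw [inRange_iff]
  have hT := abs_lt.mp (boundVal_close hrep hx .T')
  have hδ := abs_lt.mp (boundVal_close hrep hx .δ''lo)
  have h := abs_le.mp hs'
  have e₁ := mul_le_mul_of_nonneg_left hs₁ hU.le
  have e₂ := mul_le_mul_of_nonneg_left hs₂ hU.le
  rw [mul_sub] at e₁
  rw [mul_add] at e₂
  simp only [diff] at hT hδ h ⊢
  push_cast
  constructor <;> linarith

/-! ### Certificates -/

/-- The certificate with a given tag and given integers as entries. -/
def certificate (b : Bool) {n : ℕ} (z : Fin n → ℤ) : List Bool :=
  lcons [b] (encodeList (List.ofFn fun l => decide (z l < 0) :: (z l).natAbs.bits))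

theorem nthString_encodeList (l : List (List Bool)) (j : ℕ) (hj : j < l.length) :
    nthString (unary j) (encodeList l) = l[j] := by
  rw [nthString, length_unary]
  induction j generalizing l with
  | zero =>
    rcases l with _ | ⟨s, l⟩
    · simp at hj
    · simp
  | succ j ih =>
    rcases l with _ | ⟨s, l⟩
    · simp at hj
    · rw [Function.iterate_succ_apply, encodeList_cons, ltail_lcons]
      simpa using ih l (by simpa using hj)

theorem diff_entryVal_certificate (b : Bool) {n : ℕ} (z : Fin n → ℤ) (l : Fin n) :
    diff (entryVal (certificate b z) (unary l)) = z l := by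
  have e : entry (certificate b z) (unary l) = decide (z l < 0) :: (z l).natAbs.bits := by
    rw [entry, certificate, ltail_lcons, nthString_encodeList _ _ (by simp)]
    simp
  rw [diff_entryVal, entryInt, e]
  simp only [List.headD_cons, List.tail_cons, ofDigits_reverse_bits, decide_eq_true_eq]
  have h : (if z l < 0 then -((z l).natAbs : ℤ) else ((z l).natAbs : ℤ)) = z l := by
    split_ifs <;> omega
  exact_mod_cast h

/-- An entry has a sign bit and at most k digits; coding as a list element doubles these k + 1 bits
and adds one. The one-bit tag takes 3. -/
theorem length_certificate_le (b : Bool) {n : ℕ} (z : Fin n → ℤ) (k : ℕ)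
    (h : ∀ l, (z l).natAbs < 2 ^ k) : (certificate b z).length ≤ 3 + n * (2 * k + 3) := by
  have key : ∀ L : List (List Bool), (∀ s ∈ L, s.length ≤ k + 1) →
      (encodeList L).length ≤ L.length * (2 * k + 3) := by
    intro L
    induction L with
    | nil => simp
    | cons s L ih =>
      intro hL
      have h₁ := ih fun s hs => hL s (List.mem_cons_of_mem _ hs)
      have h₂ := hL s List.mem_cons_self
      simp only [encodeList_cons, length_lcons, List.length_cons, add_mul, one_mul]
      omega
  have := key (List.ofFn fun l => decide (z l < 0) :: (z l).natAbs.bits) (by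
    intro s hs
    obtain ⟨l, rfl⟩ := List.mem_ofFn.mp hs
    rw [List.length_cons, Nat.size_eq_bits_len]
    have := Nat.size_le.mpr (h l)
    omega)
  rw [List.length_ofFn] at this
  rw [certificate, length_lcons]
  simp only [List.length_singleton]
  omega

/-- Real numbers between constants of the representation have short integer approximations. -/
theorem natAbs_floor_lt {A : ℕ} {U a b c : ℝ} {p r : ℕ × ℕ} (hU : 0 < U) (hA : 4 ≤ A)
    (hp : |diff p - U * a| ≤ 4) (hr : |diff r - U * b| ≤ 4) (h₁ : a ≤ c) (h₂ : c ≤ b)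
    (hp₁ : p.1 < 2 ^ A) (hp₂ : p.2 < 2 ^ A) (hr₁ : r.1 < 2 ^ A) (hr₂ : r.2 < 2 ^ A) :
    ⌊U * c⌋.natAbs < 2 ^ (A + 1) := by
  have e₁ := mul_le_mul_of_nonneg_left h₁ hU.le
  have e₂ := mul_le_mul_of_nonneg_left h₂ hU.le
  have hp := abs_le.mp hp
  have hr := abs_le.mp hr
  have hA' : (16 : ℝ) ≤ 2 ^ A := by
    calc (16 : ℝ) = 2 ^ 4 := by norm_num
      _ ≤ 2 ^ A := pow_le_pow_right₀ (by norm_num) hA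
  have hp₁' : (p.1 : ℝ) < 2 ^ A := by exact_mod_cast hp₁
  have hp₂' : (p.2 : ℝ) < 2 ^ A := by exact_mod_cast hp₂
  have hr₁' : (r.1 : ℝ) < 2 ^ A := by exact_mod_cast hr₁
  have hr₂' : (r.2 : ℝ) < 2 ^ A := by exact_mod_cast hr₂
  have : (0 : ℝ) ≤ p.1 := Nat.cast_nonneg _
  have : (0 : ℝ) ≤ p.2 := Nat.cast_nonneg _
  have : (0 : ℝ) ≤ r.1 := Nat.cast_nonneg _
  have : (0 : ℝ) ≤ r.2 := Nat.cast_nonneg _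
  simp only [diff] at hp hr
  have f₁ := Int.floor_le (U * c)
  have f₂ := Int.lt_floor_add_one (U * c)
  have hlt : |(⌊U * c⌋ : ℝ)| < 2 ^ (A + 1) := by
    rw [abs_lt, pow_succ]
    constructor <;> linarith
  have : ((⌊U * c⌋.natAbs : ℕ) : ℝ) < ((2 ^ (A + 1) : ℕ) : ℝ) := by
    rw [Nat.cast_natAbs]
    push_cast
    exact hlt
  exact_mod_cast this

/-- A failing initial condition at a failing time between constants of the representation has a
short certificate that approximates it. -/
theorem exists_certificate (hrep : Represents g m w B) (hx : x = encodeList [w, unary B.n, q])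
    {A : ℕ} (hA : 4 ≤ A)
    (hsize : ∀ τ : TermName B.n, (constVal g m x τ.code).1 < 2 ^ A ∧
      (constVal g m x τ.code).2 < 2 ^ A)
    (b : Bool) {t c d : ℝ} (h₁ : c ≤ t) (h₂ : t ≤ d) {p r : ℕ × ℕ}
    (hp : |diff p - 2 ^ (fine m x).length * c| ≤ 4) (hr : |diff r - 2 ^ (fine m x).length * d| ≤ 4)
    (hp₁ : p.1 < 2 ^ (A + 1)) (hp₂ : p.2 < 2 ^ (A + 1)) (hr₁ : r.1 < 2 ^ (A + 1))
    (hr₂ : r.2 < 2 ^ (A + 1))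
    {v : Fin B.n → ℝ} (hv : v ∈ B.box) :
    ∃ y : List Bool, y.length ≤ 3 + (x.length + 1) * (2 * (A + 2) + 3) ∧ lhead y = [b] ∧
      |diff (entryVal y []) - 2 ^ (fine m x).length * t| ≤ 1 ∧
      ∀ i : Fin B.n, |diff (entryVal y (true :: unary i)) - 2 ^ (fine m x).length * v i| ≤ 1 := by
  set U : ℝ := 2 ^ (fine m x).length with hUdef
  have hU : 0 < U := by positivity
  have hfloor : ∀ a : ℝ, |(⌊a⌋ : ℝ) - a| ≤ 1 := fun a => by
    have f₁ := Int.floor_le a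
    have f₂ := Int.lt_floor_add_one a
    rw [abs_le]
    constructor <;> linarith
  let z : Fin (B.n + 1) → ℤ := fun l => ⌊U * (Fin.cons t v : Fin (B.n + 1) → ℝ) l⌋
  refine ⟨certificate b z, ?_, by rw [certificate, lhead_lcons], ?_, fun i => ?_⟩
  · refine (length_certificate_le b z (A + 2) fun l => ?_).trans ?_
    · refine Fin.cases ?_ (fun i => ?_) l
      · exact natAbs_floor_lt hU (by omega) hp hr h₁ h₂ hp₁ hp₂ hr₁ hr₂
      · have h₁ := hsize (.lo i)
        have h₂ := hsize (.hi i)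
        have hpow : 2 ^ A ≤ 2 ^ (A + 1) := Nat.pow_le_pow_right (by omega) (by omega)
        exact natAbs_floor_lt hU (by omega) ((loVal_close hrep hx i).le.trans (by norm_num))
          ((hiVal_close hrep hx i).le.trans (by norm_num)) (hv i).1 (hv i).2
          (h₁.1.trans_le hpow) (h₁.2.trans_le hpow) (h₂.1.trans_le hpow) (h₂.2.trans_le hpow)
    · have : B.n < x.length := by rw [hx]; simp [length_unary]; omega
      gcongr
  · have := diff_entryVal_certificate b z 0
    change diff (entryVal (certificate b z) []) = _ at this
    rw [this]
    exact hfloor (U * t)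
  · have := diff_entryVal_certificate b z i.succ
    rw [Fin.val_succ] at this
    change diff (entryVal (certificate b z) (true :: unary i)) = _ at this
    rw [this]
    exact hfloor (U * v i)

end Instance

/-- The approximations of the constants are exponentially bounded. -/
theorem exists_length_bound (g : Oracle) (m : Polynomial ℕ) :
    ∃ r : Polynomial ℕ, ∀ (x : List Bool) (n : ℕ), n ≤ x.length → ∀ τ : TermName n,
      (constVal g m x τ.code).1 < 2 ^ r.eval x.length ∧
      (constVal g m x τ.code).2 < 2 ^ r.eval x.length := by
  have h : FP g fun p : List Bool × List Bool => constVal g m p.1 p.2 := by fun_prop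
  obtain ⟨r, hr⟩ := h.polyLen
  refine ⟨r.comp (6 * .X + 58), fun x n hn τ => ?_⟩
  have h₁ := hr (x, τ.code)
  have h₂ := length_code_le τ
  simp only [length_enc_prod, length_enc_nat, enc_list] at h₁
  have h₃ := eval_mono_nat r (show 2 * x.length + 2 * τ.code.length + 2 ≤ 6 * x.length + 58 by
    omega)
  have e : (r.comp (6 * .X + 58)).eval x.length = r.eval (6 * x.length + 58) := by
    simp [Polynomial.eval_comp]
  rw [e, ← Nat.size_le, ← Nat.size_le]
  constructor <;> omega

end DeltaStab

end

/-! ### Solution of the stability problem -/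

theorem mainTheorem2 (C : Set (List Bool → List Bool)) (S : Set (List Bool))
    (sys : S → DeltaStab.BoundedSystem) (hterms : DeltaStab.TermsInClass C S sys) :
    ∃ L ∈ DeltaStab.SigmaPClass C 4, DeltaStab.SolvesStability S sys L := by
  open DeltaStab BoundedSystem in
  obtain ⟨θ, hθ, m, p, hlen, hterms⟩ := hterms
  let g : Oracle := ⟨θ, p, hlen⟩
  have hrep : ∀ w : S, Represents g m w.1 (sys w) := fun w τ => hterms ⟨w, τ⟩
  obtain ⟨r, hr⟩ := exists_length_bound g m
  obtain ⟨L, hL, hsolve⟩ := exists_mem_SigmaP_four (FP.refutes (g := g) (m := m))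
    -- The bound of `exists_certificate` with A = r + 4, where `r` bounds the bit lengths of the
    -- computed constants.
    (3 + (.X + 1) * (2 * ((r + 4) + 2) + 3))
  refine ⟨L, ⟨θ, hθ, hL⟩, fun w δ hδ => ?_⟩
  obtain ⟨h₁, h₂⟩ := hsolve (instanceCode S sys w δ)
  have hx : instanceCode S sys w δ = encodeList [w.1, unary (sys w).n, encodeRat δ] := rfl
  set x := instanceCode S sys w δ with hxdef
  set B := sys w with hB
  clear_value x
  constructor
  · intro hmem
    have hno := h₁ hmem
    simp only [Polynomial.eval_add, Polynomial.eval_mul, Polynomial.eval_ofNat, Polynomial.eval_X,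
      Polynomial.eval_one] at hno
    set A := r.eval x.length + 4 with hA
    have hpow : 2 ^ r.eval x.length ≤ 2 ^ A := Nat.pow_le_pow_right (by omega) (by omega)
    have hpow' : 2 ^ A ≤ 2 ^ (A + 1) := Nat.pow_le_pow_right (by omega) (by omega)
    have hsize : ∀ τ : TermName B.n, (constVal g m x τ.code).1 < 2 ^ A ∧
        (constVal g m x τ.code).2 < 2 ^ A := fun τ => by
      have := hr x B.n (by rw [hx]; simp [length_unary]; omega) τ
      exact ⟨this.1.trans_le hpow, this.2.trans_le hpow⟩
    refine B.aStable_isTrue (fun t ht₀ htT v hv hv₁ hbox => ?_) (fun s hs₁ hs₂ v hv hv₁ => ?_)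
    · by_contra! hge
      have hT := hsize (.bound .T)
      -- A real counterexample is rounded to a certificate; the tag `false` selects the check of
      -- Lyapunov stability.
      obtain ⟨y, hy, hb, hy₀, hyv⟩ := exists_certificate (hrep w) hx (by omega) hsize false
        (c := 0) (p := (0, 0)) ht₀ htT (by simp [diff])
        ((boundVal_close (hrep w) hx .T).le.trans (by norm_num)) (by positivity) (by positivity)
        (hT.1.trans_le hpow') (hT.2.trans_le hpow') hv
      have := hno y hy
      rw [refutes, hb] at this
      simp only [List.headD_cons, cond_false] at this
      rw [refutesStable_of_close (hrep w) hx ht₀ htT hv hv₁ hbox hge hy₀ hyv] at this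
      exact absurd this (by simp)
    · by_contra! hge
      have hT := hsize (.bound .T')
      have hδ := hsize (.bound .δ''lo)
      change (boundVal g m .T' x).1 < _ ∧ (boundVal g m .T' x).2 < _ at hT
      change (boundVal g m .δ''lo x).1 < _ ∧ (boundVal g m .δ''lo x).2 < _ at hδ
      have cT := abs_lt.mp (boundVal_close (hrep w) hx .T')
      have cδ := abs_lt.mp (boundVal_close (hrep w) hx .δ''lo)
      rw [pow_succ] at hpow'
      -- The endpoints T' ± δ₁'' are formed componentwise from two constants. This doubles the bound
      -- on the parts, and is the reason for the exponent A + 1 in `exists_certificate`.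
      obtain ⟨y, hy, hb, hy₀, hyv⟩ := exists_certificate (hrep w) hx (by omega) hsize true
        (p := ((boundVal g m .T' x).1 + (boundVal g m .δ''lo x).2,
          (boundVal g m .T' x).2 + (boundVal g m .δ''lo x).1))
        (r := ((boundVal g m .T' x).1 + (boundVal g m .δ''lo x).1,
          (boundVal g m .T' x).2 + (boundVal g m .δ''lo x).2)) hs₁ hs₂
        (by
          simp only [diff, Nat.cast_add] at cT cδ ⊢
          rw [abs_le, mul_sub]; constructor <;> linarith)
        (by
          simp only [diff, Nat.cast_add] at cT cδ ⊢
          rw [abs_le, mul_add]; constructor <;> linarith)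
        (by rw [pow_succ]; simp only; omega) (by rw [pow_succ]; simp only; omega)
        (by rw [pow_succ]; simp only; omega) (by rw [pow_succ]; simp only; omega) hv
      have := hno y hy
      rw [refutes, hb] at this
      simp only [List.headD_cons, cond_true] at this
      rw [refutesAttractive_of_close (hrep w) hx hs₁ hs₂ hv hv₁ hge hy₀ hyv] at this
      exact absurd this (by simp)
  · intro hmem
    obtain ⟨y, hy⟩ := h₂ hmem
    refine ⟨_, Formula.isPerturbation_strengthen (c := (2 : ℝ)⁻¹ ^ x.length) ?_ _, ?_⟩
    · rw [abs_of_pos (by positivity)]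
      have hq : (0 : ℝ) < δ := by exact_mod_cast hδ
      -- As the denominator is written in binary within `x`, it is smaller than 2^|x|; with
      -- numerator at least 1 this gives 2^(-|x|) ≤ δ.
      have hden : δ.den < 2 ^ x.length := by
        refine δ.den.lt_size_self.trans_le (Nat.pow_le_pow_right (by omega) ?_)
        rw [hx, ← Nat.size_eq_bits_len]
        simp [encodeRat]
        omega
      have hnum : (1 : ℝ) ≤ δ.num := by exact_mod_cast Rat.num_pos.mpr hδ
      have hd₀ : (0 : ℝ) < δ.den := by exact_mod_cast δ.den_pos
      have hd : (δ.den : ℝ) ≤ 2 ^ x.length := by exact_mod_cast hden.le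
      rw [Rat.cast_def, inv_pow, le_div_iff₀ hd₀]
      calc ((2 : ℝ) ^ x.length)⁻¹ * δ.den ≤ (2 ^ x.length)⁻¹ * 2 ^ x.length := by gcongr
        _ = 1 := inv_mul_cancel₀ (by positivity)
        _ ≤ δ.num := hnum
    · rw [refutes] at hy
      cases hb : (lhead y).headD false
      · rw [hb, cond_false] at hy
        exact not_strengthen_of_refutesStable (hrep w) hx hy
      · rw [hb, cond_true] at hy
        exact not_strengthen_of_refutesAttractive (hrep w) hx hy
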